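/- **Definitions.** A timed word over a finite alphabet $\Sigma$ is a finite sequence $w=(a_1,t_1)\dots(a_n,t_n)$ with $a_i\in\Sigma$ and $0\le t_1\le\dots\le t_n$ real; $\mathrm{dur}(w)=t_n$ (and $0$ for the empty word). For $v=(b_1,s_1)\dots(b_m,s_m)$ put $\overrightarrow d(w,v)=\max_i\min_j\{|t_i-s_j| : a_i=b_j\}$ (with $\min\emptyset=\infty$, $\max\emptyset=0$) and $d(w,v)=\max(\overrightarrow d(w,v),\overrightarrow d(v,w))$. For a set $L$ of timed words let $L_T=\{w\in L:\mathrm{dur}(w)\le T\}$. A subset $M\subseteq L$ is $\varepsilon$-separated if $d(x,y)>\varepsilon$ for all $x\ne y$ in $M$; a set $N$ of timed words is an $\varepsilon$-net of $L$ if every $y\in L$ has some $s\in N$ with $d(y,s)\le\varepsilon$. Let $\mathcal C_\varepsilon(L)$ be the base-2 logarithm of the largest cardinality of an $\varepsilon$-separated subset of $L$, $\mathcal H_\varepsilon(L)$ that of the smallest cardinality of an $\varepsilon$-net of $L$, and $\Upsilon(L)$ the largest cardinality of a $0$-separated subset of $L$. The capacitive and entropic bandwidths are $\mathcal{BC}_\varepsilon(L)=\limsup_{T\to\infty}\mathcal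 C_\varepsilon(L_T)/T$ and $\mathcal{BH}_\varepsilon(L)=\limsup_{T\to\infty}\mathcal H_\varepsilon(L_T)/T$. A simply-timed graph $\mathcal G=(Q,\Sigma,\Delta)$ consists of finite sets $Q$, $\Sigma$ and a finite set $\Delta\subset Q\times\mathbb Q_{\ge0}\times\Sigma\times Q$. Its language $L(\mathcal G)$ is the set of timed words $(a_1,t_1)\dots(a_n,t_n)$ for which there are states $q^0,\dots,q^n$ with $(q^{i-1},t_i-t_{i-1},a_i,q^i)\in\Delta$ for $1\le i\le n$, where $t_0=0$. Its growth rate is $\beta(\mathcal G)=\lim_{T\to\infty}\frac1T\log_2\Upsilon(L(\mathcal G)_T)$, when this limit exists and is finite. The $0$-elimination $\nu(\mathcal G)$ has states $Q$, alphabet $2^\Sigma\setminus\{\emptyset\}$, and a transition $(p,d,B,q)$ whenever $d>0$ and there are $k\ge0$ and $(p,d,a_0,q_0),(q_0,0,a_1,q_1),\dots,(q_{k-1},0,a_k,q_k)\in\Delta$ with $q_k=q$ and $B=\{a_0,\dots,a_k\}$. The determinization of a graph has as states the non-empty sets of states, with a transition $(S,d,a,S')$ whenever $S'\neq\emptyset$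 is the set of all destinations of transitions with delay $d$ and label $a$ from states of $S$. The adjacency matrix $M(z)$ of a graph has entries $m_{pq}(z)=\sum_{(p,d,a,q)\in\Delta}z^d$ (principal branch), and its characteristic quasi-polynomial is $\psi(z)=\det(I-M(z))$. **Theorem.** Let $\mathcal G$ be a simply-timed graph with non-empty language. Then: 1. The growth rate $\beta(\mathcal G)$ exists (and is finite), and there is $\varepsilon_0>0$ such that for all $0<\varepsilon<\varepsilon_0$ $$\mathcal{BC}_\varepsilon(L(\mathcal G))=\mathcal{BH}_\varepsilon(L(\mathcal G))=\beta(\mathcal G).$$ 2. Let $\psi$ be the characteristic quasi-polynomial of the determinization of $\nu(\mathcal G)$. Either $\psi$ has a complex root, and then it has a real root $z_0>0$ of smallest modulus among all complex roots and $\beta(\mathcal G)=-\log_2 z_0$; or $\psi$ has no complex root, and then $\beta(\mathcal G)=0$. 3. $\beta(\mathcal G)=\log_2\alpha$ for some real algebraic number $\alpha>0$, and $\alpha$ is computable from $\mathcal G$: there is a single computable function that, given any finite description of a simply-timed graph $\mathcal G$ with non-empty language (numbers of states and letters, list of transitions), outputs a non-zero integer polynomial and a closed interval with rational endpoints in which $\alpha$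 is the only real root of this polynomial. -/

import Mathlib

open scoped NNReal ENNReal Topology

noncomputable section

/-- Timed words over `A`: finite sequences of (letter, date) with non-decreasing dates. -/
def TimedWord (A : Type*) : Type _ :=
  {w : List (A × ℝ≥0) // (w.map Prod.snd).Pairwise (· ≤ ·)}

namespace TimedWord

variable {A : Type*}

/-- The duration of a timed word: its last date (`0` for the empty word). -/
def dur (w : TimedWord A) : ℝ≥0 := (w.1.map Prod.snd).getLastD 0

/-- The directed distance `max_i min_j {|t_i - s_j| : a_i = b_j}`, with `min ∅ = ∞`
(and `max ∅ = 0`). -/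
def ddist (w v : TimedWord A) : ℝ≥0∞ :=
  ⨆ x ∈ w.1, ⨅ y ∈ v.1, ⨅ _ : x.1 = y.1, edist x.2 y.2

/-- The pseudo-distance on timed words. -/
def dist (w v : TimedWord A) : ℝ≥0∞ := max (ddist w v) (ddist v w)

/-- The time-restricted language `L_T`. -/
def restrict (L : Set (TimedWord A)) (T : ℝ) : Set (TimedWord A) :=
  {w ∈ L | (w.dur : ℝ) ≤ T}

/-- `M` is an `ε`-separated subset of `L`. -/
def IsSeparatedIn (ε : ℝ≥0) (L M : Set (TimedWord A)) : Prop :=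
  M ⊆ L ∧ ∀ x ∈ M, ∀ y ∈ M, x ≠ y → (ε : ℝ≥0∞) < dist x y

/-- `N` is an `ε`-net of `L`; the points of `N` need not belong to `L`. -/
def IsNetOf (ε : ℝ≥0) (L N : Set (TimedWord A)) : Prop :=
  ∀ y ∈ L, ∃ s ∈ N, dist y s ≤ (ε : ℝ≥0∞)

/-- The largest cardinality of an `ε`-separated subset of `L`. -/
def maxSeparated (ε : ℝ≥0) (L : Set (TimedWord A)) : ℕ∞ :=
  ⨆ M ∈ {M | IsSeparatedIn ε L M}, M.encard

/-- The smallest cardinality of an `ε`-net of `L`. -/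
def minNet (ε : ℝ≥0) (L : Set (TimedWord A)) : ℕ∞ :=
  ⨅ N ∈ {N | IsNetOf ε L N}, N.encard

/-- Logarithm in base 2 of a possibly infinite cardinality (`log 0 = -∞`, `log ∞ = ∞`). -/
def log2 (n : ℕ∞) : EReal := ENNReal.log (n : ℝ≥0∞) / ((Real.log 2 : ℝ) : EReal)

/-- The `ε`-capacity. -/
def capacity (ε : ℝ≥0) (L : Set (TimedWord A)) : EReal := log2 (maxSeparated ε L)

/-- The `ε`-entropy. -/
def entropy (ε : ℝ≥0) (L : Set (TimedWord A)) : EReal := log2 (minNet ε L)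

/-- The `ε`-capacitive bandwidth. -/
def capacitiveBandwidth (ε : ℝ≥0) (L : Set (TimedWord A)) : EReal :=
  Filter.limsup (fun T : ℝ => capacity ε (restrict L T) / (T : EReal)) Filter.atTop

/-- The `ε`-entropic bandwidth. -/
def entropicBandwidth (ε : ℝ≥0) (L : Set (TimedWord A)) : EReal :=
  Filter.limsup (fun T : ℝ => entropy ε (restrict L T) / (T : EReal)) Filter.atTop

/-- The size of a set of timed words: the largest cardinality of a `0`-separated subset. -/
def size (L : Set (TimedWord A)) : ℕ∞ := maxSeparated 0 L

end TimedWord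

/-- A simply-timed graph with states `Q` and alphabet `A` (both finite where it matters):
a finite set of transitions (origin, delay, label, destination). -/
structure STG (Q A : Type*) where
  trans : Finset (Q × ℚ≥0 × A × Q)

namespace STG

variable {Q A : Type*}

/-- `G.RunOn q s w`: starting in state `q` at date `s`, there is a run on the sequence `w` of
dated letters. -/
def RunOn (G : STG Q A) : Q → ℝ≥0 → List (A × ℝ≥0) → Prop
  | _, _, [] => True
  | q, s, (a, t) :: w =>
      ∃ (d : ℚ≥0) (q' : Q), (q, d, a, q') ∈ G.trans ∧ t = s + (d : ℝ≥0) ∧ G.RunOn q' t w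

/-- The timed language of `G`: every state is initial and final, and time starts at `0`. -/
def language (G : STG Q A) : Set (TimedWord A) := {w | ∃ q, G.RunOn q 0 w.1}

/-- `β` is the growth rate of `G`: the limit of `log Υ(L_T) / T` exists and is the real `β`. -/
def HasGrowthRate (G : STG Q A) (β : ℝ) : Prop :=
  Filter.Tendsto
    (fun T : ℝ => TimedWord.log2 (TimedWord.size (TimedWord.restrict G.language T)) / (T : EReal))
    Filter.atTop (𝓝 (β : EReal))

/-- A path of instantaneous transitions reading the given letters. -/
def ZeroPath (G : STG Q A) : Q → List A → Q → Prop
  | p, [], q => p = q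
  | p, a :: l, q => ∃ p', (p, 0, a, p') ∈ G.trans ∧ G.ZeroPath p' l q

/-- The delays occurring in `G`. -/
def delays (G : STG Q A) : Finset ℚ≥0 := G.trans.image fun t => t.2.1

open Classical in
/-- 0-elimination: each transition of positive delay is combined with a subsequent (possibly
empty) path of instantaneous transitions, and labelled by the set of letters read. -/
def zeroElim [Fintype Q] [Fintype A] (G : STG Q A) : STG Q {B : Finset A // B.Nonempty} where
  trans := (Finset.univ ×ˢ G.delays ×ˢ Finset.univ ×ˢ Finset.univ).filter fun t =>
    0 < t.2.1 ∧ ∃ (a : A) (q₀ : Q) (l : List A),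
      (t.1, t.2.1, a, q₀) ∈ G.trans ∧ G.ZeroPath q₀ l t.2.2.2 ∧
        ∀ x, x ∈ t.2.2.1.1 ↔ x ∈ a :: l

/-- Determinization by the subset construction: states are the non-empty sets of states, and
reading `(d, a)` leads from `S` to the set of all `(d, a)`-successors of `S`, if non-empty. -/
def determinize [Fintype Q] [Fintype A] (G : STG Q A) : STG {S : Finset Q // S.Nonempty} A where
  trans := open Classical in
    (Finset.univ ×ˢ G.delays ×ˢ Finset.univ ×ˢ Finset.univ).filter fun t =>
      ∀ q, q ∈ t.2.2.2.1 ↔ ∃ p ∈ t.1.1, (p, t.2.1, t.2.2.1, q) ∈ G.trans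

open Classical in
/-- The adjacency matrix `M_G(z)`, with entries `∑ z ^ d` over the transitions from `i` to `j`
(principal branch of the power). -/
def adjMatrix (G : STG Q A) (z : ℂ) : Matrix Q Q ℂ := fun i j =>
  ∑ t ∈ G.trans with t.1 = i ∧ t.2.2.2 = j, z ^ ((t.2.1 : ℚ≥0) : ℂ)

open Classical in
/-- The characteristic quasi-polynomial `det (I - M_G(z))`. -/
def charQuasiPoly [Fintype Q] (G : STG Q A) (z : ℂ) : ℂ := (1 - G.adjMatrix z).det

end STG

/-- The non-negative rational number `p / (q + 1)` coded by a pair `(p, q)`. -/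
def ratOfCode (c : ℕ × ℕ) : ℚ≥0 := (c.1 : ℚ≥0) / ((c.2 : ℚ≥0) + 1)

/-- Finite descriptions of simply-timed graphs: number of states, number of letters, and the list
of transitions, states and letters being numbered from `0`. -/
abbrev STGCode : Type := ℕ × ℕ × List (ℕ × (ℕ × ℕ) × ℕ × ℕ)

/-- `c` describes `G`, for some numbering of the states and of the letters. -/
def STGCode.Describes {Q A : Type*} (c : STGCode) (G : STG Q A) : Prop :=
  ∃ (eQ : Q ≃ Fin c.1) (eA : A ≃ Fin c.2.1),
    (∀ t ∈ G.trans, ∃ x ∈ c.2.2,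
      x.1 = eQ t.1 ∧ ratOfCode x.2.1 = t.2.1 ∧ x.2.2.1 = eA t.2.2.1 ∧ x.2.2.2 = eQ t.2.2.2) ∧
    (∀ x ∈ c.2.2, ∃ t ∈ G.trans,
      x.1 = eQ t.1 ∧ ratOfCode x.2.1 = t.2.1 ∧ x.2.2.1 = eA t.2.2.1 ∧ x.2.2.2 = eQ t.2.2.2)

/-- Exact finite descriptions of non-negative real algebraic numbers: the coefficients of an
integer polynomial, constant term first, each given as a difference of two natural numbers, and
the two rational endpoints of an isolating interval. -/
abbrev AlgCode : Type := List (ℕ × ℕ) × (ℕ × ℕ) × (ℕ × ℕ)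

/-- The integer polynomial with the given list of coefficients. -/
def polyOfCode : List (ℕ × ℕ) → Polynomial ℤ
  | [] => 0
  | c :: l => Polynomial.C ((c.1 : ℤ) - (c.2 : ℤ)) + Polynomial.X * polyOfCode l

/-- `α` is the number described by `c`: the polynomial is non-zero, and `α` is its only real root
in the given closed interval. -/
def AlgCode.Describes (c : AlgCode) (α : ℝ) : Prop :=
  polyOfCode c.1 ≠ 0 ∧
    {x : ℝ | (ratOfCode c.2.1 : ℝ) ≤ x ∧ x ≤ (ratOfCode c.2.2 : ℝ) ∧
      Polynomial.aeval x (polyOfCode c.1) = 0} = {α}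

end

/-! The delays have a common denominator `D`, so all dates of the language are multiples of `1 / D`.
The distance sees a word only through its set of events (pairs letter, date): equal sets are at
distance `0`. Conversely, for `ε < 1 / (2 D)`, two words of the language within `ε` of a common
timed word have the same events. So for all such `ε`, including `0`, the largest separated set and
the smallest net of the words of duration at most `T` both have as many elements as there are event
sets (`OnGrid.maxSeparated_eq`, `OnGrid.minNet_eq`). With time counted in ticks this number is `U
n`, where `n = ⌊T D⌋`, and part 1 asks for its exponential growth. Cutting a run at tick `n` gives
`U (n + m) ≤ C * U n * U m` (`ncard_eventSets_add_le`). Fekete's lemma yields a rate `γ ≥ 1`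
together with the bound `γ ^ n ≤ C * U n` (`exists_isGrowth`), and `β = log₂ (γ ^ D)`.

For part 2, an event set splits uniquely into the letters at date `0` and a word of the
0-elimination, which the determinization reads without multiplicity. The generating functions `f` of
the word counts therefore satisfy `f = 1 + M f` with `M` the adjacency matrix in the variable `w = z
^ (1 / D)`. Where `f` converges, `det (1 - M)` has no zero on the closed disc
(`IsPathCount.det_ne_zero`). If the determinant does not vanish at `1 / γ`, Cramer's rule keeps `f`
bounded and the series converge there (`IsPathCount.summable_of_det_ne_zero`). The bound `γ ^ n ≤ C
* U n` allows this only when `γ = 1` and the word counts are eventually zero, and then there is no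
root at all (`STG.smallest_root`).

For part 3, `n ↦ U (D n)` is computable, by enumeration of runs, and satisfies a linear recurrence
of bounded order. Its growth rate `α = γ ^ D` is a root of any annihilating polynomial
(`IsGrowth.isRoot`). A finite certificate, checkable in integer arithmetic, pins `α` down as the
only root of a polynomial in a rational interval (`RootCert.Valid.describes`). Certificates always
exist (`exists_valid_rootCert`), so an unbounded search finds one. -/

namespace TimedWord

/-! ### Separated sets and nets on a time grid -/

variable {A : Type*}

/-- The set of dated letters of a timed word. -/
def events (w : TimedWord A) : Set (A × ℝ≥0) := {x | x ∈ w.1}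

theorem exists_edist_lt_of_ddist_lt {w v : TimedWord A} {r : ℝ≥0∞} (h : ddist w v < r)
    {x : A × ℝ≥0} (hx : x ∈ w.1) : ∃ y ∈ v.1, x.1 = y.1 ∧ edist x.2 y.2 < r := by
  have h1 : (⨅ y ∈ v.1, ⨅ _ : x.1 = y.1, edist x.2 y.2) < r :=
    lt_of_le_of_lt (le_iSup₂ (f := fun (x : A × ℝ≥0) (_ : x ∈ w.1) =>
      ⨅ y ∈ v.1, ⨅ _ : x.1 = y.1, edist x.2 y.2) x hx) h
  simp only [iInf_lt_iff] at h1
  obtain ⟨y, hy, he, hlt⟩ := h1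
  exact ⟨y, hy, he, hlt⟩

theorem ddist_eq_zero_of_subset {w v : TimedWord A} (h : events w ⊆ events v) :
    ddist w v = 0 := by
  refine le_antisymm (iSup₂_le fun x hx => ?_) zero_le
  exact (iInf₂_le x (h hx)).trans ((iInf_le _ rfl).trans (by simp))

theorem dist_eq_zero_of_events_eq {w v : TimedWord A} (h : events w = events v) :
    dist w v = 0 := by
  simp [dist, ddist_eq_zero_of_subset h.le, ddist_eq_zero_of_subset h.ge]

/-- Words with equal events are at distance `0`, so a separated set contains at most one word per
event set. By the hypothesis, one representative per event set is separated. -/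
theorem maxSeparated_eq_encard_events {L : Set (TimedWord A)} {ε : ℝ≥0}
    (h : ∀ x ∈ L, ∀ y ∈ L, dist x y ≤ ε → events x = events y) :
    maxSeparated ε L = (events '' L).encard := by
  apply le_antisymm
  · refine iSup₂_le fun M hM => ?_
    have hinj : Set.InjOn events M := by
      intro x hx y hy hxy
      by_contra hne
      have := hM.2 x hx y hy hne
      rw [dist_eq_zero_of_events_eq hxy] at this
      exact absurd this (by simp)
    rw [← hinj.encard_image]
    exact Set.encard_le_encard (Set.image_mono hM.1)
  · obtain ⟨M, hML, hM⟩ := (Set.surjOn_image events L).exists_bijOn_subset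
    rw [← hM.image_eq, hM.injOn.encard_image]
    refine le_iSup₂ (f := fun (M : Set (TimedWord A)) (_ : M ∈ {M | IsSeparatedIn ε L M}) =>
      M.encard) M ⟨hML, fun x hx y hy hne => ?_⟩
    by_contra hle
    exact hne (hM.injOn hx hy (h x (hML hx) y (hML hy) (not_lt.mp hle)))

/-- Representatives of the event sets form a net with distances `0`. In the other direction, one net
point cannot serve two event sets. The hypothesis involves a third word `s` because net points may
lie outside `L`. -/
theorem minNet_eq_encard_events {L : Set (TimedWord A)} {ε : ℝ≥0}
    (h : ∀ x ∈ L, ∀ y ∈ L, ∀ s, dist x s ≤ ε → dist y s ≤ ε → events x = events y) :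
    minNet ε L = (events '' L).encard := by
  apply le_antisymm
  · obtain ⟨M, hML, hM⟩ := (Set.surjOn_image events L).exists_bijOn_subset
    rw [← hM.image_eq, hM.injOn.encard_image]
    refine iInf₂_le (f := fun (N : Set (TimedWord A)) (_ : N ∈ {N | IsNetOf ε L N}) =>
      N.encard) M fun y hy => ?_
    obtain ⟨s, hs, hsy⟩ := hM.surjOn (Set.mem_image_of_mem events hy)
    exact ⟨s, hs, by simp [dist_eq_zero_of_events_eq hsy.symm]⟩
  · refine le_iInf₂ fun N hN => ?_
    have key : ∀ e : Set (A × ℝ≥0), ∃ s : TimedWord A, e ∈ events '' L →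
        s ∈ N ∧ ∃ y ∈ L, events y = e ∧ dist y s ≤ ε := by
      intro e
      by_cases he : e ∈ events '' L
      · obtain ⟨y, hy, rfl⟩ := he
        obtain ⟨s, hs, hd⟩ := hN y hy
        exact ⟨s, fun _ => ⟨hs, y, hy, rfl, hd⟩⟩
      · exact ⟨⟨[], by simp⟩, fun h => absurd h he⟩
    choose f hf using key
    refine Set.encard_le_encard_of_injOn (f := f) (fun e he => (hf e he).1) ?_
    intro e he e' he' hee
    obtain ⟨-, y, hy, rfl, hd⟩ := hf e he
    obtain ⟨-, y', hy', rfl, hd'⟩ := hf e' he'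
    exact h y hy y' hy' _ hd (hee ▸ hd')

/-- All dates of the words of `L` are multiples of `1 / D`. -/
def OnGrid (D : ℕ) (L : Set (TimedWord A)) : Prop :=
  ∀ w ∈ L, ∀ x ∈ w.1, ∃ j : ℕ, x.2 * D = j

theorem eq_of_edist_lt_of_grid {D : ℕ} (hD : 0 < D) {s t : ℝ≥0} (hs : ∃ j : ℕ, s * D = j)
    (ht : ∃ j : ℕ, t * D = j) (h : edist s t < ENNReal.ofReal (1 / D)) : s = t := by
  obtain ⟨i, hi⟩ := hs
  obtain ⟨j, hj⟩ := ht
  have hD' : (0 : ℝ) < D := by exact_mod_cast hD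
  rw [edist_dist, ENNReal.ofReal_lt_ofReal_iff (by positivity), NNReal.dist_eq,
    lt_div_iff₀ hD'] at h
  have hi' : (s : ℝ) * D = i := by exact_mod_cast congrArg NNReal.toReal hi
  have hj' : (t : ℝ) * D = j := by exact_mod_cast congrArg NNReal.toReal hj
  have h2 : |((i : ℤ) - (j : ℤ) : ℝ)| < 1 := by
    push_cast
    rw [← hi', ← hj', ← sub_mul, abs_mul, abs_of_pos hD']
    exact h
  have h3 : (i : ℤ) - j = 0 := by
    rw [← Int.abs_lt_one_iff]
    exact_mod_cast h2
  have h4 : i = j := by omega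
  subst h4
  have : (s : ℝ) = t := mul_right_cancel₀ hD'.ne' (hi'.trans hj'.symm)
  exact_mod_cast this

/-- An event of `x` is matched in `s`, and that one in `y`, with the same letter and a total error
below `1 / D`. On the grid this error is `0`. The word `s` need not be on the grid, which is why
half a tick is required. -/
theorem OnGrid.events_eq_of_dist_lt {D : ℕ} (hD : 0 < D) {L : Set (TimedWord A)}
    (hL : OnGrid D L) {x y s : TimedWord A} (hx : x ∈ L) (hy : y ∈ L)
    (hxs : dist x s < ENNReal.ofReal (1 / (2 * D)))
    (hys : dist y s < ENNReal.ofReal (1 / (2 * D))) : events x = events y := by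
  have hhalf : ENNReal.ofReal (1 / (2 * D)) + ENNReal.ofReal (1 / (2 * D))
      = ENNReal.ofReal (1 / D) := by
    rw [← ENNReal.ofReal_add (by positivity) (by positivity)]
    congr 1
    field_simp
    norm_num
  have key : ∀ x y : TimedWord A, x ∈ L → y ∈ L →
      dist x s < ENNReal.ofReal (1 / (2 * D)) → dist y s < ENNReal.ofReal (1 / (2 * D)) →
      events x ⊆ events y := by
    intro x y hx hy hxs hys e he
    obtain ⟨u, hu, h1, h2⟩ := exists_edist_lt_of_ddist_lt (lt_of_le_of_lt (le_max_left _ _) hxs) he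
    obtain ⟨v, hv, h3, h4⟩ := exists_edist_lt_of_ddist_lt (lt_of_le_of_lt (le_max_right _ _) hys) hu
    have h5 : e.2 = v.2 := by
      refine eq_of_edist_lt_of_grid hD (hL x hx e he) (hL y hy v hv) ?_
      rw [← hhalf]
      exact lt_of_le_of_lt (edist_triangle _ u.2 _) (ENNReal.add_lt_add h2 h4)
    have : e = v := Prod.ext (h1.trans h3) h5
    rw [this]
    exact hv
  exact Set.Subset.antisymm (key x y hx hy hxs hys) (key y x hy hx hys hxs)

theorem OnGrid.maxSeparated_eq {D : ℕ} (hD : 0 < D) {L : Set (TimedWord A)}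
    (hL : OnGrid D L) {ε : ℝ≥0} (hε : (ε : ℝ) < 1 / (2 * D)) :
    maxSeparated ε L = (events '' L).encard := by
  refine maxSeparated_eq_encard_events fun x hx y hy h => ?_
  refine hL.events_eq_of_dist_lt hD (s := y) hx hy (lt_of_le_of_lt h ?_) ?_
  · rw [← ENNReal.ofReal_coe_nnreal]
    exact (ENNReal.ofReal_lt_ofReal_iff (by positivity)).2 hε
  · rw [dist_eq_zero_of_events_eq rfl]
    exact ENNReal.ofReal_pos.2 (by positivity)

theorem OnGrid.minNet_eq {D : ℕ} (hD : 0 < D) {L : Set (TimedWord A)}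
    (hL : OnGrid D L) {ε : ℝ≥0} (hε : (ε : ℝ) < 1 / (2 * D)) :
    minNet ε L = (events '' L).encard := by
  have hε' : (ε : ℝ≥0∞) < ENNReal.ofReal (1 / (2 * D)) := by
    rw [← ENNReal.ofReal_coe_nnreal]
    exact (ENNReal.ofReal_lt_ofReal_iff (by positivity)).2 hε
  exact minNet_eq_encard_events fun x hx y hy s h h' =>
    hL.events_eq_of_dist_lt hD hx hy (h.trans_lt hε') (h'.trans_lt hε')

end TimedWord

/-! ### Event sets of runs, with time counted in ticks -/

/-- Delay the events of `E` by `k` ticks. -/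
def shiftBy {A : Type*} (k : ℕ) (E : Set (A × ℕ)) : Set (A × ℕ) :=
  Set.image (fun x => (x.1, x.2 + k)) E

/-- `EventRun Δ q n E`: some run from `q` in the graph with integer delays `Δ` has duration `n`
and set of dated letters `E`. -/
inductive EventRun {Q A : Type*} (Δ : Set (Q × ℕ × A × Q)) : Q → ℕ → Set (A × ℕ) → Prop
  | nil (q : Q) : EventRun Δ q 0 ∅
  | cons {q : Q} {k : ℕ} {a : A} {q' : Q} {n : ℕ} {E : Set (A × ℕ)} :
      (q, k, a, q') ∈ Δ → EventRun Δ q' n E →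
        EventRun Δ q (n + k) (shiftBy k (insert (a, 0) E))

/-- The event sets of duration at most `n`. -/
def eventSets {Q A : Type*} (Δ : Set (Q × ℕ × A × Q)) (n : ℕ) : Set (Set (A × ℕ)) :=
  {E | ∃ q, ∃ m ≤ n, EventRun Δ q m E}

namespace STG

variable {Q A : Type*}

/-- The transitions of `G`, with delays counted in multiples of `1 / D`. -/
def ticks (G : STG Q A) (D : ℕ) : Set (Q × ℕ × A × Q) :=
  {t | ∃ d : ℚ≥0, (t.1, d, t.2.2.1, t.2.2.2) ∈ G.trans ∧ (t.2.1 : ℚ≥0) = d * D}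

/-- All delays of `G` are multiples of `1 / D`. -/
def IsDenom (G : STG Q A) (D : ℕ) : Prop :=
  0 < D ∧ ∀ t ∈ G.trans, ∃ k : ℕ, (k : ℚ≥0) = t.2.1 * D

theorem exists_isDenom (G : STG Q A) : ∃ D, G.IsDenom D := by
  refine ⟨∏ t ∈ G.trans, t.2.1.den, Finset.prod_pos fun t _ => t.2.1.den_pos, fun t ht => ?_⟩
  obtain ⟨m, hm⟩ := Finset.dvd_prod_of_mem (fun t : Q × ℚ≥0 × A × Q => t.2.1.den) ht
  refine ⟨t.2.1.num * m, ?_⟩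
  rw [hm]
  push_cast
  rw [← mul_assoc, NNRat.mul_den_eq_num]

/-- The dated letter at tick `x.2` after date `s`. -/
noncomputable def tickDate (D : ℕ) (s : ℝ≥0) (x : A × ℕ) : A × ℝ≥0 := (x.1, s + x.2 / D)

theorem tickDate_injective {D : ℕ} (hD : 0 < D) (s : ℝ≥0) :
    Function.Injective (tickDate (A := A) D s) := by
  intro x y h
  simp only [tickDate, Prod.mk.injEq, add_right_inj] at h
  have hD' : (D : ℝ≥0) ≠ 0 := by exact_mod_cast hD.ne'
  refine Prod.ext h.1 ?_
  have := (div_left_inj' hD').1 h.2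
  exact_mod_cast this

theorem tickDate_image_shiftBy {D : ℕ} (s : ℝ≥0) (k : ℕ) (E : Set (A × ℕ)) :
    tickDate D s '' shiftBy k E = tickDate D (s + k / D) '' E := by
  rw [shiftBy, Set.image_image]
  congr 1
  funext x
  simp only [tickDate, Prod.mk.injEq, true_and]
  push_cast
  rw [add_div, add_comm (_ / _) (_ / (D : ℝ≥0)), add_assoc]

theorem nnrat_cast_eq_div {D : ℕ} (hD : 0 < D) {d : ℚ≥0} {k : ℕ} (h : (k : ℚ≥0) = d * D) :
    (d : ℝ≥0) = k / D := by
  have hD' : (D : ℝ≥0) ≠ 0 := by exact_mod_cast hD.ne'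
  rw [eq_div_iff hD']
  exact_mod_cast congrArg (fun r : ℚ≥0 => (r : ℝ≥0)) h.symm

theorem RunOn.exists_eventRun {G : STG Q A} {D : ℕ} (hG : G.IsDenom D) :
    ∀ {q : Q} {s : ℝ≥0} {w : List (A × ℝ≥0)}, G.RunOn q s w →
      ∃ n E, EventRun (G.ticks D) q n E ∧ {x | x ∈ w} = tickDate D s '' E ∧
        (w.map Prod.snd).getLastD s = s + n / D
  | q, s, [], _ => ⟨0, ∅, .nil q, by simp, by simp; rfl⟩
  | q, s, (a, t) :: w, h => by
    obtain ⟨d, q', hd, rfl, hr⟩ := h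
    obtain ⟨k, hk⟩ := hG.2 _ hd
    obtain ⟨n, E, hE, hw, hl⟩ := hr.exists_eventRun hG
    have hdk := nnrat_cast_eq_div hG.1 hk
    refine ⟨n + k, _, .cons (a := a) ⟨d, hd, hk⟩ hE, ?_, ?_⟩
    · rw [tickDate_image_shiftBy, ← hdk, Set.image_insert_eq, ← hw]
      ext x
      simp [tickDate]
    · rw [List.map_cons, List.getLastD_cons, hl, hdk]
      push_cast
      rw [add_div]
      ring

theorem RunOn.pairwise {G : STG Q A} : ∀ {q : Q} {s : ℝ≥0} {w : List (A × ℝ≥0)},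
    G.RunOn q s w → (∀ x ∈ w, s ≤ x.2) ∧ (w.map Prod.snd).Pairwise (· ≤ ·)
  | _, _, [], _ => by simp
  | q, s, (a, t) :: w, h => by
    obtain ⟨d, q', hd, rfl, hr⟩ := h
    obtain ⟨h1, h2⟩ := hr.pairwise
    have hs : s ≤ s + (d : ℝ≥0) := le_self_add
    constructor
    · intro x hx
      rcases List.mem_cons.1 hx with rfl | hx
      · exact hs
      · exact hs.trans (h1 x hx)
    · rw [List.map_cons, List.pairwise_cons]
      refine ⟨fun t ht => ?_, h2⟩
      obtain ⟨x, hx, rfl⟩ := List.mem_map.1 ht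
      exact h1 x hx

theorem exists_runOn_of_eventRun {G : STG Q A} {D : ℕ} (hG : G.IsDenom D) {q : Q} {n : ℕ}
    {E : Set (A × ℕ)} (h : EventRun (G.ticks D) q n E) : ∀ s : ℝ≥0,
      ∃ w : List (A × ℝ≥0), G.RunOn q s w ∧ {x | x ∈ w} = tickDate D s '' E ∧
        (w.map Prod.snd).getLastD s = s + n / D := by
  induction h with
  | nil q => exact fun s => ⟨[], trivial, by simp, by simp; rfl⟩
  | @cons q k a q' n E ht _ ih =>
    intro s
    obtain ⟨d, hd, hk⟩ := ht
    have hdk := nnrat_cast_eq_div hG.1 hk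
    obtain ⟨w, hw, he, hl⟩ := ih (s + (d : ℝ≥0))
    refine ⟨(a, s + (d : ℝ≥0)) :: w, ⟨d, q', hd, rfl, hw⟩, ?_, ?_⟩
    · dsimp only at hdk
      rw [tickDate_image_shiftBy, ← hdk, Set.image_insert_eq, ← he]
      ext x
      simp [tickDate]
    · rw [List.map_cons, List.getLastD_cons, hl, hdk]
      push_cast
      rw [add_div]
      ring

theorem onGrid_language {G : STG Q A} {D : ℕ} (hG : G.IsDenom D) :
    TimedWord.OnGrid D G.language := by
  rintro w ⟨q, hq⟩ x hx
  obtain ⟨n, E, -, he, -⟩ := hq.exists_eventRun hG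
  have hx' : x ∈ tickDate D 0 '' E := he ▸ hx
  obtain ⟨y, -, rfl⟩ := hx'
  have hD' : (D : ℝ≥0) ≠ 0 := by exact_mod_cast hG.1.ne'
  exact ⟨y.2, by simp [tickDate, hD']⟩

theorem onGrid_restrict {G : STG Q A} {D : ℕ} (hG : G.IsDenom D) (T : ℝ) :
    TimedWord.OnGrid D (TimedWord.restrict G.language T) :=
  fun w hw => onGrid_language hG w hw.1

theorem events_image_restrict {G : STG Q A} {D : ℕ} (hG : G.IsDenom D) {T : ℝ} (hT : 0 ≤ T) :
    TimedWord.events '' TimedWord.restrict G.language T =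
      (fun E => tickDate D 0 '' E) '' eventSets (G.ticks D) ⌊T * D⌋₊ := by
  have hD' : (0 : ℝ) < D := by exact_mod_cast hG.1
  have hle : ∀ n : ℕ, ((0 + n / D : ℝ≥0) : ℝ) ≤ T ↔ n ≤ ⌊T * D⌋₊ := by
    intro n
    rw [Nat.le_floor_iff (by positivity), zero_add]
    push_cast
    rw [div_le_iff₀ hD']
  ext e
  constructor
  · rintro ⟨w, ⟨⟨q, hq⟩, hw⟩, rfl⟩
    obtain ⟨n, E, hE, he, hl⟩ := hq.exists_eventRun hG
    refine ⟨E, ⟨q, n, ?_, hE⟩, he.symm⟩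
    rw [← hle, ← hl]
    exact hw
  · rintro ⟨E, ⟨q, n, hn, hE⟩, rfl⟩
    obtain ⟨w, hw, he, hl⟩ := exists_runOn_of_eventRun hG hE 0
    refine ⟨⟨w, hw.pairwise.2⟩, ⟨⟨q, hw⟩, ?_⟩, he⟩
    rw [← hle, ← hl] at hn
    exact hn

theorem encard_events_restrict {G : STG Q A} {D : ℕ} (hG : G.IsDenom D) {T : ℝ} (hT : 0 ≤ T) :
    (TimedWord.events '' TimedWord.restrict G.language T).encard =
      (eventSets (G.ticks D) ⌊T * D⌋₊).encard := by
  rw [events_image_restrict hG hT]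
  exact ((tickDate_injective hG.1 0).image_injective).encard_image _

end STG

/-! ### Cutting runs: almost submultiplicativity -/

section EventRun

variable {Q A : Type*} {Δ : Set (Q × ℕ × A × Q)}

theorem EventRun.le_of_mem {q : Q} {n : ℕ} {E : Set (A × ℕ)} (h : EventRun Δ q n E) :
    ∀ x ∈ E, x.2 ≤ n := by
  induction h with
  | nil => simp
  | cons _ _ ih =>
    rintro x ⟨y, hy, rfl⟩
    rcases hy with rfl | hy
    · simp
    · simpa using ih y hy

/-- Every transition emits a letter on arrival, so the duration of a run can be read off its event
set. This is what makes the gluing map in `ncard_eventSets_add_le` well defined on event sets. -/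
theorem EventRun.isGreatest {q : Q} {n : ℕ} {E : Set (A × ℕ)} (h : EventRun Δ q n E) :
    (E = ∅ ∧ n = 0) ∨ IsGreatest (Prod.snd '' E) n := by
  induction h with
  | nil => exact Or.inl ⟨rfl, rfl⟩
  | @cons _ k a q' n E ht hE ih =>
    right
    constructor
    · suffices h : ∃ y ∈ insert (a, 0) E, y.2 = n by
        obtain ⟨y, hy, rfl⟩ := h
        exact ⟨(y.1, y.2 + k), ⟨y, hy, rfl⟩, rfl⟩
      rcases ih with ⟨rfl, rfl⟩ | h
      · exact ⟨(a, 0), by simp, rfl⟩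
      · obtain ⟨y, hy, rfl⟩ := h.1
        exact ⟨y, Set.mem_insert_of_mem _ hy, rfl⟩
    · rintro _ ⟨x, hx, rfl⟩
      exact (EventRun.cons ht hE).le_of_mem x hx

/-- The last tick of an event set. -/
noncomputable def lastTick (E : Set (A × ℕ)) : ℕ := sSup (Prod.snd '' E)

theorem EventRun.lastTick_eq {q : Q} {n : ℕ} {E : Set (A × ℕ)} (h : EventRun Δ q n E) :
    lastTick E = n := by
  rcases h.isGreatest with ⟨rfl, rfl⟩ | h
  · simp [lastTick]
  · exact h.csSup_eq

theorem shiftBy_shiftBy (j k : ℕ) (E : Set (A × ℕ)) :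
    shiftBy k (shiftBy j E) = shiftBy (j + k) E := by
  simp [shiftBy, Set.image_image, add_assoc]

theorem shiftBy_union (k : ℕ) (E F : Set (A × ℕ)) :
    shiftBy k (E ∪ F) = shiftBy k E ∪ shiftBy k F := Set.image_union _ _ _

/-- The cut is made at the transition that crosses tick `n`: it starts at `d₁ ≤ n` and ends at `d₁ +
k > n`. -/
theorem EventRun.split {q : Q} {d : ℕ} {E : Set (A × ℕ)} (h : EventRun Δ q d E) :
    ∀ n < d, ∃ d₁ E₁ k a q₁ q₂ d₂ E₂, EventRun Δ q d₁ E₁ ∧ d₁ ≤ n ∧ (q₁, k, a, q₂) ∈ Δ ∧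
      EventRun Δ q₂ d₂ E₂ ∧ d₁ + k + d₂ = d ∧ n < d₁ + k ∧
      E = E₁ ∪ shiftBy (d₁ + k) (insert (a, 0) E₂) := by
  induction h with
  | nil => exact fun n hn => absurd hn (by simp)
  | @cons q k a q' d E ht hE ih =>
    intro n hn
    by_cases hk : n < k
    · exact ⟨0, ∅, k, a, q, q', d, E, .nil q, by simp, ht, hE, by omega, by omega, by simp⟩
    · obtain ⟨d₁, E₁, k₁, a₁, q₁, q₂, d₂, E₂, h₁, hd₁, ht₁, h₂, hd, hlt, rfl⟩ :=
        ih (n - k) (by omega)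
      refine ⟨d₁ + k, _, k₁, a₁, q₁, q₂, d₂, E₂, .cons ht h₁, by omega, ht₁, h₂, by omega,
        by omega, ?_⟩
      rw [← Set.insert_union, shiftBy_union, shiftBy_shiftBy]
      congr 2
      omega

theorem finite_eventSets [Finite A] (n : ℕ) : (eventSets Δ n).Finite := by
  refine ((Set.finite_univ (α := A)).prod (Set.finite_Iic n)).finite_subsets.subset ?_
  rintro E ⟨q, m, hm, hE⟩ x hx
  exact ⟨trivial, (hE.le_of_mem x hx).trans hm⟩

theorem ncard_eventSets_pos [Finite A] [Nonempty Q] (n : ℕ) : 1 ≤ (eventSets Δ n).ncard := by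
  rw [Nat.one_le_iff_ne_zero, ← Nat.pos_iff_ne_zero, Set.ncard_pos (finite_eventSets n)]
  exact ⟨∅, Classical.arbitrary Q, 0, by simp, .nil _⟩

/-- A run longer than `n` is determined, as an event set, by its part before the crossing
transition, this transition, and the rest, whose duration is less than `m`. The summand `1` in the
constant accounts for runs of duration at most `n`. -/
theorem ncard_eventSets_add_le [Finite A] [Nonempty Q] (hΔ : Δ.Finite) (n m : ℕ) :
    (eventSets Δ (n + m)).ncard ≤
      (1 + Δ.ncard) * (eventSets Δ n).ncard * (eventSets Δ m).ncard := by
  let Φ : Set (A × ℕ) × (Q × ℕ × A × Q) × Set (A × ℕ) → Set (A × ℕ) := fun p =>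
    p.1 ∪ shiftBy (lastTick p.1 + p.2.1.2.1) (insert (p.2.1.2.2.1, 0) p.2.2)
  have hfin : (eventSets Δ n ×ˢ Δ ×ˢ eventSets Δ m).Finite :=
    (finite_eventSets n).prod (hΔ.prod (finite_eventSets m))
  have hsub : eventSets Δ (n + m) ⊆
      eventSets Δ n ∪ Φ '' (eventSets Δ n ×ˢ Δ ×ˢ eventSets Δ m) := by
    rintro E ⟨q, d, hd, hE⟩
    by_cases hdn : d ≤ n
    · exact Or.inl ⟨q, d, hdn, hE⟩
    · obtain ⟨d₁, E₁, k, a, q₁, q₂, d₂, E₂, h₁, hd₁, ht, h₂, hsum, hlt, rfl⟩ :=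
        hE.split n (by omega)
      refine Or.inr ⟨(E₁, (q₁, k, a, q₂), E₂),
        ⟨⟨q, d₁, hd₁, h₁⟩, ht, ⟨q₂, d₂, by omega, h₂⟩⟩, ?_⟩
      simp only [Φ, h₁.lastTick_eq]
  have h1 := Set.ncard_le_ncard hsub ((finite_eventSets n).union (hfin.image Φ))
  have h2 := Set.ncard_union_le (eventSets Δ n) (Φ '' (eventSets Δ n ×ˢ Δ ×ˢ eventSets Δ m))
  have h3 := Set.ncard_image_le (f := Φ) hfin
  rw [Set.ncard_prod, Set.ncard_prod] at h3
  have h4 := ncard_eventSets_pos (Δ := Δ) m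
  nlinarith [Nat.mul_le_mul_left (eventSets Δ n).ncard h4]

end EventRun

theorem STG.ticks_subset {Q A : Type*} (G : STG Q A) (D : ℕ) :
    G.ticks D ⊆ (fun t : Q × ℚ≥0 × A × Q => (t.1, ⌊t.2.1 * D⌋₊, t.2.2.1, t.2.2.2)) ''
      (G.trans : Set (Q × ℚ≥0 × A × Q)) := by
  rintro ⟨q, k, a, q'⟩ ⟨d, hd, hk⟩
  refine ⟨(q, d, a, q'), hd, ?_⟩
  dsimp only at hk ⊢
  rw [← hk, Nat.floor_natCast]

theorem STG.finite_ticks {Q A : Type*} (G : STG Q A) (D : ℕ) : (G.ticks D).Finite :=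
  ((Finset.finite_toSet _).image _).subset (G.ticks_subset D)

/-! ### Exponential growth rates -/

/-- `γ` is the exponential growth rate of the almost submultiplicative sequence `U`. -/
structure IsGrowth (U : ℕ → ℕ) (γ : ℝ) : Prop where
  one_le : 1 ≤ γ
  pos : ∀ n, 1 ≤ U n
  tendsto : Filter.Tendsto (fun n : ℕ => Real.log (U n) / n) Filter.atTop (𝓝 (Real.log γ))
  summable : ∀ x : ℝ, 0 ≤ x → x * γ < 1 → Summable fun n => (U n : ℝ) * x ^ n

/-- Root test: for `r` strictly between `x * γ` and `1`, eventually `U n < (r / x) ^ n`, and a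
geometric series of ratio `r` dominates. -/
theorem summable_of_tendsto_log_div {U : ℕ → ℕ} {γ : ℝ} (hγ : 1 ≤ γ) (hpos : ∀ n, 1 ≤ U n)
    (h : Filter.Tendsto (fun n : ℕ => Real.log (U n) / n) Filter.atTop (𝓝 (Real.log γ)))
    {x : ℝ} (hx0 : 0 ≤ x) (hx : x * γ < 1) : Summable fun n => (U n : ℝ) * x ^ n := by
  rcases hx0.eq_or_lt with rfl | hx0
  · refine summable_of_ne_finset_zero (s := {0}) fun n hn => ?_
    simp at hn
    simp [hn]
  obtain ⟨r, hr1, hr2⟩ := exists_between hx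
  have hγ0 : 0 < γ := by linarith
  have hr0 : 0 < r := lt_trans (by positivity) hr1
  have hlog : Real.log γ < Real.log (r / x) :=
    Real.log_lt_log hγ0 (by rwa [lt_div_iff₀ hx0, mul_comm])
  have hev := (h.eventually_lt_const hlog).and (Filter.eventually_gt_atTop 0)
  refine Summable.of_norm_bounded_eventually_nat (summable_geometric_of_lt_one hr0.le hr2) ?_
  filter_upwards [hev] with n ⟨hn, hn0⟩
  have hU : (0 : ℝ) < U n := by exact_mod_cast hpos n
  have hn0' : (0 : ℝ) < n := by exact_mod_cast hn0
  rw [Real.norm_of_nonneg (by positivity)]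
  rw [div_lt_iff₀ hn0', mul_comm, ← Real.log_pow, Real.log_lt_log_iff hU (by positivity),
    div_pow, lt_div_iff₀ (by positivity)] at hn
  exact hn.le

/-- Fekete's lemma for the subadditive sequence `log (C * U n)`; the factor `C` does not change the
limit. -/
theorem exists_isGrowth {U : ℕ → ℕ} {C : ℕ} (hpos : ∀ n, 1 ≤ U n)
    (hsub : ∀ n m, U (n + m) ≤ C * U n * U m) :
    ∃ γ : ℝ, IsGrowth U γ ∧ ∀ n, γ ^ n ≤ C * U n := by
  have hC : 1 ≤ C := by
    by_contra hC
    have h := hsub 0 0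
    have := hpos 0
    simp only [not_le, Nat.lt_one_iff] at hC
    simp [hC] at h
    omega
  have hU : ∀ n, (1 : ℝ) ≤ U n := fun n => by exact_mod_cast hpos n
  have hC' : (1 : ℝ) ≤ C := by exact_mod_cast hC
  have hCU : ∀ n, (1 : ℝ) ≤ C * U n := fun n => one_le_mul_of_one_le_of_one_le hC' (hU n)
  let u : ℕ → ℝ := fun n => Real.log (C * U n)
  have hu : Subadditive u := by
    intro m n
    have h1 := hU m
    have h2 := hU n
    simp only [u]
    rw [← Real.log_mul (by positivity) (by positivity)]
    refine Real.log_le_log (by have := hCU (m + n); linarith) ?_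
    have : (U (m + n) : ℝ) ≤ C * U m * U n := by exact_mod_cast hsub m n
    calc (C : ℝ) * U (m + n) ≤ C * (C * U m * U n) := by gcongr
      _ = _ := by ring
  have hbdd : BddBelow (Set.range fun n => u n / n) := by
    refine ⟨0, ?_⟩
    rintro _ ⟨n, rfl⟩
    exact div_nonneg (Real.log_nonneg (hCU n)) (by positivity)
  have hlim := hu.tendsto_lim hbdd
  have hlim0 : 0 ≤ hu.lim := by
    refine ge_of_tendsto' hlim fun n => div_nonneg (Real.log_nonneg (hCU n)) (by positivity)
  have hγ : 1 ≤ Real.exp hu.lim := Real.one_le_exp hlim0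
  have ht : Filter.Tendsto (fun n : ℕ => Real.log (U n) / n) Filter.atTop
      (𝓝 (Real.log (Real.exp hu.lim))) := by
    rw [Real.log_exp]
    have h0 : Filter.Tendsto (fun n : ℕ => Real.log C / n) Filter.atTop (𝓝 0) :=
      tendsto_const_div_atTop_nhds_zero_nat _
    have := hlim.sub h0
    rw [sub_zero] at this
    refine this.congr fun n => ?_
    have h1 := hU n
    simp only [u]
    rw [Real.log_mul (by positivity) (by positivity)]
    ring
  refine ⟨Real.exp hu.lim, ⟨hγ, hpos, ht, fun x hx0 hx =>
    summable_of_tendsto_log_div hγ hpos ht hx0 hx⟩, fun n => ?_⟩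
  rcases Nat.eq_zero_or_pos n with rfl | hn
  · simpa using hCU 0
  have hn' : (0 : ℝ) < n := by exact_mod_cast hn
  -- Fekete's limit is an infimum, which gives a lower bound for every `n` and not just
  -- asymptotically.
  have h := hu.lim_le_div hbdd hn.ne'
  rw [le_div_iff₀ hn'] at h
  rw [← Real.exp_nat_mul, mul_comm]
  calc Real.exp (hu.lim * n) ≤ Real.exp (u n) := Real.exp_le_exp.2 h
    _ = C * U n := Real.exp_log (by have := hCU n; linarith)

/-- Sampling every `D` steps raises the growth rate to the power `D`. -/
theorem IsGrowth.comp_mul {U : ℕ → ℕ} {γ : ℝ} (h : IsGrowth U γ) {D : ℕ} (hD : 0 < D) :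
    IsGrowth (fun n => U (D * n)) (γ ^ D) := by
  have hγ : 1 ≤ γ ^ D := one_le_pow₀ h.one_le
  have hD' : (0 : ℝ) < D := by exact_mod_cast hD
  have ht : Filter.Tendsto (fun n : ℕ => Real.log (U (D * n)) / n) Filter.atTop
      (𝓝 (Real.log (γ ^ D))) := by
    rw [Real.log_pow]
    have h1 : Filter.Tendsto (fun n : ℕ => D * n) Filter.atTop Filter.atTop :=
      Filter.tendsto_id.const_mul_atTop' hD
    refine ((h.tendsto.comp h1).const_mul (D : ℝ)).congr fun n => ?_
    simp only [Function.comp, Nat.cast_mul]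
    rcases Nat.eq_zero_or_pos n with rfl | hn
    · simp
    · have hn' : (0 : ℝ) < n := by exact_mod_cast hn
      field_simp
  exact ⟨hγ, fun n => h.pos _, ht, fun x hx0 hx =>
    summable_of_tendsto_log_div hγ (fun n => h.pos _) ht hx0 hx⟩

/-! ### Counting words through the determinization -/

/-- The delay `d` as a number of ticks of length `1 / D`. -/
def tickCount (D : ℕ) (d : ℚ≥0) : ℕ := ⌊d * D⌋₊

/-- The duration in ticks of a sequence of delays and letters. -/
def wordTicks {B : Type*} (D : ℕ) (l : List (ℚ≥0 × B)) : ℕ :=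
  (l.map fun x => tickCount D x.1).sum

theorem wordTicks_cons {B : Type*} (D : ℕ) (x : ℚ≥0 × B) (l : List (ℚ≥0 × B)) :
    wordTicks D (x :: l) = tickCount D x.1 + wordTicks D l := by
  simp [wordTicks]

namespace STG

variable {Q A : Type*}

/-- There is a run from `q` on the given sequence of delays and letters. -/
def Accepts (H : STG Q A) : Q → List (ℚ≥0 × A) → Prop
  | _, [] => True
  | q, (d, a) :: l => ∃ qnext, (q, d, a, qnext) ∈ H.trans ∧ H.Accepts qnext l

/-- The sequences of duration `n` ticks accepted from some state of `S`. -/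
def wordsFrom (H : STG Q A) (D : ℕ) (S : Finset Q) (n : ℕ) : Set (List (ℚ≥0 × A)) :=
  {l | (∃ q ∈ S, H.Accepts q l) ∧ wordTicks D l = n}

/-- The number of sequences of duration `n` ticks accepted from some state of `S`. -/
noncomputable def wordCount (H : STG Q A) (D : ℕ) (S : Finset Q) (n : ℕ) : ℕ :=
  (H.wordsFrom D S n).ncard

/-- Every transition lasts at least one tick. -/
def PosTicks (H : STG Q A) (D : ℕ) : Prop := ∀ t ∈ H.trans, 0 < tickCount D t.2.1

section Determinize

variable [Fintype Q] [Fintype A]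

theorem mem_determinize_trans {H : STG Q A} {S S' : {S : Finset Q // S.Nonempty}} {d : ℚ≥0}
    {a : A} : (S, d, a, S') ∈ H.determinize.trans ↔
      ∀ q, q ∈ S'.1 ↔ ∃ p ∈ S.1, (p, d, a, q) ∈ H.trans := by
  simp only [determinize, Finset.mem_filter, Finset.mem_product, Finset.mem_univ, true_and,
    and_true, and_iff_right_iff_imp]
  intro h
  obtain ⟨q, hq⟩ := S'.2
  obtain ⟨p, -, hp⟩ := (h q).1 hq
  exact Finset.mem_image.2 ⟨_, hp, rfl⟩

/-- One step of the subset construction: since all states are final, acceptance from `S` after one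
letter only requires the successor set to be non-empty. -/
theorem exists_accepts_cons_iff {H : STG Q A} {S : {S : Finset Q // S.Nonempty}} {d : ℚ≥0}
    {a : A} {l : List (ℚ≥0 × A)} : (∃ q ∈ S.1, H.Accepts q ((d, a) :: l)) ↔
      ∃ S', (S, d, a, S') ∈ H.determinize.trans ∧ ∃ q ∈ S'.1, H.Accepts q l := by
  classical
  constructor
  · rintro ⟨q, hq, q', hq', hl⟩
    have hmem : ∀ r, r ∈ Finset.univ.filter (fun r => ∃ p ∈ S.1, (p, d, a, r) ∈ H.trans) ↔
        ∃ p ∈ S.1, (p, d, a, r) ∈ H.trans := by simp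
    have hq'' := (hmem q').2 ⟨q, hq, hq'⟩
    exact ⟨⟨_, q', hq''⟩, mem_determinize_trans.2 hmem, q', hq'', hl⟩
  · rintro ⟨S', hS', q', hq', hl⟩
    obtain ⟨p, hp, ht⟩ := (mem_determinize_trans.1 hS' q').1 hq'
    exact ⟨p, hp, q', ht, hl⟩

theorem PosTicks.determinize {H : STG Q A} {D : ℕ} (hH : H.PosTicks D) :
    H.determinize.PosTicks D := by
  rintro ⟨S, d, a, S'⟩ ht
  obtain ⟨q, hq⟩ := S'.2
  obtain ⟨p, -, hp⟩ := (mem_determinize_trans.1 ht q).1 hq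
  exact hH _ hp

theorem mem_wordsFrom_iff {H : STG Q A} {D : ℕ} {S : {S : Finset Q // S.Nonempty}} {n : ℕ}
    {l : List (ℚ≥0 × A)} : l ∈ H.wordsFrom D S n ↔ (n = 0 ∧ l = []) ∨
      ∃ t ∈ H.determinize.trans, t.1 = S ∧ tickCount D t.2.1 ≤ n ∧
        ∃ l' ∈ H.wordsFrom D t.2.2.2 (n - tickCount D t.2.1), (t.2.1, t.2.2.1) :: l' = l := by
  rcases l with _ | ⟨⟨d, a⟩, l⟩
  · constructor
    · rintro ⟨-, rfl⟩
      exact Or.inl ⟨rfl, rfl⟩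
    · rintro (⟨rfl, -⟩ | ⟨t, -, -, -, l', -, h⟩)
      · obtain ⟨q, hq⟩ := S.2
        exact ⟨⟨q, hq, trivial⟩, rfl⟩
      · exact absurd h (by simp)
  · rw [wordsFrom, Set.mem_ofPred_eq, exists_accepts_cons_iff, wordTicks_cons]
    constructor
    · rintro ⟨⟨S', hS', hl⟩, rfl⟩
      exact Or.inr ⟨_, hS', rfl, by simp, l, ⟨hl, by simp⟩, rfl⟩
    · rintro (⟨-, h⟩ | ⟨⟨S₁, d', a', S'⟩, ht, rfl, hle, l', ⟨hl, hw⟩, h⟩)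
      · exact absurd h (by simp)
      · simp only [List.cons.injEq, Prod.mk.injEq] at h
        obtain ⟨⟨rfl, rfl⟩, rfl⟩ := h
        refine ⟨⟨S', ht, hl⟩, ?_⟩
        dsimp only at hle hw ⊢
        omega

theorem finite_wordsFrom {H : STG Q A} {D : ℕ} (hH : H.PosTicks D) (n : ℕ) :
    ∀ S : Finset Q, (H.wordsFrom D S n).Finite := by
  induction n using Nat.strong_induction_on with
  | _ n ih =>
    intro S
    rcases S.eq_empty_or_nonempty with rfl | hS
    · convert Set.finite_empty
      ext l
      simp [wordsFrom]
    refine ((Set.finite_singleton []).union (Set.Finite.biUnion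
      (s := {t | t ∈ H.determinize.trans ∧ tickCount D t.2.1 ≤ n})
      (t := fun t => (fun l => (t.2.1, t.2.2.1) :: l) ''
        H.wordsFrom D t.2.2.2.1 (n - tickCount D t.2.1))
      ((Finset.finite_toSet H.determinize.trans).subset fun t ht => ht.1) fun t ht => ?_)).subset ?_
    · have := hH.determinize t ht.1
      have h2 := ht.2
      exact (ih _ (by omega) _).image _
    · intro l hl
      rcases (mem_wordsFrom_iff (S := ⟨S, hS⟩)).1 hl with ⟨-, rfl⟩ | ⟨t, ht, -, hle, l', hl', rfl⟩
      · exact Or.inl rfl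
      · exact Or.inr (Set.mem_biUnion ⟨ht, hle⟩ ⟨l', hl', rfl⟩)

-- Classify words by their first letter. The determinization has at most one transition from `S` for
-- each delay and label, so the classes are disjoint and nothing is counted twice. This is the
-- equation `f = 1 + M f` on coefficients.
open Classical in
theorem wordCount_eq {H : STG Q A} {D : ℕ} (hH : H.PosTicks D)
    (S : {S : Finset Q // S.Nonempty}) (n : ℕ) :
    H.wordCount D S n = (if n = 0 then 1 else 0) +
      ∑ t ∈ H.determinize.trans with t.1 = S, if tickCount D t.2.1 ≤ n then
        H.wordCount D t.2.2.2 (n - tickCount D t.2.1) else 0 := by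
  have hcard : ∀ (S : Finset Q) n, H.wordCount D S n = (finite_wordsFrom hH n S).toFinset.card :=
    fun S n => Set.ncard_eq_toFinset_card _ _
  have hset : (finite_wordsFrom hH n S.1).toFinset = (if n = 0 then {[]} else ∅) ∪
      ((H.determinize.trans.filter fun t => t.1 = S).filter
        fun t => tickCount D t.2.1 ≤ n).biUnion fun t =>
        (finite_wordsFrom hH (n - tickCount D t.2.1) t.2.2.2.1).toFinset.image
          fun l => (t.2.1, t.2.2.1) :: l := by
    ext l
    rw [Set.Finite.mem_toFinset, mem_wordsFrom_iff, Finset.mem_union, Finset.mem_biUnion]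
    refine or_congr ?_ ?_
    · split_ifs with h <;> simp [h]
    · simp [and_assoc]
  rw [hcard, hset, Finset.card_union_of_disjoint, Finset.card_biUnion]
  · congr 1
    · split_ifs <;> simp
    · rw [Finset.sum_filter]
      refine Finset.sum_congr rfl fun t _ => ?_
      rw [hcard]
      split_ifs
      · exact Finset.card_image_of_injective _ fun _ _ h => by simpa using h
      · rfl
  · rintro ⟨S₁, d₁, a₁, S₁'⟩ h₁ ⟨S₂, d₂, a₂, S₂'⟩ h₂ hne
    simp only [Finset.mem_coe, Finset.mem_filter] at h₁ h₂
    obtain ⟨⟨h₁, rfl⟩, -⟩ := h₁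
    obtain ⟨⟨h₂, rfl⟩, -⟩ := h₂
    rw [Function.onFun, Finset.disjoint_left]
    intro l hl hl'
    obtain ⟨l₁, -, rfl⟩ := Finset.mem_image.1 hl
    obtain ⟨l₂, -, h⟩ := Finset.mem_image.1 hl'
    simp only [List.cons.injEq, Prod.mk.injEq] at h
    obtain ⟨⟨rfl, rfl⟩, -⟩ := h
    apply hne
    have : S₁' = S₂' := Subtype.ext (Finset.ext fun q => by
      rw [mem_determinize_trans.1 h₁, mem_determinize_trans.1 h₂])
    rw [this]
  · rw [Finset.disjoint_left]
    intro l hl hl'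
    obtain ⟨t, -, ht⟩ := Finset.mem_biUnion.1 hl'
    obtain ⟨l', -, rfl⟩ := Finset.mem_image.1 ht
    split_ifs at hl
    · simp at hl
    · simp at hl

theorem wordCount_mono {H : STG Q A} {D : ℕ} (hH : H.PosTicks D) {S S' : Finset Q} (h : S ⊆ S')
    (n : ℕ) : H.wordCount D S n ≤ H.wordCount D S' n :=
  Set.ncard_le_ncard (fun _ ⟨⟨q, hq, hl⟩, hn⟩ => ⟨⟨q, h hq, hl⟩, hn⟩) (finite_wordsFrom hH n S')

end Determinize

/-! ### Event sets as words of the 0-elimination -/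

section ZeroElim

/-- The events of a set of letters read at tick `0`. -/
def lettersAt (B : Finset A) : Set (A × ℕ) := {x | x.1 ∈ B ∧ x.2 = 0}

/-- The events of a sequence of delays and sets of letters. -/
def wordEvents (D : ℕ) : List (ℚ≥0 × {B : Finset A // B.Nonempty}) → Set (A × ℕ)
  | [] => ∅
  | (d, B) :: l => shiftBy (tickCount D d) (lettersAt B.1 ∪ wordEvents D l)

theorem lettersAt_insert [DecidableEq A] (a : A) (B : Finset A) :
    lettersAt (insert a B) = insert (a, 0) (lettersAt B) := by
  ext ⟨x, n⟩
  simp only [lettersAt, Finset.mem_insert, Set.mem_ofPred_eq, Set.mem_insert_iff, Prod.mk.injEq]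
  tauto

theorem shiftBy_zero (E : Set (A × ℕ)) : shiftBy 0 E = E := by
  simp [shiftBy]

theorem shiftBy_injective (k : ℕ) : Function.Injective (shiftBy (A := A) k) := by
  refine Function.Injective.image_injective fun x y h => ?_
  simp only [Prod.mk.injEq, Nat.add_right_cancel_iff] at h
  exact Prod.ext h.1 h.2

theorem tickCount_zero (D : ℕ) : tickCount D 0 = 0 := by simp [tickCount]

theorem natCast_tickCount {G : STG Q A} {D : ℕ} (hG : G.IsDenom D) {t : Q × ℚ≥0 × A × Q}
    (ht : t ∈ G.trans) : (tickCount D t.2.1 : ℚ≥0) = t.2.1 * D := by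
  obtain ⟨k, hk⟩ := hG.2 t ht
  rw [tickCount, ← hk, Nat.floor_natCast]

/-- A word whose delays are positive multiples of the tick. -/
def GoodWord {B : Type*} (D : ℕ) (l : List (ℚ≥0 × B)) : Prop :=
  ∀ x ∈ l, 0 < tickCount D x.1 ∧ (tickCount D x.1 : ℚ≥0) = x.1 * D

theorem goodWord_of_accepts {G : STG Q A} {D : ℕ} (hG : G.IsDenom D) (hp : G.PosTicks D) :
    ∀ {l : List (ℚ≥0 × A)} {q : Q}, G.Accepts q l → GoodWord D l
  | [], _, _ => by simp [GoodWord]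
  | (d, a) :: l, q, ⟨q', ht, hl⟩ => by
    have ih := goodWord_of_accepts hG hp hl
    intro x hx
    rcases List.mem_cons.1 hx with rfl | hx
    · exact ⟨hp _ ht, natCast_tickCount hG ht⟩
    · exact ih x hx

theorem wordEvents_pos {D : ℕ} {l : List (ℚ≥0 × {B : Finset A // B.Nonempty})}
    (hl : GoodWord D l) : ∀ x ∈ wordEvents D l, 0 < x.2 := by
  rcases l with _ | ⟨⟨d, B⟩, l⟩
  · simp [wordEvents]
  · rintro _ ⟨y, -, rfl⟩
    have := (hl (d, B) (by simp)).1
    dsimp only at this ⊢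
    omega

/-- The delays of a good word are positive, so the events at tick `0` are exactly those of `B`. -/
theorem lettersAt_union_inj {D : ℕ} {l l' : List (ℚ≥0 × {B : Finset A // B.Nonempty})}
    {B B' : Finset A} (hl : GoodWord D l) (hl' : GoodWord D l')
    (h : lettersAt B ∪ wordEvents D l = lettersAt B' ∪ wordEvents D l') :
    B = B' ∧ wordEvents D l = wordEvents D l' := by
  have h1 : ∀ (B : Finset A) (l : List (ℚ≥0 × {B : Finset A // B.Nonempty})), GoodWord D l →
      ∀ x, x ∈ B ↔ (x, 0) ∈ lettersAt B ∪ wordEvents D l := by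
    intro B l hl x
    simp only [lettersAt, Set.mem_union, Set.mem_ofPred_eq, and_true]
    exact ⟨Or.inl, fun h => h.resolve_right fun h => absurd (wordEvents_pos hl _ h) (by simp)⟩
  have h2 : ∀ (B : Finset A) (l : List (ℚ≥0 × {B : Finset A // B.Nonempty})), GoodWord D l →
      ∀ x, x ∈ wordEvents D l ↔ x ∈ lettersAt B ∪ wordEvents D l ∧ 0 < x.2 := by
    intro B l hl x
    simp only [lettersAt, Set.mem_union, Set.mem_ofPred_eq]
    refine ⟨fun h => ⟨Or.inr h, wordEvents_pos hl _ h⟩, fun h => h.1.resolve_left fun h' => ?_⟩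
    have := h.2
    omega
  constructor
  · ext x
    rw [h1 B l hl, h1 B' l' hl', h]
  · ext x
    rw [h2 B l hl, h2 B' l' hl', h]

/-- A word is decoded from its events: labels are non-empty, so the earliest tick is the first
delay. The letters at that tick form the first label, and the later events encode the tail. -/
theorem wordEvents_injOn {D : ℕ} (hD : 0 < D) :
    ∀ {l l' : List (ℚ≥0 × {B : Finset A // B.Nonempty})}, GoodWord D l → GoodWord D l' →
      wordEvents D l = wordEvents D l' → l = l'
  | [], [], _, _, _ => rfl
  | [], (d, B) :: l, _, _, h => by
    obtain ⟨b, hb⟩ := B.2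
    have : (b, 0 + tickCount D d) ∈ wordEvents D ((d, B) :: l) := ⟨(b, 0), Or.inl ⟨hb, rfl⟩, rfl⟩
    rw [← h] at this
    exact absurd this (by simp [wordEvents])
  | (d, B) :: l, [], _, _, h => by
    obtain ⟨b, hb⟩ := B.2
    have : (b, 0 + tickCount D d) ∈ wordEvents D ((d, B) :: l) := ⟨(b, 0), Or.inl ⟨hb, rfl⟩, rfl⟩
    rw [h] at this
    exact absurd this (by simp [wordEvents])
  | (d, B) :: l, (d', B') :: l', hl, hl', h => by
    have hle : ∀ (d d' : ℚ≥0) (B B' : {B : Finset A // B.Nonempty})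
        (l l' : List (ℚ≥0 × {B : Finset A // B.Nonempty})),
        wordEvents D ((d, B) :: l) = wordEvents D ((d', B') :: l') →
        tickCount D d' ≤ tickCount D d := by
      intro d d' B B' l l' h
      obtain ⟨b, hb⟩ := B.2
      have : (b, 0 + tickCount D d) ∈ wordEvents D ((d, B) :: l) := ⟨(b, 0), Or.inl ⟨hb, rfl⟩, rfl⟩
      rw [h] at this
      obtain ⟨y, -, hy⟩ := this
      simp only [Prod.mk.injEq] at hy
      omega
    have heq : tickCount D d = tickCount D d' :=
      le_antisymm (hle _ _ _ _ _ _ h.symm) (hle _ _ _ _ _ _ h)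
    have hdd : d = d' := by
      have h1 := (hl (d, B) (by simp)).2
      have h2 := (hl' (d', B') (by simp)).2
      dsimp only at h1 h2
      rw [heq, h2] at h1
      exact (mul_right_cancel₀ (by exact_mod_cast hD.ne') h1).symm
    subst hdd
    have hgl : GoodWord D l := fun x hx => hl x (by simp [hx])
    have hgl' : GoodWord D l' := fun x hx => hl' x (by simp [hx])
    obtain ⟨hB, he⟩ := lettersAt_union_inj hgl hgl' (shiftBy_injective _ h)
    rw [Subtype.ext hB, wordEvents_injOn hD hgl hgl' he]

theorem eventRun_of_zeroPath {G : STG Q A} {D : ℕ} {n : ℕ} {E : Set (A × ℕ)} {q₀ : Q}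
    (h : EventRun (G.ticks D) q₀ n E) : ∀ {l₀ : List A} {q : Q}, G.ZeroPath q l₀ q₀ →
      ∀ B : Finset A, (∀ x, x ∈ B ↔ x ∈ l₀) → EventRun (G.ticks D) q n (lettersAt B ∪ E)
  | [], q, hp, B, hB => by
    obtain rfl : q = q₀ := hp
    have : B = ∅ := by ext x; simp [hB]
    subst this
    simpa [lettersAt] using h
  | a :: l₀, q, ⟨q', hq', hp⟩, B, hB => by
    classical
    have ih := eventRun_of_zeroPath h hp l₀.toFinset (by simp)
    have := EventRun.cons (Δ := G.ticks D) (q := q) (k := 0) (a := a) ⟨0, hq', by simp⟩ ih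
    rw [shiftBy_zero, ← Set.insert_union, ← lettersAt_insert] at this
    have h3 : insert a l₀.toFinset = B := by
      ext x
      simp [hB]
    rwa [h3] at this

variable [Fintype Q]

open Classical in
/-- The states reached by instantaneous transitions reading exactly the letters of `B`. -/
noncomputable def zeroReach (G : STG Q A) (B : Finset A) : Finset Q :=
  {q₀ | ∃ q l₀, G.ZeroPath q l₀ q₀ ∧ ∀ x, x ∈ B ↔ x ∈ l₀}

theorem zeroReach_empty (G : STG Q A) : G.zeroReach ∅ = Finset.univ := by
  ext q
  simp only [zeroReach, Finset.mem_filter, Finset.mem_univ, true_and, iff_true]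
  exact ⟨q, [], rfl, by simp⟩

variable [Fintype A]

theorem mem_zeroElim_trans {G : STG Q A} {p q : Q} {d : ℚ≥0} {B : {B : Finset A // B.Nonempty}} :
    (p, d, B, q) ∈ G.zeroElim.trans ↔ 0 < d ∧ ∃ (a : A) (q₀ : Q) (l : List A),
      (p, d, a, q₀) ∈ G.trans ∧ G.ZeroPath q₀ l q ∧ ∀ x, x ∈ B.1 ↔ x ∈ a :: l := by
  simp only [zeroElim, Finset.mem_filter, Finset.mem_product, Finset.mem_univ, true_and,
    and_true, and_iff_right_iff_imp]
  rintro ⟨-, a, q₀, l, h, -⟩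
  exact Finset.mem_image.2 ⟨_, h, rfl⟩

theorem IsDenom.zeroElim {G : STG Q A} {D : ℕ} (hG : G.IsDenom D) : G.zeroElim.IsDenom D := by
  refine ⟨hG.1, ?_⟩
  rintro ⟨p, d, B, q⟩ ht
  obtain ⟨-, a, q₀, l, h, -⟩ := mem_zeroElim_trans.1 ht
  exact hG.2 _ h

theorem posTicks_zeroElim {G : STG Q A} {D : ℕ} (hG : G.IsDenom D) :
    G.zeroElim.PosTicks D := by
  rintro ⟨p, d, B, q⟩ ht
  have hd := (mem_zeroElim_trans.1 ht).1
  have h := natCast_tickCount hG.zeroElim ht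
  have hD : (0 : ℚ≥0) < D := by exact_mod_cast hG.1
  have : (0 : ℚ≥0) < (tickCount D d : ℚ≥0) := by
    rw [h]
    positivity
  exact_mod_cast this

/-- By induction from the end of the run, `B` collects the letters read before any time elapses. An
instantaneous transition enlarges `B`. A transition of positive delay absorbs `B` into a transition
of the 0-elimination, and `B` restarts empty. -/
theorem exists_word_of_eventRun {G : STG Q A} {D : ℕ} {q : Q} {n : ℕ}
    {E : Set (A × ℕ)} (h : EventRun (G.ticks D) q n E) :
    ∃ (B : Finset A) (l₀ : List A) (q₀ : Q) (l : List (ℚ≥0 × {B : Finset A // B.Nonempty})),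
      G.ZeroPath q l₀ q₀ ∧ (∀ x, x ∈ B ↔ x ∈ l₀) ∧ G.zeroElim.Accepts q₀ l ∧
        E = lettersAt B ∪ wordEvents D l ∧ wordTicks D l = n := by
  classical
  induction h with
  | nil q => exact ⟨∅, [], q, [], rfl, by simp, trivial, by simp [lettersAt, wordEvents], rfl⟩
  | @cons q k a q' n E ht hE ih =>
    obtain ⟨B, l₀, q₀, l, hp, hB, hl, rfl, rfl⟩ := ih
    obtain ⟨d, hd, hk⟩ := ht
    dsimp only at hd hk
    have hk' : tickCount D d = k := by rw [tickCount, ← hk, Nat.floor_natCast]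
    rcases eq_or_ne d 0 with rfl | hd0
    · rw [tickCount_zero] at hk'
      subst hk'
      refine ⟨insert a B, a :: l₀, q₀, l, ⟨q', hd, hp⟩, by simp [hB], hl, ?_, by simp⟩
      rw [shiftBy_zero, lettersAt_insert, Set.insert_union]
    · refine ⟨∅, [], q, (d, ⟨insert a B, by simp⟩) :: l, rfl, by simp,
        ⟨q₀, mem_zeroElim_trans.2 ⟨pos_iff_ne_zero.2 hd0, a, q', l₀, hd, hp, by simp [hB]⟩, hl⟩,
        ?_, ?_⟩
      · rw [wordEvents, hk', lettersAt_insert, Set.insert_union]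
        simp [lettersAt]
      · rw [wordTicks_cons, hk', add_comm]

theorem eventRun_of_accepts {G : STG Q A} {D : ℕ} (hG : G.IsDenom D) :
    ∀ {l : List (ℚ≥0 × {B : Finset A // B.Nonempty})} {q : Q}, G.zeroElim.Accepts q l →
      EventRun (G.ticks D) q (wordTicks D l) (wordEvents D l)
  | [], q, _ => .nil q
  | (d, B) :: l, q, ⟨q', ht, hl⟩ => by
    classical
    have ih := eventRun_of_accepts hG hl
    obtain ⟨-, a, q₀, l₀, hd, hp, hB⟩ := mem_zeroElim_trans.1 ht
    have h1 := eventRun_of_zeroPath ih hp l₀.toFinset (by simp)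
    have h2 := EventRun.cons (Δ := G.ticks D) (k := tickCount D d)
      ⟨d, hd, natCast_tickCount hG hd⟩ h1
    rw [← Set.insert_union, ← lettersAt_insert] at h2
    have h3 : insert a l₀.toFinset = B.1 := by
      ext x
      simp [hB]
    rw [h3] at h2
    rw [wordTicks_cons, add_comm]
    exact h2

/-- The number of event sets of duration exactly `n` ticks. -/
noncomputable def exactCount (G : STG Q A) (D n : ℕ) : ℕ :=
  ∑ B : Finset A, G.zeroElim.wordCount D (G.zeroReach B) n

/-- Event sets correspond bijectively to pairs of an initial set of letters `B` and a word accepted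
from some state of `zeroReach B`. The start of the instantaneous path is free because every state is
initial. -/
theorem ncard_eventSets_eq {G : STG Q A} {D : ℕ} (hG : G.IsDenom D) (n : ℕ) :
    (eventSets (G.ticks D) n).ncard = ∑ j ∈ Finset.range (n + 1), G.exactCount D j := by
  classical
  have hpos := posTicks_zeroElim hG
  let F : Finset (Finset A × List (ℚ≥0 × {B : Finset A // B.Nonempty})) :=
    (Finset.range (n + 1) ×ˢ (Finset.univ : Finset (Finset A))).biUnion fun p =>
      (finite_wordsFrom hpos p.1 (G.zeroReach p.2)).toFinset.image fun l => (p.2, l)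
  have hF : ∀ B l, (B, l) ∈ F ↔ wordTicks D l ≤ n ∧
      ∃ q ∈ G.zeroReach B, G.zeroElim.Accepts q l := by
    intro B l
    simp only [F, Finset.mem_biUnion, Finset.mem_product, Finset.mem_range, Finset.mem_univ,
      and_true, Finset.mem_image, Set.Finite.mem_toFinset, Prod.exists, Prod.mk.injEq, wordsFrom,
      Set.mem_ofPred_eq]
    constructor
    · rintro ⟨j, B', hj, l', ⟨h, rfl⟩, rfl, rfl⟩
      exact ⟨by omega, h⟩
    · rintro ⟨h, h'⟩
      exact ⟨wordTicks D l, B, by omega, l, ⟨h', rfl⟩, rfl, rfl⟩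
  have himg : eventSets (G.ticks D) n = 
      (fun p : Finset A × List (ℚ≥0 × {B : Finset A // B.Nonempty}) =>
        lettersAt p.1 ∪ wordEvents D p.2) '' (F : Set _) := by
    ext E
    constructor
    · rintro ⟨q, m, hm, hE⟩
      obtain ⟨B, l₀, q₀, l, hp, hB, hl, rfl, rfl⟩ := exists_word_of_eventRun hE
      refine ⟨(B, l), (hF B l).2 ⟨hm, q₀, ?_, hl⟩, rfl⟩
      simp only [zeroReach, Finset.mem_filter, Finset.mem_univ, true_and]
      exact ⟨q, l₀, hp, hB⟩
    · rintro ⟨⟨B, l⟩, hBl, rfl⟩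
      obtain ⟨hm, q₀, hq₀, hl⟩ := (hF B l).1 hBl
      simp only [zeroReach, Finset.mem_filter, Finset.mem_univ, true_and] at hq₀
      obtain ⟨q, l₀, hp, hB⟩ := hq₀
      exact ⟨q, _, hm, eventRun_of_zeroPath (eventRun_of_accepts hG hl) hp B hB⟩
  have hinj : Set.InjOn (fun p : Finset A × List (ℚ≥0 × {B : Finset A // B.Nonempty}) =>
      lettersAt p.1 ∪ wordEvents D p.2) (F : Set _) := by
    rintro ⟨B, l⟩ h ⟨B', l'⟩ h' he
    obtain ⟨-, q, -, hl⟩ := (hF B l).1 h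
    obtain ⟨-, q', -, hl'⟩ := (hF B' l').1 h'
    have hg := goodWord_of_accepts hG.zeroElim hpos hl
    have hg' := goodWord_of_accepts hG.zeroElim hpos hl'
    obtain ⟨rfl, h2⟩ := lettersAt_union_inj hg hg' he
    rw [wordEvents_injOn hG.1 hg hg' h2]
  rw [himg, hinj.ncard_image, Set.ncard_coe_finset, Finset.card_biUnion]
  · rw [Finset.sum_product]
    refine Finset.sum_congr rfl fun j _ => Finset.sum_congr rfl fun B _ => ?_
    rw [Finset.card_image_of_injective _ fun _ _ h => by simpa using h, wordCount,
      Set.ncard_eq_toFinset_card _ (finite_wordsFrom hpos j _)]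
  · rintro ⟨j, B⟩ - ⟨j', B'⟩ - hne
    rw [Function.onFun, Finset.disjoint_left]
    rintro ⟨B₁, l⟩ hl hl'
    simp only [Finset.mem_image, Set.Finite.mem_toFinset, Prod.mk.injEq, wordsFrom,
      Set.mem_ofPred_eq] at hl hl'
    obtain ⟨_, ⟨-, rfl⟩, rfl, rfl⟩ := hl
    obtain ⟨_, ⟨-, rfl⟩, rfl, rfl⟩ := hl'
    exact hne rfl

theorem wordCount_univ_le_exactCount (G : STG Q A) (D n : ℕ) :
    G.zeroElim.wordCount D Finset.univ n ≤ G.exactCount D n := by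
  rw [← zeroReach_empty G]
  exact Finset.single_le_sum (f := fun B => G.zeroElim.wordCount D (G.zeroReach B) n)
    (fun _ _ => Nat.zero_le _) (Finset.mem_univ ∅)

theorem exactCount_le {G : STG Q A} {D : ℕ} (hG : G.IsDenom D) (n : ℕ) :
    G.exactCount D n ≤ Fintype.card (Finset A) * G.zeroElim.wordCount D Finset.univ n := by
  refine (Finset.sum_le_card_nsmul _ _ _ fun B _ =>
    wordCount_mono (posTicks_zeroElim hG) (Finset.subset_univ _) n).trans ?_
  simp

end ZeroElim

end STG

/-! ### Generating functions and the smallest root of the determinant -/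

namespace STG

variable {Q A : Type*}

open Classical in
/-- The adjacency matrix in the variable `w = z ^ (1 / D)`. -/
noncomputable def tickMatrix {K : Type*} [CommRing K] (H : STG Q A) (D : ℕ) (w : K) :
    Matrix Q Q K := fun i j =>
  ∑ t ∈ H.trans with t.1 = i ∧ t.2.2.2 = j, w ^ tickCount D t.2.1

theorem ofReal_det_tickMatrix [Fintype Q] [DecidableEq Q] (H : STG Q A) (D : ℕ) (x : ℝ) :
    (((1 - H.tickMatrix D x).det : ℝ) : ℂ) = (1 - H.tickMatrix D (x : ℂ)).det := by
  have h : Complex.ofRealHom.mapMatrix (H.tickMatrix D x) = H.tickMatrix D (x : ℂ) := by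
    ext i j
    simp [tickMatrix]
  rw [← Complex.ofRealHom_eq_coe, RingHom.map_det, map_sub, map_one, h]

open Classical in
theorem sum_tickMatrix_mul [Fintype Q] {K : Type*} [CommRing K] (H : STG Q A) (D : ℕ) (w : K)
    (f : Q → K) (i : Q) : ∑ j, H.tickMatrix D w i j * f j =
      ∑ t ∈ H.trans with t.1 = i, w ^ tickCount D t.2.1 * f t.2.2.2 := by
  rw [← Finset.sum_fiberwise _ (fun t : Q × ℚ≥0 × A × Q => t.2.2.2)]
  refine Finset.sum_congr rfl fun j _ => ?_
  rw [tickMatrix, Finset.sum_mul, Finset.filter_filter]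
  refine Finset.sum_congr rfl fun t ht => ?_
  rw [(Finset.mem_filter.1 ht).2.2]

theorem tickMatrix_nonneg (H : STG Q A) (D : ℕ) {x : ℝ} (hx : 0 ≤ x) (i j : Q) :
    0 ≤ H.tickMatrix D x i j := Finset.sum_nonneg fun _ _ => pow_nonneg hx _

theorem norm_tickMatrix_le (H : STG Q A) (D : ℕ) {x : ℝ} {w : ℂ} (hw : ‖w‖ ≤ x) (i j : Q) :
    ‖H.tickMatrix D w i j‖ ≤ H.tickMatrix D x i j := by
  refine (norm_sum_le _ _).trans (Finset.sum_le_sum fun t _ => ?_)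
  rw [norm_pow]
  gcongr

theorem continuous_tickMatrix (H : STG Q A) (D : ℕ) :
    Continuous fun x : ℝ => H.tickMatrix D x := by
  refine continuous_matrix fun i j => ?_
  unfold tickMatrix
  fun_prop

/-- Counting functions with `c = 1 + M c` in terms of generating functions. -/
def IsPathCount (H : STG Q A) (D : ℕ) (c : Q → ℕ → ℕ) : Prop := open Classical in
  ∀ i n, c i n = (if n = 0 then 1 else 0) +
    ∑ t ∈ H.trans with t.1 = i, if tickCount D t.2.1 ≤ n then
      c t.2.2.2 (n - tickCount D t.2.1) else 0

variable {H : STG Q A} {D : ℕ} {c : Q → ℕ → ℕ}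

theorem hasSum_shift {g : ℕ → ℕ} {x a : ℝ} (k : ℕ) (h : HasSum (fun n => (g n : ℝ) * x ^ n) a) :
    HasSum (fun n => ((if k ≤ n then g (n - k) else 0 : ℕ) : ℝ) * x ^ n) (x ^ k * a) := by
  rw [← hasSum_nat_add_iff' k, Finset.sum_eq_zero, sub_zero]
  · refine (h.mul_left (x ^ k)).congr_fun fun n => ?_
    simp only [le_add_iff_nonneg_left, zero_le, if_true, Nat.add_sub_cancel, pow_add]
    ring
  · intro i hi
    rw [if_neg (by have := Finset.mem_range.1 hi; omega)]
    simp

theorem IsPathCount.eq_one_add [Fintype Q] (hc : H.IsPathCount D c) {x : ℝ} {f : Q → ℝ}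
    (hf : ∀ i, HasSum (fun n => (c i n : ℝ) * x ^ n) (f i)) (i : Q) :
    f i = 1 + ∑ j, H.tickMatrix D x i j * f j := by
  classical
  rw [sum_tickMatrix_mul]
  refine (hf i).unique ?_
  have h1 : HasSum (fun n => ((if n = 0 then 1 else 0 : ℕ) : ℝ) * x ^ n) 1 := by
    have := hasSum_single (f := fun n => ((if n = 0 then 1 else 0 : ℕ) : ℝ) * x ^ n) 0
      fun n hn => by simp [hn]
    simpa using this
  refine (h1.add (hasSum_sum fun t _ => hasSum_shift (tickCount D t.2.1)
    (hf t.2.2.2))).congr_fun fun n => ?_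
  rw [hc i n]
  push_cast
  rw [add_mul, Finset.sum_mul]

theorem IsPathCount.one_le (hc : H.IsPathCount D c) {x : ℝ} (hx : 0 ≤ x) {f : Q → ℝ}
    (hf : ∀ i, HasSum (fun n => (c i n : ℝ) * x ^ n) (f i)) (i : Q) : 1 ≤ f i := by
  have h := sum_le_hasSum {0} (fun n _ => by positivity) (hf i)
  have h0 : 1 ≤ c i 0 := by rw [hc i 0]; simp
  have : (1 : ℝ) ≤ c i 0 := by exact_mod_cast h0
  simp at h
  linarith

/-- Perron–Frobenius argument. Suppose `v = M(w) v` with `v ≠ 0`, and let `f ≥ 1` be the generating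
functions at `x`. At an index `i` maximizing `‖v i‖ / f i = θ`, the bound `‖M(w)‖ ≤ M(x)` entrywise
gives `‖v i‖ ≤ θ * (M(x) f) i = θ * (f i - 1) < θ * f i`, a contradiction. -/
theorem IsPathCount.det_ne_zero [Fintype Q] [DecidableEq Q] (hc : H.IsPathCount D c) {x : ℝ}
    (hx : 0 ≤ x) (hs : ∀ i, Summable fun n => (c i n : ℝ) * x ^ n) {w : ℂ} (hw : ‖w‖ ≤ x) :
    (1 - H.tickMatrix D w).det ≠ 0 := by
  intro hdet
  obtain ⟨v, hv, hv0⟩ := Matrix.exists_mulVec_eq_zero_iff.2 hdet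
  have hf := fun i => (hs i).hasSum
  set f : Q → ℝ := fun i => ∑' n, (c i n : ℝ) * x ^ n with hfdef
  have hpos : ∀ i, 0 < f i := fun i => lt_of_lt_of_le one_pos (hc.one_le hx hf i)
  obtain ⟨i₀, hi₀⟩ : ∃ i, v i ≠ 0 := by
    by_contra h
    push Not at h
    exact hv (funext h)
  have : Nonempty Q := ⟨i₀⟩
  obtain ⟨i, hi⟩ := Finite.exists_max fun i => ‖v i‖ / f i
  set θ := ‖v i‖ / f i with hθ
  have hle : ∀ j, ‖v j‖ ≤ θ * f j := fun j => (div_le_iff₀ (hpos j)).1 (hi j)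
  have hθ0 : 0 < θ := lt_of_lt_of_le (div_pos (norm_pos_iff.2 hi₀) (hpos i₀)) (hi i₀)
  have hvi : v i = ∑ j, H.tickMatrix D w i j * v j := by
    have := congrFun hv0 i
    rw [Matrix.sub_mulVec, Matrix.one_mulVec, Pi.sub_apply, Pi.zero_apply, sub_eq_zero] at this
    exact this
  have h1 : ‖v i‖ ≤ ∑ j, H.tickMatrix D x i j * (θ * f j) := by
    conv_lhs => rw [hvi]
    refine (norm_sum_le _ _).trans (Finset.sum_le_sum fun j _ => ?_)
    rw [norm_mul]
    exact mul_le_mul (norm_tickMatrix_le H D hw i j) (hle j) (norm_nonneg _)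
      (tickMatrix_nonneg H D hx i j)
  have h2 : ∑ j, H.tickMatrix D x i j * (θ * f j) = θ * (f i - 1) := by
    have h := hc.eq_one_add hf i
    rw [show f i - 1 = ∑ j, H.tickMatrix D x i j * f j by rw [hfdef]; linarith, Finset.mul_sum]
    exact Finset.sum_congr rfl fun j _ => by ring
  have h3 : ‖v i‖ = θ * f i := by
    rw [hθ, div_mul_cancel₀ _ (hpos i).ne']
  rw [h2, h3] at h1
  nlinarith

/-- Cramer's rule for `(1 - M) f = 1`. -/
theorem IsPathCount.det_mul_eq [Fintype Q] [DecidableEq Q] (hc : H.IsPathCount D c) {x : ℝ}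
    {f : Q → ℝ} (hf : ∀ i, HasSum (fun n => (c i n : ℝ) * x ^ n) (f i)) (i : Q) :
    (1 - H.tickMatrix D x).det * f i = ∑ j, (1 - H.tickMatrix D x).adjugate i j := by
  have h1 : (1 - H.tickMatrix D x).mulVec f = fun _ => 1 := by
    funext j
    rw [Matrix.sub_mulVec, Matrix.one_mulVec, Pi.sub_apply]
    have := hc.eq_one_add hf j
    simp only [Matrix.mulVec, dotProduct]
    linarith
  have h2 := congrArg (fun v => (1 - H.tickMatrix D x).adjugate.mulVec v) h1
  simp only [Matrix.mulVec_mulVec, Matrix.adjugate_mul, Matrix.smul_mulVec, Matrix.one_mulVec] at h2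
  have h3 := congrFun h2 i
  simpa [Matrix.mulVec, dotProduct] using h3

/-- By Cramer's rule the generating function is, on `[0, R)`, a quotient that is continuous on `[0,
R]`, hence bounded. The terms are non-negative, so letting `x` tend to `R` bounds the partial sums
at `R`. -/
theorem IsPathCount.summable_of_det_ne_zero [Fintype Q] [DecidableEq Q]
    (hc : H.IsPathCount D c) {R : ℝ} (hR : 0 < R)
    (hs : ∀ x, 0 ≤ x → x < R → ∀ i, Summable fun n => (c i n : ℝ) * x ^ n)
    (hdet : (1 - H.tickMatrix D R).det ≠ 0) (i : Q) : Summable fun n => (c i n : ℝ) * R ^ n := by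
  have hdet' : ∀ x ∈ Set.Icc 0 R, (1 - H.tickMatrix D x).det ≠ 0 := by
    rintro x ⟨h0, h1⟩
    rcases h1.eq_or_lt with rfl | h1
    · exact hdet
    · have := hc.det_ne_zero h0 (hs x h0 h1) (w := (x : ℂ)) (by simp [abs_of_nonneg h0])
      intro h
      apply this
      rw [← ofReal_det_tickMatrix, h, Complex.ofReal_zero]
  have hcont : Continuous fun x : ℝ => 1 - H.tickMatrix D x :=
    continuous_const.sub (continuous_tickMatrix H D)
  have hcont' : ContinuousOn (fun x : ℝ => (∑ j, (1 - H.tickMatrix D x).adjugate i j) /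
      (1 - H.tickMatrix D x).det) (Set.Icc 0 R) := by
    refine ContinuousOn.div ?_ hcont.matrix_det.continuousOn hdet'
    exact (continuous_finsetSum _ fun j _ =>
      hcont.matrix_adjugate.matrix_elem i j).continuousOn
  obtain ⟨M, hM⟩ := isCompact_Icc.bddAbove_image hcont'
  have hpart : ∀ N, ∑ n ∈ Finset.range N, (c i n : ℝ) * R ^ n ≤ M := by
    intro N
    have ht : Filter.Tendsto (fun x : ℝ => ∑ n ∈ Finset.range N, (c i n : ℝ) * x ^ n) (𝓝[<] R)
        (𝓝 (∑ n ∈ Finset.range N, (c i n : ℝ) * R ^ n)) := by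
      have : Continuous fun x : ℝ => ∑ n ∈ Finset.range N, (c i n : ℝ) * x ^ n := by fun_prop
      exact this.continuousAt.mono_left nhdsWithin_le_nhds
    refine le_of_tendsto ht ?_
    filter_upwards [Ioo_mem_nhdsLT hR] with x hx
    have hf := fun i => (hs x hx.1.le hx.2 i).hasSum
    have h1 := hc.det_mul_eq hf i
    have hx' : x ∈ Set.Icc 0 R := ⟨hx.1.le, hx.2.le⟩
    have h2 := hM (Set.mem_image_of_mem _ hx')
    rw [← h1, mul_div_cancel_left₀ _ (hdet' x hx')] at h2
    refine le_trans ?_ h2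
    have hx0 := hx.1.le
    exact sum_le_hasSum _ (fun n _ => by positivity) (hf i)
  exact summable_of_sum_range_le (fun n => by positivity) hpart

theorem adjMatrix_eq_tickMatrix (hH : ∀ t ∈ H.trans, (tickCount D t.2.1 : ℚ≥0) = t.2.1 * D)
    (hD : 0 < D) (z : ℂ) : H.adjMatrix z = H.tickMatrix D (z ^ ((D : ℂ)⁻¹)) := by
  classical
  ext i j
  refine Finset.sum_congr rfl fun t ht => ?_
  rw [← Complex.cpow_nat_mul]
  congr 1
  have h := hH t (Finset.mem_filter.1 ht).1
  have hD' : (D : ℂ) ≠ 0 := by exact_mod_cast hD.ne'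
  rw [← div_eq_mul_inv, eq_div_iff hD']
  exact_mod_cast congrArg (fun r : ℚ≥0 => (r : ℂ)) h.symm

theorem charQuasiPoly_eq [Fintype Q] [DecidableEq Q]
    (hH : ∀ t ∈ H.trans, (tickCount D t.2.1 : ℚ≥0) = t.2.1 * D) (hD : 0 < D) (z : ℂ) :
    H.charQuasiPoly z = (1 - H.tickMatrix D (z ^ ((D : ℂ)⁻¹))).det := by
  rw [charQuasiPoly, adjMatrix_eq_tickMatrix hH hD]
  congr!

theorem norm_cpow_inv_pow (hD : 0 < D) (z : ℂ) : ‖z ^ ((D : ℂ)⁻¹)‖ ^ D = ‖z‖ := by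
  rw [← norm_pow, Complex.cpow_nat_inv_pow z hD.ne']

section

variable [Fintype Q] [Fintype A]

theorem isPathCount_wordCount (hH : H.PosTicks D) :
    H.determinize.IsPathCount D fun S n => H.wordCount D S n :=
  fun S n => by
    convert wordCount_eq hH S n

theorem natCast_tickCount_determinize (hH : H.IsDenom D) :
    ∀ t ∈ H.determinize.trans, (tickCount D t.2.1 : ℚ≥0) = t.2.1 * D := by
  rintro ⟨S, d, a, S'⟩ ht
  obtain ⟨q, hq⟩ := S'.2
  obtain ⟨p, -, hp⟩ := (mem_determinize_trans.1 ht q).1 hq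
  exact natCast_tickCount hH hp

/-- The word counts are at most `U n`, so their series converge below `γ⁻¹` and no root has modulus
below `(γ ^ D)⁻¹`. If some series diverges at `γ⁻¹`, the determinant must vanish there. If all
converge, the lower bound on `U` forces the second alternative. -/
theorem smallest_root [Nonempty Q] {G : STG Q A} (hG : G.IsDenom D) {γ : ℝ} {C : ℕ}
    (hγ : IsGrowth (fun n => (eventSets (G.ticks D) n).ncard) γ)
    (hC : ∀ n, γ ^ n ≤ C * (eventSets (G.ticks D) n).ncard) :
    (G.zeroElim.determinize.charQuasiPoly (((γ ^ D)⁻¹ : ℝ) : ℂ) = 0 ∧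
      ∀ z : ℂ, G.zeroElim.determinize.charQuasiPoly z = 0 → (γ ^ D)⁻¹ ≤ ‖z‖) ∨
    ((∀ z : ℂ, G.zeroElim.determinize.charQuasiPoly z ≠ 0) ∧ γ = 1) := by
  classical
  have hpos := posTicks_zeroElim hG
  have hD := hG.1
  set H := G.zeroElim with hHdef
  have hpc := isPathCount_wordCount hpos
  have hψ := charQuasiPoly_eq (natCast_tickCount_determinize (H := H) hG.zeroElim) hD
  have hγ1 := hγ.one_le
  have hγ0 : 0 < γ := by linarith
  have hR : 0 < γ⁻¹ := by positivity
  have hcg : ∀ (S : Finset Q) n, H.wordCount D S n ≤ G.exactCount D n := fun S n =>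
    (wordCount_mono hpos (Finset.subset_univ S) n).trans (wordCount_univ_le_exactCount G D n)
  have hcU : ∀ (S : Finset Q) n, H.wordCount D S n ≤ (eventSets (G.ticks D) n).ncard := by
    intro S n
    rw [ncard_eventSets_eq hG]
    exact (hcg S n).trans (Finset.single_le_sum (f := fun j => G.exactCount D j)
      (fun _ _ => Nat.zero_le _) (Finset.self_mem_range_succ n))
  have hsum : ∀ x, 0 ≤ x → x < γ⁻¹ → ∀ S : {S : Finset Q // S.Nonempty},
      Summable fun n => (H.wordCount D S n : ℝ) * x ^ n := by
    intro x hx0 hx S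
    have hx1 : x * γ < 1 := by
      have := mul_lt_mul_of_pos_right hx hγ0
      rwa [inv_mul_cancel₀ hγ0.ne'] at this
    refine Summable.of_nonneg_of_le (fun n => by positivity) (fun n => ?_) (hγ.summable x hx0 hx1)
    gcongr
    exact hcU S n
  have hmin : ∀ z : ℂ, G.zeroElim.determinize.charQuasiPoly z = 0 → (γ ^ D)⁻¹ ≤ ‖z‖ := by
    intro z hz
    by_contra hlt
    push Not at hlt
    have hw : ‖z ^ ((D : ℂ)⁻¹)‖ < γ⁻¹ := by
      refine lt_of_pow_lt_pow_left₀ D hR.le ?_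
      rwa [norm_cpow_inv_pow hD, inv_pow]
    rw [hψ] at hz
    exact hpc.det_ne_zero (norm_nonneg _) (hsum _ (norm_nonneg _) hw) le_rfl hz
  by_cases hall : ∀ S : {S : Finset Q // S.Nonempty},
      Summable fun n => (H.wordCount D S n : ℝ) * γ⁻¹ ^ n
  swap
  · left
    refine ⟨?_, hmin⟩
    push Not at hall
    obtain ⟨S, hS⟩ := hall
    have hdet : (1 - H.determinize.tickMatrix D γ⁻¹).det = 0 := by
      by_contra h
      exact hS (hpc.summable_of_det_ne_zero hR hsum h S)
    rw [hψ]
    have hw : (((γ ^ D)⁻¹ : ℝ) : ℂ) ^ ((D : ℂ)⁻¹) = ((γ⁻¹ : ℝ) : ℂ) := by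
      have hD' : (D : ℝ) ≠ 0 := by exact_mod_cast hD.ne'
      have : ((D : ℂ)⁻¹) = (((D : ℝ)⁻¹ : ℝ) : ℂ) := by push_cast; rfl
      rw [this, ← Complex.ofReal_cpow (by positivity), ← inv_pow,
        Real.pow_rpow_inv_natCast hR.le hD.ne']
    rw [hw]
    rw [← ofReal_det_tickMatrix, hdet, Complex.ofReal_zero]
  · right
    have hg : Summable fun n => (G.exactCount D n : ℝ) * γ⁻¹ ^ n := by
      have h1 := (hall ⟨Finset.univ, Finset.univ_nonempty⟩).mul_left
        ((Fintype.card (Finset A) : ℕ) : ℝ)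
      refine Summable.of_nonneg_of_le (fun n => by positivity) (fun n => ?_) h1
      rw [← mul_assoc]
      gcongr
      exact_mod_cast exactCount_le hG n
    -- If `γ > 1`, then `U n * γ⁻¹ ^ n` is the convolution of two summable sequences, the exact
    -- counts and the constant `1`, both weighted by powers of `γ⁻¹`. It would tend to `0`, although
    -- it is at least `1 / (C + 1)`.
    have hγeq : γ = 1 := by
      by_contra hne
      have hγ2 : 1 < γ := lt_of_le_of_ne hγ1 (Ne.symm hne)
      have hgeo : Summable fun n : ℕ => γ⁻¹ ^ n :=
        summable_geometric_of_lt_one hR.le (inv_lt_one_of_one_lt₀ hγ2)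
      have hconv := summable_norm_sum_mul_antidiagonal_of_summable_norm
        hg.norm hgeo.norm
      have ht := hconv.tendsto_atTop_zero
      have hlow : ∀ n, 1 / ((C : ℝ) + 1) ≤ ‖∑ kl ∈ Finset.HasAntidiagonal.antidiagonal n,
          (G.exactCount D kl.1 : ℝ) * γ⁻¹ ^ kl.1 * γ⁻¹ ^ kl.2‖ := by
        intro n
        have h1 : ∑ kl ∈ Finset.HasAntidiagonal.antidiagonal n,
            (G.exactCount D kl.1 : ℝ) * γ⁻¹ ^ kl.1 * γ⁻¹ ^ kl.2 =
            ((eventSets (G.ticks D) n).ncard : ℝ) * γ⁻¹ ^ n := by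
          rw [ncard_eventSets_eq hG, Nat.cast_sum, Finset.sum_mul,
            ← Finset.Nat.sum_antidiagonal_eq_sum_range_succ_mk
              (f := fun kl => (G.exactCount D kl.1 : ℝ) * γ⁻¹ ^ n)]
          refine Finset.sum_congr rfl fun kl hkl => ?_
          rw [mul_assoc, ← pow_add, Finset.HasAntidiagonal.mem_antidiagonal.1 hkl]
        rw [h1, Real.norm_of_nonneg (by positivity), div_le_iff₀ (by positivity), inv_pow,
          mul_assoc, ← div_eq_inv_mul, ← mul_div_assoc, le_div_iff₀ (by positivity), one_mul]
        have := hC n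
        have h2 : (0 : ℝ) ≤ (eventSets (G.ticks D) n).ncard := by positivity
        nlinarith
      have h0 := ge_of_tendsto' ht hlow
      have : (0 : ℝ) < 1 / ((C : ℝ) + 1) := by positivity
      linarith
    refine ⟨fun z => ?_, hγeq⟩
    subst hγeq
    simp only [inv_one, one_pow, mul_one] at hg
    -- A summable sequence of natural numbers is eventually zero, so the generating functions are
    -- polynomials and the non-vanishing argument applies on every disc.
    have hev : ∀ᶠ n in Filter.atTop, G.exactCount D n = 0 := by
      filter_upwards [hg.tendsto_atTop_zero.eventually_lt_const one_pos] with n hn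
      have : G.exactCount D n < 1 := by exact_mod_cast hn
      omega
    obtain ⟨N, hN⟩ := Filter.eventually_atTop.1 hev
    rw [hψ]
    refine hpc.det_ne_zero (norm_nonneg _) (fun S => ?_) le_rfl
    refine summable_of_ne_finset_zero (s := Finset.range N) fun n hn => ?_
    have h0 : H.wordCount D S n = 0 :=
      Nat.eq_zero_of_le_zero ((hcg S n).trans (hN n (by simpa using hn)).le)
    simp [h0]

end

end STG

/-! ### Linear recurrences via the shift operator -/

open Polynomial in
/-- If the coefficients of `p` vanish from `d` on, sums over its coefficients run up to `d`. -/
theorem Polynomial.sum_range_coeff_eq {R M : Type*} [Semiring R] [AddCommMonoid M] (p : R[X])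
    {d : ℕ} (hd : ∀ i, d ≤ i → p.coeff i = 0) (g : ℕ → R → M) (hg : ∀ i, g i 0 = 0) :
    ∑ i ∈ Finset.range d, g i (p.coeff i) = p.sum g := by
  rw [Polynomial.sum_def]
  symm
  refine Finset.sum_subset (fun i hi => ?_) fun i _ hi => ?_
  · rw [Finset.mem_range]
    by_contra h
    exact (mem_support_iff.1 hi) (hd i (not_lt.1 h))
  · rw [notMem_support_iff.1 hi, hg]

/-- The shift operator on rational sequences. -/
def seqShift : (ℕ → ℚ) →ₗ[ℚ] (ℕ → ℚ) := LinearMap.funLeft ℚ ℚ Nat.succ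

theorem seqShift_pow_apply (i : ℕ) (y : ℕ → ℚ) (n : ℕ) : (seqShift ^ i) y n = y (n + i) := by
  induction i generalizing n with
  | zero => simp
  | succ i ih =>
    rw [pow_succ', Module.End.mul_apply]
    change (seqShift ^ i) y (n + 1) = _
    rw [ih]
    congr 1
    omega

theorem aeval_seqShift_apply (p : Polynomial ℚ) {d : ℕ} (hd : ∀ i, d ≤ i → p.coeff i = 0)
    (y : ℕ → ℚ) (n : ℕ) :
    Polynomial.aeval seqShift p y n = ∑ i ∈ Finset.range d, p.coeff i * y (n + i) := by
  rw [p.sum_range_coeff_eq hd (fun i a => a * y (n + i)) (by simp), Polynomial.aeval_def,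
    Polynomial.eval₂_eq_sum, Polynomial.sum_def, Polynomial.sum_def, LinearMap.sum_apply,
    Finset.sum_apply]
  refine Finset.sum_congr rfl fun i _ => ?_
  rw [Module.End.mul_apply, Module.algebraMap_end_apply, Pi.smul_apply, seqShift_pow_apply,
    smul_eq_mul]

/-- `y` lies in a shift-invariant space of dimension at most `K`. -/
def IsRecurrent (K : ℕ) (y : ℕ → ℚ) : Prop :=
  ∃ V : Submodule ℚ (ℕ → ℚ), FiniteDimensional ℚ V ∧ (∀ z ∈ V, seqShift z ∈ V) ∧
    Module.finrank ℚ V ≤ K ∧ y ∈ V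

/-- Cayley–Hamilton for the shift restricted to `V`. -/
theorem exists_monic_annihilator {V : Submodule ℚ (ℕ → ℚ)} [FiniteDimensional ℚ V]
    (hV : ∀ z ∈ V, seqShift z ∈ V) :
    ∃ p : Polynomial ℚ, p.Monic ∧ p.natDegree = Module.finrank ℚ V ∧
      ∀ y ∈ V, Polynomial.aeval seqShift p y = 0 := by
  let f : V →ₗ[ℚ] V := seqShift.restrict hV
  refine ⟨f.charpoly, f.charpoly_monic, f.charpoly_natDegree, fun y hy => ?_⟩
  have hpow : ∀ (i : ℕ) (z : V), ((f ^ i) z : ℕ → ℚ) = (seqShift ^ i) z := by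
    intro i
    induction i with
    | zero => simp
    | succ i ih =>
      intro z
      rw [pow_succ, pow_succ, Module.End.mul_apply, Module.End.mul_apply, ih]
      rfl
  have h := congrArg (fun g => ((g ⟨y, hy⟩ : V) : ℕ → ℚ)) f.aeval_self_charpoly
  simp only [LinearMap.zero_apply, ZeroMemClass.coe_zero] at h
  rw [← h, Polynomial.aeval_def, Polynomial.aeval_def, Polynomial.eval₂_eq_sum,
    Polynomial.eval₂_eq_sum, Polynomial.sum_def, Polynomial.sum_def, LinearMap.sum_apply,
    LinearMap.sum_apply, Submodule.coe_sum]
  refine Finset.sum_congr rfl fun i _ => ?_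
  rw [Module.End.mul_apply, Module.End.mul_apply, Module.algebraMap_end_apply,
    Module.algebraMap_end_apply, Submodule.coe_smul, hpow]

/-- A monic recurrence of order at most `K` propagates `K` initial zeros. This makes an identity
between infinite sequences checkable on finitely many terms. -/
theorem IsRecurrent.eq_zero {K : ℕ} {y : ℕ → ℚ} (h : IsRecurrent K y)
    (h0 : ∀ n < K, y n = 0) : y = 0 := by
  obtain ⟨V, _, hV, hK, hy⟩ := h
  obtain ⟨p, hp, hdeg, hann⟩ := exists_monic_annihilator hV
  funext n
  induction n using Nat.strong_induction_on with
  | _ n ih =>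
    by_cases hn : n < K
    · exact h0 n hn
    · have h1 := congrFun (hann y hy) (n - p.natDegree)
      rw [aeval_seqShift_apply p (d := p.natDegree + 1)
        (fun i hi => Polynomial.coeff_eq_zero_of_natDegree_lt (by omega)),
        Finset.sum_range_succ, Finset.sum_eq_zero, zero_add, hp.coeff_natDegree, one_mul] at h1
      · rwa [Nat.sub_add_cancel (by omega)] at h1
      · intro i hi
        have := Finset.mem_range.1 hi
        rw [ih (n - p.natDegree + i) (by omega)]
        simp

theorem IsRecurrent.exists_annihilator {K : ℕ} {y : ℕ → ℚ} (h : IsRecurrent K y) :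
    ∃ p : Polynomial ℚ, p ≠ 0 ∧ Polynomial.aeval seqShift p y = 0 := by
  obtain ⟨V, _, hV, -, hy⟩ := h
  obtain ⟨p, hp, -, hann⟩ := exists_monic_annihilator hV
  exact ⟨p, hp.ne_zero, hann y hy⟩

theorem IsRecurrent.sum_shift {K : ℕ} {y : ℕ → ℚ} (h : IsRecurrent K y) (d : ℕ) (a : ℕ → ℚ) :
    IsRecurrent K fun n => ∑ i ∈ Finset.range d, a i * y (n + i) := by
  obtain ⟨V, h1, h2, h3, h4⟩ := h
  refine ⟨V, h1, h2, h3, ?_⟩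
  have hpow : ∀ i, (seqShift ^ i) y ∈ V := by
    intro i
    induction i with
    | zero => simpa using h4
    | succ i ih =>
      rw [pow_succ', Module.End.mul_apply]
      exact h2 _ ih
  have : (fun n => ∑ i ∈ Finset.range d, a i * y (n + i)) =
      ∑ i ∈ Finset.range d, a i • (seqShift ^ i) y := by
    funext n
    rw [Finset.sum_apply]
    exact Finset.sum_congr rfl fun i _ => by
      rw [Pi.smul_apply, seqShift_pow_apply, smul_eq_mul]
  rw [this]
  exact V.sum_mem fun i _ => V.smul_mem _ (hpow i)

/-- Sampling along multiples of `D` turns the `D`-th power of the shift into the shift, and a linear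
image has no larger dimension. -/
theorem IsRecurrent.comp_mul {K : ℕ} {y : ℕ → ℚ} (h : IsRecurrent K y) (D : ℕ) :
    IsRecurrent K fun n => y (D * n) := by
  obtain ⟨V, h1, h2, h3, h4⟩ := h
  refine ⟨V.map (LinearMap.funLeft ℚ ℚ fun n => D * n), inferInstance, ?_,
    (Submodule.finrank_map_le _ V).trans h3, ⟨y, h4, rfl⟩⟩
  have hpow : ∀ i, ∀ z ∈ V, (seqShift ^ i) z ∈ V := by
    intro i
    induction i with
    | zero => simp
    | succ i ih =>
      intro z hz
      rw [pow_succ', Module.End.mul_apply]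
      exact h2 _ (ih z hz)
  rintro _ ⟨z, hz, rfl⟩
  refine ⟨_, hpow D z hz, ?_⟩
  funext n
  change (seqShift ^ D) z (D * n) = z (D * (n + 1))
  rw [seqShift_pow_apply, mul_add, mul_one]

namespace STG

variable {Q A : Type*} [Fintype Q] [Fintype A] {G : STG Q A} {D : ℕ}

/-- The invariant space is spanned by `U` and the word counts from each `S` delayed by `j < M`
ticks. Shifting lowers `j`. At `j = 0` the first-letter recursion rewrites the shifted count with
delays below `M`, and `U (n + 1) - U n` is a sum of shifted word counts. -/
theorem isRecurrent_ncard_eventSets (hG : G.IsDenom D) {M : ℕ}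
    (hM : ∀ t ∈ G.trans, tickCount D t.2.1 ≤ M) :
    IsRecurrent (1 + 2 ^ Fintype.card Q * M)
      fun n => ((eventSets (G.ticks D) n).ncard : ℚ) := by
  classical
  set H := G.zeroElim with hH
  have hpos := posTicks_zeroElim hG
  have hdpos := hpos.determinize
  have hMd : ∀ t ∈ H.determinize.trans, tickCount D t.2.1 ≤ M := by
    rintro ⟨S, d, B, S'⟩ ht
    obtain ⟨q, hq⟩ := S'.2
    obtain ⟨p, -, hp⟩ := (mem_determinize_trans.1 ht q).1 hq
    obtain ⟨-, a, q₀, l, hd, -⟩ := mem_zeroElim_trans.1 hp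
    exact hM _ hd
  let e : {S : Finset Q // S.Nonempty} → ℕ → ℕ → ℚ := fun S j n =>
    if j ≤ n then (H.wordCount D S (n - j) : ℚ) else 0
  let U : ℕ → ℚ := fun n => ((eventSets (G.ticks D) n).ncard : ℚ)
  let b : Option ({S : Finset Q // S.Nonempty} × Fin M) → ℕ → ℚ := fun o =>
    o.elim U fun x => e x.1 x.2
  let V := Submodule.span ℚ (Set.range b)
  have he : ∀ S j, j < M → e S j ∈ V := fun S j hj =>
    Submodule.subset_span ⟨some (S, ⟨j, hj⟩), rfl⟩
  have hU : U ∈ V := Submodule.subset_span ⟨none, rfl⟩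
  have hword : ∀ S : {S : Finset Q // S.Nonempty},
      (fun n => (H.wordCount D S (n + 1) : ℚ)) ∈ V := by
    intro S
    have : (fun n => (H.wordCount D S (n + 1) : ℚ)) =
        ∑ t ∈ H.determinize.trans with t.1 = S, e t.2.2.2 (tickCount D t.2.1 - 1) := by
      funext n
      rw [wordCount_eq hpos, Finset.sum_apply, if_neg (by omega), zero_add, Nat.cast_sum]
      refine Finset.sum_congr rfl fun t ht => ?_
      have h1 := hdpos t (Finset.mem_filter.1 ht).1
      simp only [e]
      by_cases hle : tickCount D t.2.1 ≤ n + 1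
      · rw [if_pos hle, if_pos (by omega)]
        congr 2
        omega
      · rw [if_neg hle, if_neg (by omega), Nat.cast_zero]
    rw [this]
    refine V.sum_mem fun t ht => he _ _ ?_
    have h1 := hdpos t (Finset.mem_filter.1 ht).1
    have h2 := hMd t (Finset.mem_filter.1 ht).1
    omega
  refine ⟨V, FiniteDimensional.span_of_finite ℚ (Set.finite_range b), ?_, ?_, hU⟩
  · suffices h : V ≤ V.comap seqShift from fun z hz => h hz
    rw [Submodule.span_le]
    rintro _ ⟨_ | ⟨S, j⟩, rfl⟩
    · change seqShift U ∈ V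
      have : seqShift U = U + ∑ B : Finset A, fun n =>
          (H.wordCount D (G.zeroReach B) (n + 1) : ℚ) := by
        funext n
        change U (n + 1) = _
        simp only [U]
        rw [ncard_eventSets_eq hG, Finset.sum_range_succ, ← ncard_eventSets_eq hG, exactCount,
          Pi.add_apply, Finset.sum_apply]
        push_cast
        rfl
      rw [this]
      refine V.add_mem hU (V.sum_mem fun B _ => ?_)
      rcases (G.zeroReach B).eq_empty_or_nonempty with h | h
      · have h0 : (fun n => (H.wordCount D (G.zeroReach B) (n + 1) : ℚ)) = 0 := by
          funext n
          simp [h, wordCount, wordsFrom]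
        rw [h0]
        exact V.zero_mem
      · exact hword ⟨_, h⟩
    · change seqShift (e S j) ∈ V
      rcases Nat.eq_zero_or_pos (j : ℕ) with hj | hj
      · have : seqShift (e S j) = fun n => (H.wordCount D S (n + 1) : ℚ) := by
          funext n
          change e S j (n + 1) = _
          simp [e, hj]
        rw [this]
        exact hword S
      · have : seqShift (e S j) = e S (j - 1) := by
          funext n
          change e S j (n + 1) = _
          simp only [e]
          by_cases hle : (j : ℕ) ≤ n + 1
          · rw [if_pos hle, if_pos (by omega)]
            congr 2
            omega
          · rw [if_neg hle, if_neg (by omega)]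
        rw [this]
        exact he S _ (by have := j.2; omega)
  · refine (finrank_range_le_card b).trans ?_
    rw [Fintype.card_option, Fintype.card_prod, Fintype.card_fin, add_comm]
    gcongr
    refine (Fintype.card_subtype_le _).trans ?_
    rw [Fintype.card_finset]

end STG

/-! ### The growth rate as a root of annihilating polynomials -/

section Recurrence

/-- The numerator of the generating function of a recurrent sequence, in the variable `x⁻¹`. -/
noncomputable def recNum (a : ℕ → ℝ) (d : ℕ) (u : ℕ → ℕ) (x : ℝ) : ℝ :=
  ∑ i ∈ Finset.range d, a i * x ^ i * ∑ k ∈ Finset.range i, (u k : ℝ) * x⁻¹ ^ k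

variable {a : ℕ → ℝ} {d : ℕ} {u : ℕ → ℕ}

/-- With `P` the polynomial with coefficients `a` and `F` the series in `x⁻¹`, the recurrence kills
all of `P * F` except the finitely many boundary terms gathered in `recNum`. -/
theorem sum_mul_eq_recNum (h : ∀ n, ∑ i ∈ Finset.range d, a i * (u (n + i) : ℝ) = 0) {x f : ℝ}
    (hx : 0 < x) (hf : HasSum (fun k => (u k : ℝ) * x⁻¹ ^ k) f) :
    (∑ i ∈ Finset.range d, a i * x ^ i) * f = recNum a d u x := by
  have h1 : ∀ i, HasSum (fun n => a i * (u (n + i) : ℝ) * x⁻¹ ^ n)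
      (a i * x ^ i * (f - ∑ k ∈ Finset.range i, (u k : ℝ) * x⁻¹ ^ k)) := by
    intro i
    refine (((hasSum_nat_add_iff' i).2 hf).mul_left (a i * x ^ i)).congr_fun fun n => ?_
    have : x ^ i * x⁻¹ ^ i = 1 := by rw [← mul_pow, mul_inv_cancel₀ hx.ne', one_pow]
    rw [pow_add]
    linear_combination (-a i * u (n + i) * x⁻¹ ^ n) * this
  have h2 := hasSum_sum (s := Finset.range d) fun i _ => h1 i
  have h3 : (fun n => ∑ i ∈ Finset.range d, a i * (u (n + i) : ℝ) * x⁻¹ ^ n) = fun _ => 0 := by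
    funext n
    rw [← Finset.sum_mul, h n, zero_mul]
  rw [h3] at h2
  have h4 := h2.unique hasSum_zero
  rw [recNum, Finset.sum_mul, ← sub_eq_zero, ← Finset.sum_sub_distrib, ← h4]
  exact Finset.sum_congr rfl fun i _ => by ring

variable {α : ℝ} {C : ℕ}

theorem IsGrowth.le_sum (hα : IsGrowth u α) (hC : ∀ n, α ^ n ≤ C * u n) {x : ℝ} (hx : 0 < x)
    (hxα : x ≤ α) (N : ℕ) :
    (N : ℝ) / C ≤ ∑ k ∈ Finset.range N, (u k : ℝ) * x⁻¹ ^ k := by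
  have hC0 : (0 : ℝ) < C := by
    have h0 := hC 0
    have h1 : (0 : ℝ) < u 0 := by exact_mod_cast hα.pos 0
    by_contra h
    have : (C : ℝ) = 0 := le_antisymm (not_lt.1 h) (by positivity)
    rw [this] at h0
    norm_num at h0
  have h1 : ∀ k ∈ Finset.range N, 1 / (C : ℝ) ≤ (u k : ℝ) * x⁻¹ ^ k := by
    intro k _
    rw [inv_pow, ← div_eq_mul_inv, div_le_div_iff₀ hC0 (by positivity), one_mul, mul_comm]
    exact (pow_le_pow_left₀ hx.le hxα k).trans (hC k)
  have := Finset.sum_le_sum h1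
  simpa [div_eq_mul_inv] using this

/-- For `x > α`, `|P x|` times a partial sum of `F` is at most `|recNum|`; this passes to the limit
`x = α`. There the partial sums are at least `N / C`, hence unbounded, while the right side is
fixed, so `P α = 0`. -/
theorem IsGrowth.isRoot (hα : IsGrowth u α) (hC : ∀ n, α ^ n ≤ C * u n)
    (h : ∀ n, ∑ i ∈ Finset.range d, a i * (u (n + i) : ℝ) = 0) :
    ∑ i ∈ Finset.range d, a i * α ^ i = 0 := by
  have hα0 : 0 < α := lt_of_lt_of_le one_pos hα.one_le
  have key : ∀ N, |∑ i ∈ Finset.range d, a i * α ^ i| *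
      ∑ k ∈ Finset.range N, (u k : ℝ) * α⁻¹ ^ k ≤ |recNum a d u α| := by
    intro N
    have hinv : ContinuousAt (fun x : ℝ => x⁻¹) α := continuousAt_inv₀ hα0.ne'
    have hl : ContinuousAt (fun x : ℝ => |∑ i ∈ Finset.range d, a i * x ^ i| *
        ∑ k ∈ Finset.range N, (u k : ℝ) * x⁻¹ ^ k) α := by
      refine ContinuousAt.mul (by fun_prop) (tendsto_finsetSum _ fun k _ => ?_)
      exact continuousAt_const.mul (hinv.pow k)
    have hr : ContinuousAt (fun x : ℝ => |recNum a d u x|) α := by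
      refine ContinuousAt.abs (tendsto_finsetSum _ fun i _ => ?_)
      refine ContinuousAt.mul (by fun_prop) (tendsto_finsetSum _ fun k _ => ?_)
      exact continuousAt_const.mul (hinv.pow k)
    refine le_of_tendsto_of_tendsto (hl.mono_left nhdsWithin_le_nhds)
      (hr.mono_left nhdsWithin_le_nhds) (b := 𝓝[>] α) ?_
    filter_upwards [self_mem_nhdsWithin] with x hx
    have hx' : α < x := hx
    have hx0 : 0 < x := hα0.trans hx'
    have hs := hα.summable x⁻¹ (by positivity) (by rw [inv_mul_lt_one₀ hx0]; exact hx')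
    rw [← sum_mul_eq_recNum h hx0 hs.hasSum, abs_mul]
    gcongr
    exact (hs.sum_le_tsum _ fun k _ => by positivity).trans (le_abs_self _)
  by_contra hne
  have hpos := abs_pos.2 hne
  set P := |∑ i ∈ Finset.range d, a i * α ^ i|
  obtain ⟨N, hN⟩ := exists_nat_gt (|recNum a d u α| / P * C)
  have h1 := key N
  have h2 := hα.le_sum hC hα0 le_rfl N
  have hC0 : (0 : ℝ) < C := by
    by_contra h
    have hC' : (C : ℝ) = 0 := le_antisymm (not_lt.1 h) (by positivity)
    have h0 := hC 0
    rw [hC'] at h0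
    norm_num at h0
  have h3 : |recNum a d u α| / P < N / C := by rwa [lt_div_iff₀ hC0]
  rw [div_lt_iff₀ hpos] at h3
  nlinarith

/-- If `α < x`, the series converges and `P * recNum = P ^ 2 * F` strictly exceeds `P ^ 2` times any
partial sum. Hence `hle`, which involves only finite sums, certifies `x ≤ α`; the extra factor `P`
avoids a case split on its sign. -/
theorem IsGrowth.le_of_recNum_le (hα : IsGrowth u α)
    (h : ∀ n, ∑ i ∈ Finset.range d, a i * (u (n + i) : ℝ) = 0) {x : ℝ} (hx : 0 < x)
    (hne : ∑ i ∈ Finset.range d, a i * x ^ i ≠ 0) {N : ℕ}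
    (hle : (∑ i ∈ Finset.range d, a i * x ^ i) * recNum a d u x ≤
      (∑ i ∈ Finset.range d, a i * x ^ i) ^ 2 * ∑ k ∈ Finset.range N, (u k : ℝ) * x⁻¹ ^ k) :
    x ≤ α := by
  by_contra hlt
  push Not at hlt
  have hs := hα.summable x⁻¹ (by positivity) (by rw [inv_mul_lt_one₀ hx]; exact hlt)
  rw [← sum_mul_eq_recNum h hx hs.hasSum] at hle
  have h1 : ∑ k ∈ Finset.range (N + 1), (u k : ℝ) * x⁻¹ ^ k ≤ ∑' k, (u k : ℝ) * x⁻¹ ^ k :=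
    hs.sum_le_tsum _ fun k _ => by positivity
  rw [Finset.sum_range_succ] at h1
  have h2 : 0 < (u N : ℝ) * x⁻¹ ^ N := by
    have : (0 : ℝ) < u N := by exact_mod_cast hα.pos N
    positivity
  have h3 : 0 < (∑ i ∈ Finset.range d, a i * x ^ i) ^ 2 := by positivity
  nlinarith

end Recurrence

/-! ### Monotonicity on an interval from coefficient bounds -/

section Isolation

/-- Interval arithmetic: on `[x₀, x₁]` the part of the derivative coming from `s` is smallest at
`x₀` and the part coming from `t` is largest at `x₁`. -/
theorem strictMonoOn_of_coeff_bounds {d : ℕ} {s t : ℕ → ℝ} (hs : ∀ i, 0 ≤ s i)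
    (ht : ∀ i, 0 ≤ t i) {x₀ x₁ : ℝ} (h0 : 0 ≤ x₀)
    (h : ∑ i ∈ Finset.range d, t i * (i * x₁ ^ (i - 1)) <
      ∑ i ∈ Finset.range d, s i * (i * x₀ ^ (i - 1))) :
    StrictMonoOn (fun x : ℝ => ∑ i ∈ Finset.range d, (s i - t i) * x ^ i) (Set.Icc x₀ x₁) := by
  refine strictMonoOn_of_deriv_pos (convex_Icc _ _) (by fun_prop) fun x hx => ?_
  rw [interior_Icc] at hx
  have hd : HasDerivAt (fun x : ℝ => ∑ i ∈ Finset.range d, (s i - t i) * x ^ i)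
      (∑ i ∈ Finset.range d, (s i - t i) * (i * x ^ (i - 1))) x :=
    HasDerivAt.fun_sum fun i _ => (hasDerivAt_pow i x).const_mul _
  rw [hd.deriv]
  have hx0 : 0 ≤ x := h0.trans hx.1.le
  have h1 : ∑ i ∈ Finset.range d, s i * (i * x₀ ^ (i - 1)) ≤
      ∑ i ∈ Finset.range d, s i * (i * x ^ (i - 1)) :=
    Finset.sum_le_sum fun i _ => by
      have := hs i
      have := hx.1.le
      gcongr
  have h2 : ∑ i ∈ Finset.range d, t i * (i * x ^ (i - 1)) ≤
      ∑ i ∈ Finset.range d, t i * (i * x₁ ^ (i - 1)) :=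
    Finset.sum_le_sum fun i _ => by
      have := ht i
      have := hx.2.le
      gcongr
  simp only [sub_mul, Finset.sum_sub_distrib]
  linarith

end Isolation

/-! ### Integer polynomials as lists of coefficients -/

section Lists

open Polynomial

/-- The integer coefficients given as differences. -/
def intCoeffs (l : List (ℕ × ℕ)) : List ℤ := l.map fun c => (c.1 : ℤ) - (c.2 : ℤ)

/-- Product of lists of coefficients. -/
def listMul (p q : List ℤ) : List ℤ :=
  (List.range (p.length + q.length)).map fun n =>
    ∑ i ∈ Finset.range (n + 1), p.getD i 0 * q.getD (n - i) 0

/-- Power of a list of coefficients. -/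
def listPow (q : List ℤ) : ℕ → List ℤ
  | 0 => [1]
  | m + 1 => listMul (listPow q m) q

/-- `l` is the list of coefficients of `p`, up to trailing zeros. -/
def IsCoeffList (l : List ℤ) (p : ℤ[X]) : Prop := ∀ i, p.coeff i = l.getD i 0

theorem isCoeffList_intCoeffs (l : List (ℕ × ℕ)) : IsCoeffList (intCoeffs l) (polyOfCode l) := by
  induction l with
  | nil => intro i; simp [polyOfCode, intCoeffs]
  | cons c l ih =>
    intro i
    rw [polyOfCode]
    cases i with
    | zero => simp [intCoeffs]
    | succ i =>
      rw [coeff_add, coeff_X_mul, coeff_C_succ, zero_add, ih i]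
      simp [intCoeffs]

theorem IsCoeffList.mul {l l' : List ℤ} {p q : ℤ[X]} (h : IsCoeffList l p)
    (h' : IsCoeffList l' q) : IsCoeffList (listMul l l') (p * q) := by
  intro n
  have h1 : (p * q).coeff n = ∑ i ∈ Finset.range (n + 1), l.getD i 0 * l'.getD (n - i) 0 := by
    rw [coeff_mul, Finset.Nat.sum_antidiagonal_eq_sum_range_succ_mk]
    exact Finset.sum_congr rfl fun i _ => by rw [h, h']
  rw [h1, listMul]
  by_cases hn : n < l.length + l'.length
  · simp [List.getD_eq_getElem?_getD, hn]
  · rw [List.getD_eq_default _ _ (by simpa using hn)]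
    refine Finset.sum_eq_zero fun i _ => ?_
    by_cases hi : i < l.length
    · rw [List.getD_eq_default l' _ (by omega), mul_zero]
    · rw [List.getD_eq_default l _ (by omega), zero_mul]

theorem IsCoeffList.pow {l : List ℤ} {p : ℤ[X]} (h : IsCoeffList l p) (m : ℕ) :
    IsCoeffList (listPow l m) (p ^ m) := by
  induction m with
  | zero =>
    intro i
    rw [pow_zero, listPow, coeff_one]
    cases i <;> simp
  | succ m ih => exact pow_succ p m ▸ ih.mul h

theorem IsCoeffList.coeff_eq_zero {l : List ℤ} {p : ℤ[X]} (h : IsCoeffList l p) {i : ℕ}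
    (hi : l.length ≤ i) : p.coeff i = 0 := by
  rw [h, List.getD_eq_default _ _ hi]

theorem IsCoeffList.aeval_eq {l : List ℤ} {p : ℤ[X]} (h : IsCoeffList l p) (x : ℝ) :
    aeval x p = ∑ i ∈ Finset.range l.length, (l.getD i 0 : ℝ) * x ^ i := by
  rw [aeval_def, eval₂_eq_sum, ← p.sum_range_coeff_eq (fun i hi => h.coeff_eq_zero hi) _ (by simp)]
  exact Finset.sum_congr rfl fun i _ => by rw [h]; simp

theorem exists_polyOfCode (p : ℤ[X]) : ∃ l, polyOfCode l = p := by
  refine ⟨(List.range (p.natDegree + 1)).map fun i =>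
    ((p.coeff i).toNat, (-p.coeff i).toNat), ?_⟩
  ext i
  rw [isCoeffList_intCoeffs, intCoeffs, List.map_map]
  by_cases hi : i < p.natDegree + 1
  · simp [List.getD_eq_getElem?_getD, hi]
  · rw [List.getD_eq_default _ _ (by simpa using hi), coeff_eq_zero_of_natDegree_lt (by omega)]

end Lists

/-! ### Certificates for the growth rate, in integer arithmetic -/

/-- Data isolating the growth rate of a recurrent sequence: a polynomial and a power of it that
annihilates the sequence, an interval `[A / (B + 1), A' / (B + 1)]` given by `(A, A', B)`, and two
indices witnessing that the growth rate lies in this interval. -/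
abbrev RootCert : Type := List (ℕ × ℕ) × ℕ × (ℕ × ℕ × ℕ) × ℕ × ℕ

section Hom

/-- The `n`-th value of the image of `u` under the operator with coefficients `p`. -/
def annSum (p : List ℤ) (u : ℕ → ℕ) (n : ℕ) : ℤ :=
  ∑ i ∈ Finset.range p.length, p.getD i 0 * (u (n + i) : ℤ)

/-- The value of a polynomial at `A / B`, with denominators cleared. -/
def evalHom (p : List ℤ) (A B : ℕ) : ℤ :=
  ∑ i ∈ Finset.range p.length, p.getD i 0 * ((A ^ i * B ^ (p.length - i) : ℕ) : ℤ)

/-- The numerator of the generating function at `A / B`, with denominators cleared. -/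
def numHom (p : List ℤ) (u : ℕ → ℕ) (A B : ℕ) : ℤ :=
  ∑ i ∈ Finset.range p.length, p.getD i 0 *
    ((∑ k ∈ Finset.range i, u k * (A ^ (i - k) * B ^ (p.length - i + k)) : ℕ) : ℤ)

/-- A partial sum of the generating function at `A / B`, with denominators cleared. -/
def geomHom (u : ℕ → ℕ) (N A B : ℕ) : ℕ :=
  ∑ k ∈ Finset.range N, u k * (B ^ k * A ^ (N - k))

/-- The value at `A / B` of the derivative, with denominators cleared. -/
def derivHom (s : List ℕ) (A B : ℕ) : ℕ :=
  ∑ i ∈ Finset.range s.length, s.getD i 0 * (i * (A ^ (i - 1) * B ^ (s.length - i)))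

variable {A B : ℕ}

theorem pow_mul_pow_sub_eq (hB : 0 < B) {i n : ℕ} (hi : i ≤ n) :
    (A : ℝ) ^ i * (B : ℝ) ^ (n - i) = (B : ℝ) ^ n * ((A : ℝ) / B) ^ i := by
  have hB' : (B : ℝ) ≠ 0 := by exact_mod_cast hB.ne'
  rw [div_pow, ← mul_div_assoc, eq_div_iff (pow_ne_zero _ hB'), mul_assoc, ← pow_add,
    Nat.sub_add_cancel hi, mul_comm]

theorem evalHom_eq (hB : 0 < B) (p : List ℤ) : (evalHom p A B : ℝ) =
    (B : ℝ) ^ p.length * ∑ i ∈ Finset.range p.length, (p.getD i 0 : ℝ) * ((A : ℝ) / B) ^ i := by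
  rw [evalHom, Finset.mul_sum]
  push_cast
  refine Finset.sum_congr rfl fun i hi => ?_
  rw [pow_mul_pow_sub_eq hB (Finset.mem_range.1 hi).le]
  ring

theorem numHom_eq (hA : 0 < A) (hB : 0 < B) (p : List ℤ) (u : ℕ → ℕ) :
    (numHom p u A B : ℝ) =
      (B : ℝ) ^ p.length * recNum (fun i => (p.getD i 0 : ℝ)) p.length u ((A : ℝ) / B) := by
  have hA' : (A : ℝ) ≠ 0 := by exact_mod_cast hA.ne'
  have hB' : (B : ℝ) ≠ 0 := by exact_mod_cast hB.ne'
  rw [numHom, recNum, Finset.mul_sum]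
  push_cast
  refine Finset.sum_congr rfl fun i hi => ?_
  rw [Finset.mul_sum, Finset.mul_sum, Finset.mul_sum]
  refine Finset.sum_congr rfl fun k hk => ?_
  have hi' := Finset.mem_range.1 hi
  have hk' := Finset.mem_range.1 hk
  have h1 : p.length - i + k = p.length - (i - k) := by omega
  rw [h1, pow_mul_pow_sub_eq hB (by omega)]
  have h2 : ((A : ℝ) / B) ^ i = ((A : ℝ) / B) ^ (i - k) * ((A : ℝ) / B) ^ k := by
    rw [← pow_add, Nat.sub_add_cancel hk'.le]
  have h3 : ((A : ℝ) / B) ^ k * ((A : ℝ) / B)⁻¹ ^ k = 1 := by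
    rw [← mul_pow, mul_inv_cancel₀ (by positivity), one_pow]
  rw [h2]
  linear_combination (-(p.getD i 0 : ℝ) * u k * (B : ℝ) ^ p.length *
    ((A : ℝ) / B) ^ (i - k)) * h3

theorem geomHom_eq (hA : 0 < A) (u : ℕ → ℕ) (N : ℕ) :
    (geomHom u N A B : ℝ) =
      (A : ℝ) ^ N * ∑ k ∈ Finset.range N, (u k : ℝ) * ((A : ℝ) / B)⁻¹ ^ k := by
  rw [geomHom, Finset.mul_sum]
  push_cast
  refine Finset.sum_congr rfl fun k hk => ?_
  rw [pow_mul_pow_sub_eq hA (Finset.mem_range.1 hk).le, inv_div]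
  ring

theorem derivHom_eq (hB : 0 < B) (s : List ℕ) : (B : ℝ) * derivHom s A B =
    (B : ℝ) ^ s.length *
      ∑ i ∈ Finset.range s.length, (s.getD i 0 : ℝ) * (i * ((A : ℝ) / B) ^ (i - 1)) := by
  rw [derivHom, Finset.mul_sum]
  push_cast
  rw [Finset.mul_sum]
  refine Finset.sum_congr rfl fun i hi => ?_
  have hi' := Finset.mem_range.1 hi
  rcases Nat.eq_zero_or_pos i with rfl | h0
  · simp
  have h1 : (B : ℝ) * (B : ℝ) ^ (s.length - i) = (B : ℝ) ^ (s.length - (i - 1)) := by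
    rw [← pow_succ']
    congr 1
    omega
  have h2 := pow_mul_pow_sub_eq (A := A) hB (i := i - 1) (n := s.length) (by omega)
  rw [← h1] at h2
  linear_combination ((s.getD i 0 : ℝ) * i) * h2

end Hom

/-- The conditions under which `x` isolates the growth rate of `u`, where `u` is recurrent of order
at most `K` and submultiplicative up to the factor `C`. -/
def RootCert.Valid (x : RootCert) (u : ℕ → ℕ) (C K : ℕ) : Prop :=
  0 < x.2.2.1.1 ∧
  (∀ n < K, annSum (listPow (intCoeffs x.1) x.2.1) u n = 0) ∧
  derivHom (x.1.map Prod.snd) x.2.2.1.2.1 (x.2.2.1.2.2 + 1) <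
    derivHom (x.1.map Prod.fst) x.2.2.1.1 (x.2.2.1.2.2 + 1) ∧
  0 < x.2.2.2.2 ∧
  C * u x.2.2.2.2 * (x.2.2.1.2.2 + 1) ^ x.2.2.2.2 ≤ x.2.2.1.2.1 ^ x.2.2.2.2 ∧
  evalHom (listPow (intCoeffs x.1) x.2.1) x.2.2.1.1 (x.2.2.1.2.2 + 1) ≠ 0 ∧
  evalHom (listPow (intCoeffs x.1) x.2.1) x.2.2.1.1 (x.2.2.1.2.2 + 1) *
      numHom (listPow (intCoeffs x.1) x.2.1) u x.2.2.1.1 (x.2.2.1.2.2 + 1) *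
        ((x.2.2.1.1 ^ x.2.2.2.1 : ℕ) : ℤ) ≤
    evalHom (listPow (intCoeffs x.1) x.2.1) x.2.2.1.1 (x.2.2.1.2.2 + 1) *
      evalHom (listPow (intCoeffs x.1) x.2.1) x.2.2.1.1 (x.2.2.1.2.2 + 1) *
        ((geomHom u x.2.2.2.1 x.2.2.1.1 (x.2.2.1.2.2 + 1) : ℕ) : ℤ)

/-- The algebraic number isolated by a certificate. -/
def RootCert.toAlgCode (x : RootCert) : AlgCode :=
  (x.1, (x.2.2.1.1, x.2.2.1.2.2), (x.2.2.1.2.1, x.2.2.1.2.2))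

theorem coe_ratOfCode (A B : ℕ) : ((ratOfCode (A, B) : ℚ≥0) : ℝ) = (A : ℝ) / ((B + 1 : ℕ) : ℝ) := by
  simp [ratOfCode]

theorem getD_map_fst_sub_snd (q : List (ℕ × ℕ)) (i : ℕ) :
    (((intCoeffs q).getD i 0 : ℤ) : ℝ) =
      ((q.map Prod.fst).getD i 0 : ℝ) - ((q.map Prod.snd).getD i 0 : ℝ) := by
  by_cases hi : i < q.length
  · simp [intCoeffs, List.getD_eq_getElem?_getD, hi]
  · rw [List.getD_eq_default _ _ (by simpa [intCoeffs] using hi),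
      List.getD_eq_default _ _ (by simpa using hi), List.getD_eq_default _ _ (by simpa using hi)]
    simp

theorem strictMonoOn_aeval_polyOfCode {q : List (ℕ × ℕ)} {A A' B : ℕ} (hB : 0 < B)
    (h : derivHom (q.map Prod.snd) A' B < derivHom (q.map Prod.fst) A B) :
    StrictMonoOn (fun x : ℝ => Polynomial.aeval x (polyOfCode q))
      (Set.Icc ((A : ℝ) / B) ((A' : ℝ) / B)) := by
  have hB' : (0 : ℝ) < B := by exact_mod_cast hB
  have h1 : (B : ℝ) * derivHom (q.map Prod.snd) A' B < B * derivHom (q.map Prod.fst) A B := by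
    gcongr
  rw [derivHom_eq hB, derivHom_eq hB, List.length_map, List.length_map] at h1
  have h2 := lt_of_mul_lt_mul_left h1 (by positivity)
  have h3 := strictMonoOn_of_coeff_bounds (d := q.length)
    (s := fun i => ((q.map Prod.fst).getD i 0 : ℝ)) (t := fun i => ((q.map Prod.snd).getD i 0 : ℝ))
    (fun i => by positivity) (fun i => by positivity) (x₀ := (A : ℝ) / B) (x₁ := (A' : ℝ) / B)
    (by positivity) h2
  refine h3.congr fun x _ => ?_
  dsimp only
  rw [(isCoeffList_intCoeffs q).aeval_eq, intCoeffs, List.length_map, ← intCoeffs]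
  exact Finset.sum_congr rfl fun i _ => by rw [getD_map_fst_sub_snd]

/-- Since `q ^ m` annihilates `u`, the rate `α` is a root of `q`. It is at most `A' / B` because `α
^ n₀ ≤ C * u n₀`, and at least `A / B` by `IsGrowth.le_of_recNum_le`. Uniqueness holds because the
derivative test makes `q` strictly increasing on the interval. -/
theorem RootCert.Valid.describes {x : RootCert} {u : ℕ → ℕ} {C K : ℕ} (hx : x.Valid u C K)
    {α : ℝ} (hα : IsGrowth u α) (hC : ∀ n, α ^ n ≤ C * u n)
    (hK : IsRecurrent K fun n => (u n : ℚ)) : x.toAlgCode.Describes α := by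
  obtain ⟨q, m, ⟨A, A', B'⟩, N, n₀⟩ := x
  obtain ⟨hA, hann, hder, hn₀, hup, hne, hlow⟩ := hx
  dsimp only at hA hann hder hn₀ hup hne hlow
  have hB : 0 < B' + 1 := Nat.succ_pos _
  simp only [RootCert.toAlgCode, AlgCode.Describes, coe_ratOfCode]
  generalize B' + 1 = B at *
  have hmono := strictMonoOn_aeval_polyOfCode hB hder
  have hα0 : 0 < α := lt_of_lt_of_le one_pos hα.one_le
  have hA0 : (0 : ℝ) < A := by exact_mod_cast hA
  have hB0 : (0 : ℝ) < B := by exact_mod_cast hB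
  set p := listPow (intCoeffs q) m with hp
  have hpl : IsCoeffList p (polyOfCode q ^ m) := (isCoeffList_intCoeffs q).pow m
  -- The certificate checks only `n < K`; the annihilated sequence is again recurrent of order at
  -- most `K`, so it vanishes identically.
  have hrecQ : ∀ n, annSum p u n = 0 := by
    have h1 := (hK.sum_shift p.length fun i => (p.getD i 0 : ℚ)).eq_zero fun n hn => by
      have := hann n hn
      rw [annSum] at this
      exact_mod_cast congrArg (fun z : ℤ => (z : ℚ)) this
    intro n
    have h2 := congrFun h1 n
    rw [annSum]
    have h3 : ((∑ i ∈ Finset.range p.length, p.getD i 0 * (u (n + i) : ℤ) : ℤ) : ℚ) = 0 := by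
      push_cast
      exact h2
    exact_mod_cast h3
  have hrec : ∀ n, ∑ i ∈ Finset.range p.length, (p.getD i 0 : ℝ) * (u (n + i) : ℝ) = 0 := by
    intro n
    have := congrArg (fun z : ℤ => (z : ℝ)) (hrecQ n)
    simpa [annSum] using this
  have hpow : Polynomial.aeval α (polyOfCode q) ^ m = 0 := by
    rw [← map_pow, hpl.aeval_eq]
    exact hα.isRoot hC hrec
  have hroot := eq_zero_of_pow_eq_zero hpow
  have hm : m ≠ 0 := by
    rintro rfl
    simp at hpow
  have hupper : α ≤ (A' : ℝ) / B := by
    rw [le_div_iff₀ hB0]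
    refine le_of_pow_le_pow_left₀ hn₀.ne' (by positivity) ?_
    have h1 : (C : ℝ) * u n₀ * B ^ n₀ ≤ (A' : ℝ) ^ n₀ := by exact_mod_cast hup
    calc (α * B) ^ n₀ = α ^ n₀ * B ^ n₀ := mul_pow _ _ _
      _ ≤ C * u n₀ * B ^ n₀ := by
        have := hC n₀
        gcongr
      _ ≤ _ := h1
  have hlower : (A : ℝ) / B ≤ α := by
    have hne' : (evalHom p A B : ℝ) ≠ 0 := by exact_mod_cast hne
    have hlow' : (evalHom p A B : ℝ) * numHom p u A B * (A : ℝ) ^ N ≤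
        evalHom p A B * evalHom p A B * geomHom u N A B := by exact_mod_cast hlow
    rw [evalHom_eq hB] at hne'
    rw [evalHom_eq hB, numHom_eq hA hB, geomHom_eq hA] at hlow'
    refine hα.le_of_recNum_le hrec (by positivity) (right_ne_zero_of_mul hne') (N := N) ?_
    set P := ∑ i ∈ Finset.range p.length, (p.getD i 0 : ℝ) * ((A : ℝ) / B) ^ i
    set W := recNum (fun i => (p.getD i 0 : ℝ)) p.length u ((A : ℝ) / B)
    set F := ∑ k ∈ Finset.range N, (u k : ℝ) * ((A : ℝ) / B)⁻¹ ^ k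
    have h0 : 0 < (B : ℝ) ^ p.length * (B : ℝ) ^ p.length * (A : ℝ) ^ N := by positivity
    refine le_of_mul_le_mul_left ?_ h0
    linarith
  refine ⟨?_, ?_⟩
  · intro h0
    apply hne
    have h1 := evalHom_eq (A := A) hB p
    rw [← hpl.aeval_eq, h0, zero_pow hm, map_zero, mul_zero] at h1
    exact_mod_cast h1
  · ext y
    simp only [Set.mem_ofPred_eq, Set.mem_singleton_iff]
    constructor
    · rintro ⟨h1, h2, h3⟩
      exact hmono.injOn ⟨h1, h2⟩ ⟨hlower, hupper⟩ (h3.trans hroot.symm)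
    · rintro rfl
      exact ⟨hlower, hupper, hroot⟩

/-! ### Existence of certificates -/

section Existence

open Polynomial

variable {u : ℕ → ℕ} {α : ℝ} {C K : ℕ}

theorem IsGrowth.aeval_eq_zero (hα : IsGrowth u α) (hC : ∀ n, α ^ n ≤ C * u n) {p : ℚ[X]}
    (hp : aeval seqShift p (fun n => (u n : ℚ)) = 0) : aeval α p = 0 := by
  have hd : ∀ i, p.natDegree + 1 ≤ i → p.coeff i = 0 := fun i hi =>
    coeff_eq_zero_of_natDegree_lt (by omega)
  have h := hα.isRoot hC (a := fun i => (p.coeff i : ℝ)) (d := p.natDegree + 1) fun n => by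
    have h1 := congrFun hp n
    rw [aeval_seqShift_apply p hd] at h1
    exact_mod_cast congrArg (fun r : ℚ => (r : ℝ)) h1
  rw [aeval_def, eval₂_eq_sum, ← p.sum_range_coeff_eq hd _ (by simp)]
  simpa using h

/-- An annihilating power of an integer polynomial for which the growth rate is a simple root. -/
theorem IsGrowth.exists_simple (hα : IsGrowth u α) (hC : ∀ n, α ^ n ≤ C * u n)
    (hK : IsRecurrent K fun n => (u n : ℚ)) :
    ∃ (q : ℤ[X]) (m : ℕ), aeval α q = 0 ∧ 0 < aeval α (derivative q) ∧
      aeval seqShift ((q ^ m).map (Int.castRingHom ℚ)) (fun n => (u n : ℚ)) = 0 := by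
  classical
  obtain ⟨p, hp0, hp⟩ := hK.exists_annihilator
  -- The radical has the same roots but is separable in characteristic zero, so `α` is a simple root
  -- of it. A power of it is a multiple of the annihilator `p`.
  obtain ⟨m, hm⟩ := UniqueFactorizationMonoid.exists_dvd_radical_self_pow hp0
  set r := UniqueFactorizationMonoid.radical p with hr
  have hrα : aeval α r = 0 := by
    have h1 := hα.aeval_eq_zero hC hp
    obtain ⟨s, hs⟩ := hm
    have h2 : aeval α (r ^ m) = 0 := by rw [hs, map_mul, h1, zero_mul]
    rw [map_pow] at h2
    exact eq_zero_of_pow_eq_zero h2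
  have hsep : r.Separable :=
    PerfectField.separable_iff_squarefree.2 UniqueFactorizationMonoid.squarefree_radical
  have hr' := hsep.aeval_derivative_ne_zero hrα
  obtain ⟨b, hb, hq⟩ := IsLocalization.integerNormalization_spec (nonZeroDivisors ℤ) r
  set q₀ := IsLocalization.integerNormalization (nonZeroDivisors ℤ) r
  have hb0 : (b : ℚ) ≠ 0 := by exact_mod_cast nonZeroDivisors.ne_zero hb
  have hb0' : (b : ℝ) ≠ 0 := by exact_mod_cast nonZeroDivisors.ne_zero hb
  have hq' : q₀.map (Int.castRingHom ℚ) = Polynomial.C (b : ℚ) * r := by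
    rw [← smul_eq_C_mul, Int.cast_smul_eq_zsmul]
    exact hq
  have hmap : ∀ g : ℤ[X], aeval α g = aeval α (g.map (Int.castRingHom ℚ)) := by
    intro g
    exact (aeval_map_algebraMap ℚ α g).symm
  have hann : ∀ e : ℤ, aeval seqShift (((Polynomial.C e * q₀) ^ m).map (Int.castRingHom ℚ))
      (fun n => (u n : ℚ)) = 0 := by
    intro e
    obtain ⟨s, hs⟩ := hm
    rw [Polynomial.map_pow, Polynomial.map_mul, hq', mul_pow, mul_pow, hs]
    rw [show map (Int.castRingHom ℚ) (Polynomial.C e) ^ m * (Polynomial.C (b : ℚ) ^ m * (p * s)) =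
      (map (Int.castRingHom ℚ) (Polynomial.C e) ^ m * Polynomial.C (b : ℚ) ^ m * s) * p by ring]
    rw [map_mul, Module.End.mul_apply, hp, map_zero]
  have hd : aeval α (derivative q₀) ≠ 0 := by
    rw [hmap, ← derivative_map, hq', derivative_C_mul, map_mul, aeval_C]
    exact mul_ne_zero (by simpa using hb0') hr'
  have h0 : aeval α q₀ = 0 := by
    rw [hmap, hq', map_mul, hrα, mul_zero]
  -- Multiplying by `-1` if necessary makes the derivative at `α` positive.
  rcases hd.lt_or_gt with hlt | hgt
  · refine ⟨Polynomial.C (-1) * q₀, m, ?_, ?_, hann _⟩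
    · rw [map_mul, h0, mul_zero]
    · rw [derivative_C_mul, map_mul, aeval_C]
      simpa using hlt
  · refine ⟨Polynomial.C 1 * q₀, m, ?_, ?_, hann _⟩
    · rw [map_mul, h0, mul_zero]
    · simpa using hgt

/-- Fine enough rational intervals around `α`. -/
theorem exists_nat_interval {α : ℝ} (hα : 1 ≤ α) {P : ℝ × ℝ → Prop} (hP : ∀ᶠ x in 𝓝 (α, α), P x) :
    ∃ A A' B' : ℕ, 0 < A ∧ (A : ℝ) / (B' + 1 : ℕ) < α ∧ α < (A' : ℝ) / (B' + 1 : ℕ) ∧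
      P ((A : ℝ) / (B' + 1 : ℕ), (A' : ℝ) / (B' + 1 : ℕ)) := by
  obtain ⟨δ, hδ, hball⟩ := Metric.eventually_nhds_iff.1 hP
  obtain ⟨n, hn⟩ := exists_nat_gt (1 / δ)
  have hn1 : (0 : ℝ) < n := lt_trans (by positivity) hn
  set B : ℝ := ((n + 1 : ℕ) : ℝ) with hB
  have hBn : (n : ℝ) + 1 = B := by simp [hB]
  have hn2 : 1 ≤ n := by exact_mod_cast hn1
  have hn3 : (1 : ℝ) ≤ n := by exact_mod_cast hn2
  have hB2 : 2 ≤ B := by linarith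
  have hB0 : 0 < B := by linarith
  have hBδ : 1 / B < δ := by
    rw [div_lt_iff₀ hB0]
    rw [div_lt_iff₀ hδ] at hn
    nlinarith
  have hαB : 2 ≤ α * B := by nlinarith
  have hc1 : α * B ≤ ⌈α * B⌉₊ := Nat.le_ceil _
  have hc2 : (⌈α * B⌉₊ : ℝ) < α * B + 1 := Nat.ceil_lt_add_one (by positivity)
  have hc3 : 2 ≤ ⌈α * B⌉₊ := by exact_mod_cast hαB.trans hc1
  have hf1 : (⌊α * B⌋₊ : ℝ) ≤ α * B := Nat.floor_le (by positivity)
  have hf2 : α * B < ⌊α * B⌋₊ + 1 := Nat.lt_floor_add_one _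
  have hA : ((⌈α * B⌉₊ - 1 : ℕ) : ℝ) = ⌈α * B⌉₊ - 1 := by
    rw [Nat.cast_sub (by omega)]
    simp
  have h1 : ((⌈α * B⌉₊ - 1 : ℕ) : ℝ) / B < α := by
    rw [div_lt_iff₀ hB0, hA]
    linarith
  have h2 : α < ((⌊α * B⌋₊ + 1 : ℕ) : ℝ) / B := by
    rw [lt_div_iff₀ hB0]
    push_cast
    exact hf2
  have h3 : α - 1 / B ≤ ((⌈α * B⌉₊ - 1 : ℕ) : ℝ) / B := by
    rw [le_div_iff₀ hB0, hA, sub_mul, div_mul_cancel₀ _ hB0.ne']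
    linarith
  have h4 : ((⌊α * B⌋₊ + 1 : ℕ) : ℝ) / B ≤ α + 1 / B := by
    rw [div_le_iff₀ hB0, add_mul, div_mul_cancel₀ _ hB0.ne']
    push_cast
    linarith
  -- These numerators make both inequalities strict even when `α * B` is an integer; `α * B ≥ 2`
  -- keeps the lower one positive.
  refine ⟨⌈α * B⌉₊ - 1, ⌊α * B⌋₊ + 1, n, by omega, h1, h2, hball ?_⟩
  rw [Prod.dist_eq, max_lt_iff, Real.dist_eq, Real.dist_eq, abs_lt, abs_lt]
  dsimp only
  refine ⟨⟨?_, ?_⟩, ?_, ?_⟩ <;> linarith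

/-- The derivative test holds at the degenerate interval `[α, α]`, hence by continuity on small
rational intervals with `α` strictly inside. Strictness makes the two bounds on `α` provable with
large enough indices `n₀` and `N`. -/
theorem exists_valid_rootCert (hα : IsGrowth u α) (hC : ∀ n, α ^ n ≤ C * u n)
    (hK : IsRecurrent K fun n => (u n : ℚ)) : ∃ x : RootCert, x.Valid u C K := by
  obtain ⟨q', m, hq0, hqd, hann⟩ := hα.exists_simple hC hK
  obtain ⟨q, rfl⟩ := exists_polyOfCode q'
  have hα0 : 0 < α := lt_of_lt_of_le one_pos hα.one_le
  have hpl : IsCoeffList (listPow (intCoeffs q) m) (polyOfCode q ^ m) :=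
    (isCoeffList_intCoeffs q).pow m
  have hder : aeval α (derivative (polyOfCode q)) =
      ∑ i ∈ Finset.range q.length, ((q.map Prod.fst).getD i 0 : ℝ) * (i * α ^ (i - 1)) -
        ∑ i ∈ Finset.range q.length, ((q.map Prod.snd).getD i 0 : ℝ) * (i * α ^ (i - 1)) := by
    have h1 : (fun x : ℝ => aeval x (polyOfCode q)) = fun x : ℝ =>
        ∑ i ∈ Finset.range q.length, ((intCoeffs q).getD i 0 : ℝ) * x ^ i := by
      funext x
      rw [(isCoeffList_intCoeffs q).aeval_eq, intCoeffs, List.length_map]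
    have h2 := (polyOfCode q).hasDerivAt_aeval α
    rw [h1] at h2
    have h3 : HasDerivAt (fun x : ℝ => ∑ i ∈ Finset.range q.length,
        ((intCoeffs q).getD i 0 : ℝ) * x ^ i)
        (∑ i ∈ Finset.range q.length, ((intCoeffs q).getD i 0 : ℝ) * (i * α ^ (i - 1))) α :=
      HasDerivAt.fun_sum fun i _ => (hasDerivAt_pow i α).const_mul _
    rw [h2.unique h3, ← Finset.sum_sub_distrib]
    exact Finset.sum_congr rfl fun i _ => by rw [getD_map_fst_sub_snd]; ring
  have hcont : Continuous fun x : ℝ × ℝ =>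
      ∑ i ∈ Finset.range q.length, ((q.map Prod.fst).getD i 0 : ℝ) * (i * x.1 ^ (i - 1)) -
        ∑ i ∈ Finset.range q.length, ((q.map Prod.snd).getD i 0 : ℝ) * (i * x.2 ^ (i - 1)) := by
    fun_prop
  have hev : ∀ᶠ x : ℝ × ℝ in 𝓝 (α, α), 0 <
      ∑ i ∈ Finset.range q.length, ((q.map Prod.fst).getD i 0 : ℝ) * (i * x.1 ^ (i - 1)) -
        ∑ i ∈ Finset.range q.length, ((q.map Prod.snd).getD i 0 : ℝ) * (i * x.2 ^ (i - 1)) :=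
    hcont.continuousAt.eventually_const_lt (by dsimp only; rwa [← hder])
  obtain ⟨A, A', B', hA, hAα, hαA', hpos⟩ := exists_nat_interval hα.one_le hev
  have hA0 : (0 : ℝ) < A := by exact_mod_cast hA
  have hB : 0 < B' + 1 := Nat.succ_pos _
  have hB0 : (0 : ℝ) < (B' + 1 : ℕ) := by exact_mod_cast hB
  have hderlt : derivHom (q.map Prod.snd) A' (B' + 1) < derivHom (q.map Prod.fst) A (B' + 1) := by
    have h1 : ((B' + 1 : ℕ) : ℝ) * derivHom (q.map Prod.snd) A' (B' + 1) <
        ((B' + 1 : ℕ) : ℝ) * derivHom (q.map Prod.fst) A (B' + 1) := by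
      rw [derivHom_eq hB, derivHom_eq hB, List.length_map, List.length_map]
      exact mul_lt_mul_of_pos_left (by linarith) (by positivity)
    exact_mod_cast lt_of_mul_lt_mul_left h1 hB0.le
  -- The polynomial increases strictly to its zero `α`, so it is negative at the left endpoint.
  have hne : evalHom (listPow (intCoeffs q) m) A (B' + 1) ≠ 0 := by
    have hmono := strictMonoOn_aeval_polyOfCode hB hderlt
    have h1 := hmono ⟨le_rfl, (hAα.trans hαA').le⟩ ⟨hAα.le, hαA'.le⟩ hAα
    dsimp only at h1
    rw [hq0] at h1
    intro h2
    have h3 := evalHom_eq (A := A) hB (listPow (intCoeffs q) m)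
    rw [h2, ← hpl.aeval_eq, map_pow, Int.cast_zero, eq_comm] at h3
    have h4 := (mul_eq_zero.1 h3).resolve_left (by positivity)
    exact h1.ne (eq_zero_of_pow_eq_zero h4)
  have hup : ∃ n, 0 < n ∧ C * u n * (B' + 1) ^ n ≤ A' ^ n := by
    have hA'0 : (0 : ℝ) < (A' : ℝ) / (B' + 1 : ℕ) := hα0.trans hαA'
    have hs := hα.summable ((A' : ℝ) / (B' + 1 : ℕ))⁻¹ (by positivity)
      (by rw [inv_mul_lt_one₀ hA'0]; exact hαA')
    have ht := hs.tendsto_atTop_zero.const_mul (C : ℝ)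
    rw [mul_zero] at ht
    obtain ⟨n, hn, hn0⟩ := ((ht.eventually_lt_const one_pos).and
      (Filter.eventually_gt_atTop 0)).exists
    refine ⟨n, hn0, ?_⟩
    have hA'1 : (0 : ℝ) < A' := by
      by_contra h
      have : (A' : ℝ) = 0 := le_antisymm (not_lt.1 h) (by positivity)
      rw [this, zero_div] at hA'0
      exact lt_irrefl _ hA'0
    rw [inv_div, div_pow, ← mul_assoc, ← mul_div_assoc, div_lt_one (by positivity)] at hn
    exact_mod_cast hn.le
  obtain ⟨n₀, hn₀, hup⟩ := hup
  have hlow : ∃ N, evalHom (listPow (intCoeffs q) m) A (B' + 1) *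
      numHom (listPow (intCoeffs q) m) u A (B' + 1) * ((A ^ N : ℕ) : ℤ) ≤
      evalHom (listPow (intCoeffs q) m) A (B' + 1) *
        evalHom (listPow (intCoeffs q) m) A (B' + 1) * ((geomHom u N A (B' + 1) : ℕ) : ℤ) := by
    set e := evalHom (listPow (intCoeffs q) m) A (B' + 1)
    set w := numHom (listPow (intCoeffs q) m) u A (B' + 1)
    have he : (0 : ℝ) < (e : ℝ) * e := by
      have : (e : ℝ) ≠ 0 := by exact_mod_cast hne
      exact mul_self_pos.2 this
    have hC0 : (0 : ℝ) < C := by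
      by_contra h
      have hC' : (C : ℝ) = 0 := le_antisymm (not_lt.1 h) (by positivity)
      have h0 := hC 0
      rw [hC'] at h0
      norm_num at h0
    -- To the left of `α` the partial sums are at least `N / C`, so they eventually exceed any fixed
    -- bound.
    obtain ⟨N, hN⟩ := exists_nat_gt ((e : ℝ) * w / (e * e) * C)
    refine ⟨N, ?_⟩
    have h1 := hα.le_sum hC (x := (A : ℝ) / (B' + 1 : ℕ)) (by positivity) hAα.le N
    have h2 : (e : ℝ) * w / (e * e) ≤ N / C := by
      rw [le_div_iff₀ hC0]
      exact hN.le
    have h3 : (e : ℝ) * w ≤ e * e *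
        ∑ k ∈ Finset.range N, (u k : ℝ) * ((A : ℝ) / (B' + 1 : ℕ))⁻¹ ^ k := by
      rw [mul_comm (_ * _)]
      exact (div_le_iff₀ he).1 (h2.trans h1)
    have h4 : (e : ℝ) * w * (A : ℝ) ^ N ≤ e * e * geomHom u N A (B' + 1) := by
      rw [geomHom_eq hA]
      calc (e : ℝ) * w * (A : ℝ) ^ N ≤ _ * (A : ℝ) ^ N :=
            mul_le_mul_of_nonneg_right h3 (by positivity)
        _ = _ := by ring
    exact_mod_cast h4
  obtain ⟨N, hlow⟩ := hlow
  refine ⟨(q, m, (A, A', B'), N, n₀), hA, fun n _ => ?_, hderlt, hn₀, hup, hne, hlow⟩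
  have h1 := congrFun hann n
  have hc : ∀ i, ((polyOfCode q ^ m).map (Int.castRingHom ℚ)).coeff i =
      (((listPow (intCoeffs q) m).getD i 0 : ℤ) : ℚ) := fun i => by
    rw [coeff_map, hpl i]
    rfl
  rw [aeval_seqShift_apply _ (d := (listPow (intCoeffs q) m).length) fun i hi => by
    rw [hc, List.getD_eq_default _ _ hi, Int.cast_zero]] at h1
  simp only [hc] at h1
  have h2 : ((annSum (listPow (intCoeffs q) m) u n : ℤ) : ℚ) = 0 := by
    rw [annSum]
    push_cast
    exact h1
  exact_mod_cast h2

end Existence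

/-! ### Primitive recursive integer arithmetic -/

namespace Primrec

theorem nat_pow : Primrec₂ ((· ^ ·) : ℕ → ℕ → ℕ) :=
  Primrec₂.unpaired'.1 Nat.Primrec.pow

theorem encode_int_natCast (n : ℕ) : Encodable.encode (n : ℤ) = 2 * n := rfl

theorem encode_int_negSucc (n : ℕ) : Encodable.encode (Int.negSucc n) = 2 * n + 1 := rfl

theorem int_natCast : Primrec (fun n : ℕ => (n : ℤ)) :=
  Primrec.encode_iff.1 (nat_double.of_eq fun n => (encode_int_natCast n).symm)

theorem int_negSucc : Primrec Int.negSucc :=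
  Primrec.encode_iff.1 (nat_double_succ.of_eq fun n => (encode_int_negSucc n).symm)

theorem int_toNat : Primrec Int.toNat := by
  have h : Primrec fun z : ℤ => if Encodable.encode z % 2 = 0 then Encodable.encode z / 2 else 0 :=
    Primrec.ite (Primrec.eq.comp (nat_mod.comp Primrec.encode (const 2)) (const 0))
      (nat_div.comp Primrec.encode (const 2)) (const 0)
  refine h.of_eq fun z => ?_
  rcases z with n | n
  · rw [Int.ofNat_eq_natCast, encode_int_natCast]
    simp
  · rw [encode_int_negSucc, if_neg (by omega)]
    rfl

theorem int_neg_toNat : Primrec fun z : ℤ => (-z).toNat := by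
  have h : Primrec fun z : ℤ =>
      if Encodable.encode z % 2 = 0 then 0 else Encodable.encode z / 2 + 1 :=
    Primrec.ite (Primrec.eq.comp (nat_mod.comp Primrec.encode (const 2)) (const 0))
      (const 0) (succ.comp (nat_div.comp Primrec.encode (const 2)))
  refine h.of_eq fun z => ?_
  rcases z with n | n
  · rw [Int.ofNat_eq_natCast, encode_int_natCast]
    simp
  · rw [encode_int_negSucc, if_neg (by omega)]
    simp
    omega

theorem int_natCast_sub : Primrec₂ fun a b : ℕ => (a : ℤ) - (b : ℤ) := by
  have h : Primrec₂ fun a b : ℕ =>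
      if b ≤ a then ((a - b : ℕ) : ℤ) else Int.negSucc (b - a - 1) :=
    Primrec.ite (nat_le.comp snd fst) (int_natCast.comp (nat_sub.comp fst snd))
      (int_negSucc.comp (nat_sub.comp (nat_sub.comp snd fst) (const 1)))
  refine h.of_eq fun a b => ?_
  split_ifs with hab
  · omega
  · omega

/-- Integer operations reduce to natural ones through positive and negative parts. -/
theorem int_add : Primrec₂ ((· + ·) : ℤ → ℤ → ℤ) := by
  have h : Primrec₂ fun x y : ℤ =>
      ((x.toNat + y.toNat : ℕ) : ℤ) - (((-x).toNat + (-y).toNat : ℕ) : ℤ) :=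
    int_natCast_sub.comp (nat_add.comp (int_toNat.comp fst) (int_toNat.comp snd))
      (nat_add.comp (int_neg_toNat.comp fst) (int_neg_toNat.comp snd))
  exact h.of_eq fun x y => by omega

theorem int_mul : Primrec₂ ((· * ·) : ℤ → ℤ → ℤ) := by
  have h : Primrec₂ fun x y : ℤ =>
      ((x.toNat * y.toNat + (-x).toNat * (-y).toNat : ℕ) : ℤ) -
        ((x.toNat * (-y).toNat + (-x).toNat * y.toNat : ℕ) : ℤ) :=
    int_natCast_sub.comp
      (nat_add.comp (nat_mul.comp (int_toNat.comp fst) (int_toNat.comp snd))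
        (nat_mul.comp (int_neg_toNat.comp fst) (int_neg_toNat.comp snd)))
      (nat_add.comp (nat_mul.comp (int_toNat.comp fst) (int_neg_toNat.comp snd))
        (nat_mul.comp (int_neg_toNat.comp fst) (int_toNat.comp snd)))
  refine h.of_eq fun x y => ?_
  have hx : x = (x.toNat : ℤ) - ((-x).toNat : ℤ) := by omega
  have hy : y = (y.toNat : ℤ) - ((-y).toNat : ℤ) := by omega
  conv_rhs => rw [hx, hy]
  push_cast
  ring

theorem int_le : PrimrecRel ((· ≤ ·) : ℤ → ℤ → Prop) :=
  (nat_le.comp₂ (nat_add.comp (int_toNat.comp fst) (int_neg_toNat.comp snd)).to₂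
    (nat_add.comp (int_toNat.comp snd) (int_neg_toNat.comp fst)).to₂).of_eq fun x y => by omega

variable {α : Type*} [Primcodable α]

theorem sum_range {M : Type*} [AddCommMonoid M] [Primcodable M]
    (hadd : Primrec₂ ((· + ·) : M → M → M)) {g : α → ℕ} {f : α → ℕ → M} (hg : Primrec g)
    (hf : Primrec₂ f) : Primrec fun a => ∑ i ∈ Finset.range (g a), f a i := by
  have h : Primrec fun a => Nat.rec (motive := fun _ => M) 0 (fun i s => s + f a i) (g a) :=
    Primrec.nat_rec' hg (const 0)
      (hadd.comp (snd.comp snd) (hf.comp fst (fst.comp snd))).to₂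
  refine h.of_eq fun a => ?_
  induction g a with
  | zero => simp
  | succ n ih => rw [Finset.sum_range_succ, ← ih]

theorem nat_sum_range {g : α → ℕ} {f : α → ℕ → ℕ} (hg : Primrec g) (hf : Primrec₂ f) :
    Primrec fun a => ∑ i ∈ Finset.range (g a), f a i := sum_range nat_add hg hf

theorem int_sum_range {g : α → ℕ} {f : α → ℕ → ℤ} (hg : Primrec g) (hf : Primrec₂ f) :
    Primrec fun a => ∑ i ∈ Finset.range (g a), f a i := sum_range int_add hg hf

end Primrec

/-! ### Checking a certificate is primitive recursive -/

section CertPrimrec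

open Primrec

variable {α : Type*} [Primcodable α] {p : α → List ℤ} {u : α → ℕ → ℕ} {A B N : α → ℕ}

theorem primrec_intCoeffs : Primrec intCoeffs :=
  list_map .id (int_natCast_sub.comp (fst.comp snd) (snd.comp snd)).to₂

theorem primrec_listMul : Primrec₂ listMul := by
  have h1 : Primrec fun y : ((List ℤ × List ℤ) × ℕ) × ℕ => y.1.1.1.getD y.2 0 :=
    (list_getD (0 : ℤ)).comp (fst.comp (fst.comp fst)) snd
  have h2 : Primrec fun y : ((List ℤ × List ℤ) × ℕ) × ℕ => y.1.1.2.getD (y.1.2 - y.2) 0 :=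
    (list_getD (0 : ℤ)).comp (snd.comp (fst.comp fst)) (nat_sub.comp (snd.comp fst) snd)
  exact list_map (list_range.comp (nat_add.comp (list_length.comp fst) (list_length.comp snd)))
    (int_sum_range (f := fun (y : (List ℤ × List ℤ) × ℕ) i =>
      y.1.1.getD i 0 * y.1.2.getD (y.2 - i) 0) (succ.comp snd) (int_mul.comp h1 h2).to₂).to₂

theorem primrec_listPow : Primrec₂ listPow := by
  have h : Primrec₂ fun (q : List ℤ) (m : ℕ) =>
      Nat.rec (motive := fun _ => List ℤ) [1] (fun _ l => listMul l q) m :=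
    Primrec.nat_rec (const [1]) (primrec_listMul.comp (snd.comp snd) fst).to₂
  refine h.of_eq fun q m => ?_
  induction m with
  | zero => rfl
  | succ m ih => exact congrArg (fun l => listMul l q) ih

theorem primrec_annSum (hp : Primrec p) (hu : Primrec₂ u) (hN : Primrec N) :
    Primrec fun a => annSum (p a) (u a) (N a) :=
  int_sum_range (list_length.comp hp) (int_mul.comp ((list_getD (0 : ℤ)).comp (hp.comp fst) snd)
    (int_natCast.comp (hu.comp fst (nat_add.comp (hN.comp fst) snd)))).to₂

theorem primrec_evalHom (hp : Primrec p) (hA : Primrec A) (hB : Primrec B) :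
    Primrec fun a => evalHom (p a) (A a) (B a) :=
  int_sum_range (list_length.comp hp) (int_mul.comp ((list_getD (0 : ℤ)).comp (hp.comp fst) snd)
    (int_natCast.comp (nat_mul.comp (nat_pow.comp (hA.comp fst) snd)
      (nat_pow.comp (hB.comp fst) (nat_sub.comp (list_length.comp (hp.comp fst)) snd))))).to₂

theorem primrec_numHom (hp : Primrec p) (hu : Primrec₂ u) (hA : Primrec A) (hB : Primrec B) :
    Primrec fun a => numHom (p a) (u a) (A a) (B a) := by
  refine int_sum_range (list_length.comp hp)
    (int_mul.comp ((list_getD (0 : ℤ)).comp (hp.comp fst) snd)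
    (int_natCast.comp (nat_sum_range snd (nat_mul.comp (hu.comp (fst.comp fst) snd)
      (nat_mul.comp (nat_pow.comp (hA.comp (fst.comp fst)) (nat_sub.comp (snd.comp fst) snd))
        (nat_pow.comp (hB.comp (fst.comp fst)) (nat_add.comp (nat_sub.comp
          (list_length.comp (hp.comp (fst.comp fst))) (snd.comp fst)) snd)))).to₂))).to₂

theorem primrec_geomHom (hu : Primrec₂ u) (hN : Primrec N) (hA : Primrec A) (hB : Primrec B) :
    Primrec fun a => geomHom (u a) (N a) (A a) (B a) :=
  nat_sum_range hN (nat_mul.comp (hu.comp fst snd) (nat_mul.comp (nat_pow.comp (hB.comp fst) snd)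
    (nat_pow.comp (hA.comp fst) (nat_sub.comp (hN.comp fst) snd)))).to₂

theorem primrec_derivHom {s : α → List ℕ} (hs : Primrec s) (hA : Primrec A) (hB : Primrec B) :
    Primrec fun a => derivHom (s a) (A a) (B a) :=
  nat_sum_range (list_length.comp hs) (nat_mul.comp ((list_getD 0).comp (hs.comp fst) snd)
    (nat_mul.comp snd (nat_mul.comp (nat_pow.comp (hA.comp fst) (nat_sub.comp snd (const 1)))
      (nat_pow.comp (hB.comp fst) (nat_sub.comp (list_length.comp (hs.comp fst)) snd))))).to₂

theorem PrimrecPred.forall_lt_comp {R : α → ℕ → Prop} {g : α → ℕ} (hR : PrimrecRel R)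
    (hg : Primrec g) : PrimrecPred fun a => ∀ n < g a, R a n :=
  (PrimrecRel.forall_mem_list (R := fun (n : ℕ) (a : α) => R a n) hR.swap).comp
    (list_range.comp hg) Primrec.id |>.of_eq fun a => by simp

theorem primrecPred_valid {x : α → RootCert} (hx : Primrec x) (hu : Primrec₂ u) {C K : α → ℕ}
    (hC : Primrec C) (hK : Primrec K) : PrimrecPred fun a => (x a).Valid (u a) (C a) (K a) := by
  have hq : Primrec fun a => (x a).1 := fst.comp hx
  have h2 : Primrec fun a => (x a).2 := snd.comp hx
  have hm : Primrec fun a => (x a).2.1 := fst.comp h2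
  have h3 : Primrec fun a => (x a).2.2 := snd.comp h2
  have hI : Primrec fun a => (x a).2.2.1 := fst.comp h3
  have hA : Primrec fun a => (x a).2.2.1.1 := fst.comp hI
  have hA' : Primrec fun a => (x a).2.2.1.2.1 := fst.comp (snd.comp hI)
  have hB : Primrec fun a => (x a).2.2.1.2.2 + 1 := succ.comp (snd.comp (snd.comp hI))
  have hN : Primrec fun a => (x a).2.2.2.1 := fst.comp (snd.comp h3)
  have hn : Primrec fun a => (x a).2.2.2.2 := snd.comp (snd.comp h3)
  have hp : Primrec fun a => listPow (intCoeffs (x a).1) (x a).2.1 :=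
    primrec_listPow.comp (primrec_intCoeffs.comp hq) hm
  have he := primrec_evalHom hp hA hB
  have hfst : Primrec fun a => (x a).1.map Prod.fst := list_map hq (fst.comp snd).to₂
  have hsnd : Primrec fun a => (x a).1.map Prod.snd := list_map hq (snd.comp snd).to₂
  refine (nat_lt.comp (const 0) hA).and (PrimrecPred.and ?_ (PrimrecPred.and ?_
    ((nat_lt.comp (const 0) hn).and (PrimrecPred.and ?_ (PrimrecPred.and ?_ ?_)))))
  · refine PrimrecPred.forall_lt_comp
      (R := fun a n => annSum (listPow (intCoeffs (x a).1) (x a).2.1) (u a) n = 0) ?_ hK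
    exact Primrec.eq.comp (primrec_annSum (α := α × ℕ) (u := fun y => u y.1) (hp.comp fst)
      (hu.comp (fst.comp fst) snd).to₂ snd) (const 0)
  · exact nat_lt.comp (primrec_derivHom hsnd hA' hB) (primrec_derivHom hfst hA hB)
  · exact nat_le.comp (nat_mul.comp (nat_mul.comp hC (hu.comp .id hn)) (nat_pow.comp hB hn))
      (nat_pow.comp hA' hn)
  · exact (Primrec.eq.comp he (const 0)).not
  · exact int_le.comp (int_mul.comp (int_mul.comp he (primrec_numHom hp hu hA hB))
      (int_natCast.comp (nat_pow.comp hA hN)))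
      (int_mul.comp (int_mul.comp he he) (int_natCast.comp (primrec_geomHom hu hN hA hB)))

theorem primrec_toAlgCode : Primrec RootCert.toAlgCode := by
  have hI : Primrec fun x : RootCert => x.2.2.1 := fst.comp (snd.comp snd)
  exact Primrec.pair fst (Primrec.pair
    (Primrec.pair (fst.comp hI) (snd.comp (snd.comp hI)))
    (Primrec.pair (fst.comp (snd.comp hI)) (snd.comp (snd.comp hI))))

end CertPrimrec

/-! ### Enumerating the event sets of bounded duration -/

section RunLists

/-- Prepend the transition `t` to a run, given by origin, duration and events. -/
def extendRun (t : ℕ × ℕ × ℕ × ℕ) (x : ℕ × ℕ × List (ℕ × ℕ)) : ℕ × ℕ × List (ℕ × ℕ) :=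
  (t.1, x.2.1 + t.2.1, ((t.2.2.1, 0) :: x.2.2).map fun y => (y.1, y.2 + t.2.1))

/-- Add to `X` the runs of duration at most `n` obtained by prepending a transition. -/
def runStep (Δ : List (ℕ × ℕ × ℕ × ℕ)) (n : ℕ) (X : List (ℕ × ℕ × List (ℕ × ℕ))) :
    List (ℕ × ℕ × List (ℕ × ℕ)) :=
  X ++ Δ.flatMap fun t => X.filterMap fun x =>
    if t.2.2.2 = x.1 ∧ x.2.1 + t.2.1 ≤ n then some (extendRun t x) else none

/-- The empty runs. -/
def runStart (Δ : List (ℕ × ℕ × ℕ × ℕ)) : List (ℕ × ℕ × List (ℕ × ℕ)) :=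
  (0, 0, []) :: Δ.map fun t => (t.2.2.2, 0, [])

/-- The runs of duration at most `n` with at most `j` transitions. -/
def runList (Δ : List (ℕ × ℕ × ℕ × ℕ)) (n j : ℕ) : List (ℕ × ℕ × List (ℕ × ℕ)) :=
  (runStep Δ n)^[j] (runStart Δ)

/-- The number of different sets of elements among the given lists. -/
def distinctCount : List (List (ℕ × ℕ)) → ℕ
  | [] => 0
  | x :: l => if ∃ y ∈ l, (∀ z ∈ y, z ∈ x) ∧ ∀ z ∈ x, z ∈ y then distinctCount l
      else distinctCount l + 1

theorem distinctCount_eq (L : List (List (ℕ × ℕ))) :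
    distinctCount L = (L.map List.toFinset).toFinset.card := by
  induction L with
  | nil => rfl
  | cons x l ih =>
    rw [distinctCount, List.map_cons, List.toFinset_cons]
    have h : (∃ y ∈ l, (∀ z ∈ y, z ∈ x) ∧ ∀ z ∈ x, z ∈ y) ↔
        x.toFinset ∈ (l.map List.toFinset).toFinset := by
      simp only [List.mem_toFinset, List.mem_map]
      refine exists_congr fun y => and_congr_right fun _ => ?_
      rw [Finset.ext_iff]
      simp only [List.mem_toFinset]
      exact ⟨fun h z => ⟨h.1 z, h.2 z⟩, fun h => ⟨fun z => (h z).1, fun z => (h z).2⟩⟩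
    split_ifs with hx
    · rw [Finset.insert_eq_of_mem (h.1 hx), ih]
    · rw [Finset.card_insert_of_notMem fun h' => hx (h.2 h'), ih]

variable {Δ : List (ℕ × ℕ × ℕ × ℕ)} {n : ℕ}

/-- The runs of `runList`, with their sets of events. -/
def runFinset (Δ : List (ℕ × ℕ × ℕ × ℕ)) (n j : ℕ) : Finset (ℕ × ℕ × Finset (ℕ × ℕ)) :=
  ((runList Δ n j).map fun x => (x.1, x.2.1, x.2.2.toFinset)).toFinset

theorem mem_runFinset_zero {y : ℕ × ℕ × Finset (ℕ × ℕ)} :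
    y ∈ runFinset Δ n 0 ↔ (y.1 = 0 ∨ ∃ t ∈ Δ, t.2.2.2 = y.1) ∧ y.2 = (0, ∅) := by
  obtain ⟨q, m, E⟩ := y
  simp only [runFinset, runList, runStart, Function.iterate_zero, id_eq, List.map_cons,
    List.toFinset_nil, List.map_map, List.mem_toFinset, List.mem_cons, Prod.mk.injEq, List.mem_map,
    Function.comp]
  constructor
  · rintro (⟨rfl, rfl, rfl⟩ | ⟨t, ht, rfl, rfl, rfl⟩)
    · simp
    · exact ⟨Or.inr ⟨t, ht, rfl⟩, rfl, rfl⟩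
  · rintro ⟨rfl | ⟨t, ht, rfl⟩, rfl, rfl⟩
    · simp
    · exact Or.inr ⟨t, ht, rfl, rfl, rfl⟩

theorem mem_runFinset_succ {j : ℕ} {y : ℕ × ℕ × Finset (ℕ × ℕ)} :
    y ∈ runFinset Δ n (j + 1) ↔ y ∈ runFinset Δ n j ∨ ∃ t ∈ Δ, ∃ x ∈ runFinset Δ n j,
      t.2.2.2 = x.1 ∧ x.2.1 + t.2.1 ≤ n ∧ (t.1, x.2.1 + t.2.1,
        (insert (t.2.2.1, 0) x.2.2).image fun z => (z.1, z.2 + t.2.1)) = y := by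
  have h1 : runList Δ n (j + 1) = runStep Δ n (runList Δ n j) := Function.iterate_succ_apply' _ _ _
  rw [runFinset, h1, runStep, List.map_append, List.toFinset_append, Finset.mem_union]
  refine or_congr Iff.rfl ?_
  simp only [runFinset, List.mem_toFinset, List.mem_map, List.mem_flatMap, List.mem_filterMap]
  constructor
  · rintro ⟨_, ⟨t, ht, x, hx, hxt⟩, rfl⟩
    split_ifs at hxt with hc
    · simp only [Option.some.injEq] at hxt
      subst hxt
      refine ⟨t, ht, _, ⟨x, hx, rfl⟩, hc.1, hc.2, ?_⟩
      simp only [extendRun, Prod.mk.injEq, true_and]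
      ext z
      simp
  · rintro ⟨t, ht, _, ⟨x, hx, rfl⟩, h2, h3, rfl⟩
    refine ⟨extendRun t x, ⟨t, ht, x, hx, by rw [if_pos ⟨h2, h3⟩]⟩, ?_⟩
    simp only [extendRun, Prod.mk.injEq, true_and]
    ext z
    simp

theorem coe_image_insert (k a : ℕ) (E : Finset (ℕ × ℕ)) :
    (((insert (a, 0) E).image fun z => (z.1, z.2 + k) : Finset (ℕ × ℕ)) : Set (ℕ × ℕ)) =
      shiftBy k (insert (a, 0) (E : Set (ℕ × ℕ))) := by
  rw [Finset.coe_image, Finset.coe_insert, shiftBy]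

theorem eventRun_of_mem_runFinset {j : ℕ} : ∀ {y : ℕ × ℕ × Finset (ℕ × ℕ)},
    y ∈ runFinset Δ n j → y.2.1 ≤ n ∧ EventRun {t | t ∈ Δ} y.1 y.2.1 (y.2.2 : Set (ℕ × ℕ)) := by
  induction j with
  | zero =>
    rintro ⟨q, m, E⟩ hy
    obtain ⟨-, h⟩ := mem_runFinset_zero.1 hy
    simp only [Prod.mk.injEq] at h
    obtain ⟨rfl, rfl⟩ := h
    simpa using EventRun.nil q
  | succ j ih =>
    intro y hy
    rcases mem_runFinset_succ.1 hy with hy | ⟨t, ht, x, hx, h1, h2, rfl⟩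
    · exact ih hy
    · refine ⟨h2, ?_⟩
      dsimp only
      rw [coe_image_insert]
      refine EventRun.cons (q' := x.1) ?_ (ih hx).2
      rw [← h1]
      exact ht

theorem runFinset_mono : Monotone (runFinset Δ n) :=
  monotone_nat_of_le_succ fun _ _ hy => mem_runFinset_succ.2 (Or.inl hy)

/-- Empty runs are listed only at state `0` and at destinations of transitions, whence the
disjunction. Destinations suffice for prepending transitions, and state `0` ensures that `∅` is
counted even without transitions. -/
theorem exists_mem_runFinset {q m : ℕ} {E : Set (ℕ × ℕ)} (h : EventRun {t | t ∈ Δ} q m E) :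
    m ≤ n → (q = 0 ∨ (∃ t ∈ Δ, t.2.2.2 = q) ∨ E ≠ ∅) →
      ∃ j, ∃ y ∈ runFinset Δ n j, y.1 = q ∧ y.2.1 = m ∧ (y.2.2 : Set (ℕ × ℕ)) = E := by
  induction h with
  | nil q =>
    intro _ h
    refine ⟨0, (q, 0, ∅), mem_runFinset_zero.2 ⟨?_, rfl⟩, rfl, rfl, by simp⟩
    tauto
  | @cons q k a q' m E ht hE ih =>
    intro hm _
    obtain ⟨j, y, hy, rfl, rfl, rfl⟩ := ih (by omega) (Or.inr (Or.inl ⟨_, ht, rfl⟩))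
    exact ⟨j + 1, _, mem_runFinset_succ.2 (Or.inr ⟨_, ht, y, hy, rfl, hm, rfl⟩), rfl, rfl,
      coe_image_insert _ _ _⟩

/-- All entries of the transitions are in range. -/
def TransBound (Δ : List (ℕ × ℕ × ℕ × ℕ)) (s a : ℕ) : Prop :=
  0 < s ∧ ∀ t ∈ Δ, t.1 < s ∧ t.2.2.1 < a ∧ t.2.2.2 < s

theorem runFinset_subset {s a : ℕ} (h : TransBound Δ s a) (j : ℕ) :
    runFinset Δ n j ⊆ Finset.range s ×ˢ Finset.range (n + 1) ×ˢ
      (Finset.range a ×ˢ Finset.range (n + 1)).powerset := by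
  intro y hy
  have hrun := eventRun_of_mem_runFinset hy
  suffices hs : y.1 < s ∧ ∀ z ∈ y.2.2, z.1 < a by
    simp only [Finset.mem_product, Finset.mem_range, Finset.mem_powerset]
    refine ⟨hs.1, by omega, fun z hz => ?_⟩
    have h1 := hrun.2.le_of_mem z hz
    simp only [Finset.mem_product, Finset.mem_range]
    exact ⟨hs.2 z hz, by omega⟩
  clear hrun
  induction j generalizing y with
  | zero =>
    obtain ⟨h1, h2⟩ := mem_runFinset_zero.1 hy
    rw [h2]
    refine ⟨?_, by simp⟩
    rcases h1 with h1 | ⟨t, ht, h1⟩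
    · rw [h1]
      exact h.1
    · rw [← h1]
      exact (h.2 t ht).2.2
  | succ j ih =>
    rcases mem_runFinset_succ.1 hy with hy | ⟨t, ht, x, hx, h1, h2, rfl⟩
    · exact ih hy
    · refine ⟨(h.2 t ht).1, fun z hz => ?_⟩
      obtain ⟨w, hw, rfl⟩ := Finset.mem_image.1 hz
      rcases Finset.mem_insert.1 hw with rfl | hw
      · exact (h.2 t ht).2.1
      · exact (ih hx).2 w hw

/-- A number of transitions after which all event sets have been found. -/
def runBound (s a n : ℕ) : ℕ := s * ((n + 1) * 2 ^ (a * (n + 1)))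

/-- An increasing chain of subsets of a set with `runBound s a n` elements, each determined by its
predecessor, is stationary after at most that many steps. Instantaneous cycles make runs arbitrarily
long, so their number of transitions gives no bound. -/
theorem runFinset_subset_runBound {s a : ℕ} (h : TransBound Δ s a) (j : ℕ) :
    runFinset Δ n j ⊆ runFinset Δ n (runBound s a n) := by
  have hstab : ∀ m, runFinset Δ n m = runFinset Δ n (m + 1) →
      runFinset Δ n (m + 1) = runFinset Δ n (m + 2) := by
    intro m hm
    ext y
    rw [mem_runFinset_succ (j := m), mem_runFinset_succ (j := m + 1), hm]
  have hcard : ∀ m, (runFinset Δ n m).card ≤ runBound s a n := by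
    intro m
    refine (Finset.card_le_card (runFinset_subset h m)).trans ?_
    simp [Finset.card_product, runBound]
  rcases le_total j (runBound s a n) with hj | hj
  · exact runFinset_mono hj
  · have h1 := Nat.stabilises_of_monotone (f := fun m => (runFinset Δ n m).card)
      (fun a b hab => Finset.card_le_card (runFinset_mono hab)) hcard (fun m hm => by
        rw [← hstab m (Finset.eq_of_subset_of_card_le (runFinset_mono (Nat.le_succ m)) hm.ge),
          ← hm]) hj
    exact (Finset.eq_of_subset_of_card_le (runFinset_mono hj) h1.le).ge

theorem distinctCount_runList {s a : ℕ} (h : TransBound Δ s a) :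
    distinctCount ((runList Δ n (runBound s a n)).map fun x => x.2.2) =
      (eventSets {t | t ∈ Δ} n).ncard := by
  have h1 : ((runList Δ n (runBound s a n)).map fun x => x.2.2).map List.toFinset =
      (((runList Δ n (runBound s a n)).map fun x => (x.1, x.2.1, x.2.2.toFinset)).map
        fun y => y.2.2) := by
    simp [List.map_map, Function.comp_def]
  have h2 : eventSets {t | t ∈ Δ} n = (fun E : Finset (ℕ × ℕ) => (E : Set (ℕ × ℕ))) ''
      ((((runList Δ n (runBound s a n)).map fun x => (x.1, x.2.1, x.2.2.toFinset)).map
        fun y => y.2.2).toFinset : Set (Finset (ℕ × ℕ))) := by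
    ext E
    simp only [Set.mem_image, Finset.mem_coe, List.mem_toFinset]
    simp only [List.mem_map (f := fun y : ℕ × ℕ × Finset (ℕ × ℕ) => y.2.2)]
    have hmem : ∀ y, y ∈ (runList Δ n (runBound s a n)).map
        (fun x => (x.1, x.2.1, x.2.2.toFinset)) ↔ y ∈ runFinset Δ n (runBound s a n) :=
      fun y => List.mem_toFinset.symm
    simp only [hmem]
    constructor
    · rintro ⟨q, m, hm, hE⟩
      suffices hq : ∃ j, ∃ y ∈ runFinset Δ n j, (y.2.2 : Set (ℕ × ℕ)) = E by
        obtain ⟨j, y, hy, rfl⟩ := hq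
        exact ⟨y.2.2, ⟨y, runFinset_subset_runBound h j hy, rfl⟩, rfl⟩
      rcases eq_or_ne E ∅ with rfl | hne
      · exact ⟨0, (0, 0, ∅), mem_runFinset_zero.2 ⟨Or.inl rfl, rfl⟩, by simp⟩
      · obtain ⟨j, y, hy, -, -, hyE⟩ := exists_mem_runFinset hE hm (Or.inr (Or.inr hne))
        exact ⟨j, y, hy, hyE⟩
    · rintro ⟨_, ⟨y, hy, rfl⟩, rfl⟩
      obtain ⟨h1, h2⟩ := eventRun_of_mem_runFinset hy
      exact ⟨y.1, y.2.1, h1, h2⟩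
  rw [distinctCount_eq, h1, h2, Set.ncard_image_of_injective _ Finset.coe_injective,
    Set.ncard_coe_finset]

end RunLists

/-! ### The enumeration is primitive recursive -/

section RunPrimrec

open Primrec

theorem primrec_extendRun : Primrec₂ extendRun := by
  have ht : Primrec fun y : (ℕ × ℕ × ℕ × ℕ) × (ℕ × ℕ × List (ℕ × ℕ)) => y.1.2.1 :=
    fst.comp (snd.comp fst)
  refine Primrec.pair (fst.comp fst) (Primrec.pair
    (nat_add.comp (fst.comp (snd.comp snd)) ht) ?_)
  refine list_map (list_cons.comp (Primrec.pair
    (fst.comp (snd.comp (snd.comp fst))) (const 0)) (snd.comp (snd.comp snd))) ?_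
  exact (Primrec.pair (fst.comp snd) (nat_add.comp (snd.comp snd) (ht.comp fst))).to₂

theorem primrec_runStep : Primrec fun y : (List (ℕ × ℕ × ℕ × ℕ) × ℕ) ×
    List (ℕ × ℕ × List (ℕ × ℕ)) => runStep y.1.1 y.1.2 y.2 := by
  refine list_append.comp snd (list_flatMap (fst.comp fst) ?_)
  refine listFilterMap (snd.comp fst) ?_
  refine Primrec.ite (PrimrecPred.and ?_ ?_) ?_ (const none)
  · exact Primrec.eq.comp (snd.comp (snd.comp (snd.comp (snd.comp fst)))) (fst.comp snd)
  · exact nat_le.comp (nat_add.comp (fst.comp (snd.comp snd))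
      (fst.comp (snd.comp (snd.comp fst)))) (snd.comp (fst.comp (fst.comp fst)))
  · exact option_some.comp (primrec_extendRun.comp (snd.comp fst) snd)

theorem primrec_runStart : Primrec runStart :=
  list_cons.comp (const (0, 0, [])) (list_map .id
    (Primrec.pair (snd.comp (snd.comp (snd.comp snd))) (const (0, []))).to₂)

theorem primrec_distinctCount : Primrec distinctCount := by
  have hsub : PrimrecRel fun x y : List (ℕ × ℕ) => ∀ z ∈ x, z ∈ y := by
    have hmem : PrimrecRel fun (z : ℕ × ℕ) (y : List (ℕ × ℕ)) => z ∈ y :=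
      (PrimrecRel.exists_mem_list (R := fun a b : ℕ × ℕ => a = b) Primrec.eq).swap.of_eq
        fun a b => by simp
    exact hmem.forall_mem_list
  have hR : PrimrecRel fun (y x : List (ℕ × ℕ)) => (∀ z ∈ y, z ∈ x) ∧ ∀ z ∈ x, z ∈ y :=
    PrimrecPred.and hsub hsub.swap
  have hex := hR.exists_mem_list
  have h : Primrec fun L : List (List (ℕ × ℕ)) =>
      List.rec (motive := fun _ => ℕ) 0 (fun x l c =>
        if ∃ y ∈ l, (∀ z ∈ y, z ∈ x) ∧ ∀ z ∈ x, z ∈ y then c else c + 1) L := by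
    refine list_rec .id (const 0) (h := fun _ y => if ∃ z ∈ y.2.1, (∀ w ∈ z, w ∈ y.1) ∧
      ∀ w ∈ y.1, w ∈ z then y.2.2 else y.2.2 + 1) ?_
    refine Primrec.ite (hex.comp (fst.comp (snd.comp snd)) (fst.comp snd)) ?_ ?_
    · exact snd.comp (snd.comp snd)
    · exact succ.comp (snd.comp (snd.comp snd))
  refine h.of_eq fun L => ?_
  induction L with
  | nil => rfl
  | cons x l ih =>
    rw [distinctCount, ← ih]

end RunPrimrec

/-! ### Counting event sets from the code of a graph -/

section Codes

open Primrec

/-- A common denominator of the delays. -/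
def codeDenom (c : STGCode) : ℕ := c.2.2.foldr (fun x d => (x.2.1.2 + 1) * d) 1

/-- The transitions with delays in ticks. -/
def codeTrans (c : STGCode) : List (ℕ × ℕ × ℕ × ℕ) :=
  c.2.2.map fun x => (x.1, x.2.1.1 * (codeDenom c / (x.2.1.2 + 1)), x.2.2.1, x.2.2.2)

/-- The code has a state, and all its entries are in range. -/
def CodeValid (c : STGCode) : Prop :=
  0 < c.1 ∧ ∀ x ∈ c.2.2, x.1 < c.1 ∧ x.2.2.1 < c.2.1 ∧ x.2.2.2 < c.1

/-- The number of event sets up to date `n`. -/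
def codeCount (c : STGCode) (n : ℕ) : ℕ :=
  distinctCount ((runList (codeTrans c) (codeDenom c * n)
    (runBound c.1 c.2.1 (codeDenom c * n))).map fun x => x.2.2)

/-- A bound for the delays, in ticks. -/
def codeMaxTick (c : STGCode) : ℕ := (codeTrans c).foldr (fun t s => t.2.1 + s) 0

/-- A bound for the order of the recurrence satisfied by `codeCount`. -/
def codeOrder (c : STGCode) : ℕ := 1 + 2 ^ c.1 * codeMaxTick c

theorem primrec_codeDenom : Primrec codeDenom := by
  have h : Primrec₂ fun (_ : STGCode) (y : (ℕ × (ℕ × ℕ) × ℕ × ℕ) × ℕ) =>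
      (y.1.2.1.2 + 1) * y.2 :=
    nat_mul.comp (succ.comp (snd.comp (fst.comp (snd.comp (fst.comp snd))))) (snd.comp snd)
  exact list_foldr (snd.comp snd) (const 1) h

theorem primrec_codeTrans : Primrec codeTrans := by
  have h : Primrec₂ fun (c : STGCode) (x : ℕ × (ℕ × ℕ) × ℕ × ℕ) =>
      (x.1, x.2.1.1 * (codeDenom c / (x.2.1.2 + 1)), x.2.2.1, x.2.2.2) := by
    have h1 : Primrec fun y : STGCode × (ℕ × (ℕ × ℕ) × ℕ × ℕ) => y.2.2.1 :=
      fst.comp (snd.comp snd)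
    exact Primrec.pair (fst.comp snd) (Primrec.pair (nat_mul.comp (fst.comp h1) (nat_div.comp
      (primrec_codeDenom.comp fst) (succ.comp (snd.comp h1)))) (snd.comp (snd.comp snd)))
  exact list_map (snd.comp snd) h

theorem primrec_codeCount : Primrec₂ codeCount := by
  have hn : Primrec fun y : STGCode × ℕ => codeDenom y.1 * y.2 :=
    nat_mul.comp (primrec_codeDenom.comp fst) snd
  have hb : Primrec fun y : STGCode × ℕ => runBound y.1.1 y.1.2.1 (codeDenom y.1 * y.2) :=
    nat_mul.comp (fst.comp fst) (nat_mul.comp (succ.comp hn) (nat_pow.comp (const 2)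
      (nat_mul.comp (fst.comp (snd.comp fst)) (succ.comp hn))))
  have ht : Primrec fun y : STGCode × ℕ => codeTrans y.1 := primrec_codeTrans.comp fst
  have hrun : Primrec fun y : STGCode × ℕ => runList (codeTrans y.1) (codeDenom y.1 * y.2)
      (runBound y.1.1 y.1.2.1 (codeDenom y.1 * y.2)) :=
    nat_iterate hb (primrec_runStart.comp ht)
      (primrec_runStep.comp (Primrec.pair (Primrec.pair (ht.comp fst) (hn.comp fst)) snd)).to₂
  exact primrec_distinctCount.comp (list_map hrun (snd.comp (snd.comp snd)).to₂)

theorem primrec_codeOrder : Primrec codeOrder :=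
  nat_add.comp (const 1) (nat_mul.comp (nat_pow.comp (const 2) fst)
    (list_foldr primrec_codeTrans (const 0)
      (nat_add.comp (fst.comp (snd.comp (fst.comp snd))) (snd.comp snd)).to₂))

theorem primrecPred_codeValid : PrimrecPred CodeValid := by
  have h : PrimrecRel fun (x : ℕ × (ℕ × ℕ) × ℕ × ℕ) (c : STGCode) =>
      x.1 < c.1 ∧ x.2.2.1 < c.2.1 ∧ x.2.2.2 < c.1 := by
    refine PrimrecPred.and ?_ (PrimrecPred.and ?_ ?_)
    · exact nat_lt.comp (fst.comp fst) (fst.comp snd)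
    · exact nat_lt.comp (fst.comp (snd.comp (snd.comp fst))) (fst.comp (snd.comp snd))
    · exact nat_lt.comp (snd.comp (snd.comp (snd.comp fst))) (fst.comp snd)
  exact (nat_lt.comp (const 0) fst).and (h.forall_mem_list.comp (snd.comp snd) .id)

end Codes

/-! ### Invariance under renaming of states and letters -/

section Relabel

variable {Q Q' A A' : Type*} {f : Q → Q'} {g : A → A'} {Δ : Set (Q × ℕ × A × Q)}

/-- Rename the states and the letter of a transition. -/
def relabel (f : Q → Q') (g : A → A') (t : Q × ℕ × A × Q) : Q' × ℕ × A' × Q' :=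
  (f t.1, t.2.1, g t.2.2.1, f t.2.2.2)

theorem image_shiftBy_insert (g : A → A') (k : ℕ) (a : A) (E : Set (A × ℕ)) :
    Prod.map g id '' shiftBy k (insert (a, 0) E) =
      shiftBy k (insert (g a, 0) (Prod.map g id '' E)) := by
  have h : insert (g a, 0) (Prod.map g id '' E) = Prod.map g id '' insert (a, 0) E :=
    (Set.image_insert_eq (f := Prod.map g id) (a := (a, 0))).symm
  rw [h, shiftBy, shiftBy, Set.image_image, Set.image_image]
  rfl

theorem EventRun.relabel {q : Q} {n : ℕ} {E : Set (A × ℕ)} (h : EventRun Δ q n E) :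
    EventRun (relabel f g '' Δ) (f q) n (Prod.map g id '' E) := by
  induction h with
  | nil q =>
    rw [Set.image_empty]
    exact .nil _
  | cons ht _ ih =>
    rw [image_shiftBy_insert]
    exact .cons ⟨_, ht, rfl⟩ ih

theorem EventRun.exists_of_relabel (hf : f.Injective) {q' : Q'} {n : ℕ} {E' : Set (A' × ℕ)}
    (h : EventRun (_root_.relabel f g '' Δ) q' n E') :
    ∀ q, f q = q' → ∃ E, EventRun Δ q n E ∧ Prod.map g id '' E = E' := by
  induction h with
  | nil q' => exact fun q _ => ⟨∅, .nil q, Set.image_empty _⟩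
  | cons ht _ ih =>
    rintro q rfl
    obtain ⟨⟨p, k, a, p'⟩, ht, he⟩ := ht
    simp only [_root_.relabel, Prod.mk.injEq] at he
    obtain ⟨h1, rfl, rfl, h2⟩ := he
    obtain rfl := hf h1
    obtain ⟨E, hE, rfl⟩ := ih p' h2
    exact ⟨_, .cons ht hE, image_shiftBy_insert _ _ _ _⟩

theorem eventSets_relabel [Nonempty Q] (hf : f.Injective) (n : ℕ) :
    eventSets (relabel f g '' Δ) n = (fun E => Prod.map g id '' E) '' eventSets Δ n := by
  ext E'
  constructor
  · rintro ⟨q', m, hm, h⟩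
    -- A state outside the range of `f` has no outgoing transition and carries only the empty run.
    have hq : E' = ∅ ∨ ∃ q, f q = q' := by
      cases h with
      | nil => exact Or.inl rfl
      | cons ht _ =>
        obtain ⟨t, -, he⟩ := ht
        exact Or.inr ⟨t.1, congrArg Prod.fst he⟩
    rcases hq with rfl | ⟨q, rfl⟩
    · exact ⟨∅, ⟨Classical.arbitrary Q, 0, n.zero_le, .nil _⟩, Set.image_empty _⟩
    · obtain ⟨E, hE, rfl⟩ := h.exists_of_relabel hf q rfl
      exact ⟨E, ⟨q, m, hm, hE⟩, rfl⟩
  · rintro ⟨E, ⟨q, m, hm, hE⟩, rfl⟩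
    exact ⟨f q, m, hm, hE.relabel⟩

theorem ncard_eventSets_relabel [Nonempty Q] (hf : f.Injective) (hg : g.Injective) (n : ℕ) :
    (eventSets (relabel f g '' Δ) n).ncard = (eventSets Δ n).ncard := by
  rw [eventSets_relabel hf]
  exact Set.ncard_image_of_injective _ (hg.prodMap Function.injective_id).image_injective

end Relabel

/-! ### Codes compute the event counts of the graphs they describe -/

section CodeCorrect

theorem codeDenom_pos (c : STGCode) : 0 < codeDenom c := by
  rw [codeDenom]
  induction c.2.2 with
  | nil => simp
  | cons x l ih => exact Nat.mul_pos (Nat.succ_pos _) ih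

theorem dvd_codeDenom {c : STGCode} {x : ℕ × (ℕ × ℕ) × ℕ × ℕ} (hx : x ∈ c.2.2) :
    x.2.1.2 + 1 ∣ codeDenom c := by
  rw [codeDenom]
  revert hx
  induction c.2.2 with
  | nil => simp
  | cons y l ih =>
    intro hx
    rcases List.mem_cons.1 hx with rfl | hx
    · exact Dvd.intro _ rfl
    · exact (ih hx).mul_left _

theorem natCast_ratOfCode_mul {p : ℕ × ℕ} {D : ℕ} (h : p.2 + 1 ∣ D) :
    ((p.1 * (D / (p.2 + 1)) : ℕ) : ℚ≥0) = ratOfCode p * D := by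
  obtain ⟨m, rfl⟩ := h
  have h0 : (p.2 : ℚ≥0) + 1 ≠ 0 := by positivity
  rw [Nat.mul_div_cancel_left _ (Nat.succ_pos _), ratOfCode]
  push_cast
  field_simp

theorem le_codeMaxTick {c : STGCode} {t : ℕ × ℕ × ℕ × ℕ} (ht : t ∈ codeTrans c) :
    t.2.1 ≤ codeMaxTick c := by
  rw [codeMaxTick]
  revert ht
  induction codeTrans c with
  | nil => simp
  | cons y l ih =>
    intro ht
    rw [List.foldr_cons]
    rcases List.mem_cons.1 ht with rfl | ht
    · exact Nat.le_add_right _ _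
    · exact (ih ht).trans (Nat.le_add_left _ _)

variable {Q A : Type*} {G : STG Q A} {c : STGCode}

theorem STGCode.Describes.codeValid [Nonempty Q] (h : c.Describes G) : CodeValid c := by
  obtain ⟨eQ, eA, -, h2⟩ := h
  refine ⟨(eQ (Classical.arbitrary Q)).pos, fun x hx => ?_⟩
  obtain ⟨t, -, h3, -, h4, h5⟩ := h2 x hx
  rw [h3, h4, h5]
  exact ⟨(eQ _).2, (eA _).2, (eQ _).2⟩

theorem STGCode.Describes.isDenom (h : c.Describes G) : G.IsDenom (codeDenom c) := by
  obtain ⟨eQ, eA, h1, -⟩ := h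
  refine ⟨codeDenom_pos c, fun t ht => ?_⟩
  obtain ⟨x, hx, -, h2, -⟩ := h1 t ht
  exact ⟨_, (natCast_ratOfCode_mul (dvd_codeDenom hx)).trans (by rw [h2])⟩

theorem STGCode.Describes.exists_relabel (h : c.Describes G) :
    ∃ (f : Q → ℕ) (g : A → ℕ), f.Injective ∧ g.Injective ∧
      {t | t ∈ codeTrans c} = relabel f g '' G.ticks (codeDenom c) := by
  obtain ⟨eQ, eA, h1, h2⟩ := h
  refine ⟨fun q => eQ q, fun a => eA a, Fin.val_injective.comp eQ.injective,
    Fin.val_injective.comp eA.injective, ?_⟩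
  ext ⟨q, k, a, q'⟩
  simp only [codeTrans, Set.mem_ofPred_eq, List.mem_map, Set.mem_image]
  constructor
  · rintro ⟨x, hx, he⟩
    obtain ⟨⟨p, d, b, p'⟩, ht, e1, e2, e3, e4⟩ := h2 x hx
    refine ⟨(p, k, b, p'), ⟨d, ht, ?_⟩, ?_⟩
    · simp only [Prod.mk.injEq] at he
      rw [← he.2.1, natCast_ratOfCode_mul (dvd_codeDenom hx), e2]
    · rw [← he]
      simp only [Prod.mk.injEq] at he
      simp only [relabel, ← e1, ← e3, ← e4, he.2.1]
  · rintro ⟨⟨p, k', b, p'⟩, ⟨d, hd, hk⟩, he⟩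
    obtain ⟨x, hx, e1, e2, e3, e4⟩ := h1 _ hd
    refine ⟨x, hx, ?_⟩
    rw [← he]
    dsimp only at e1 e2 e3 e4 hk
    simp only [relabel, Prod.mk.injEq, e1, e3, e4, true_and, and_true]
    have h3 := (natCast_ratOfCode_mul (dvd_codeDenom hx)).trans (by rw [e2, ← hk])
    exact_mod_cast h3

theorem codeTrans_transBound (h : CodeValid c) : TransBound (codeTrans c) c.1 c.2.1 := by
  refine ⟨h.1, fun t ht => ?_⟩
  obtain ⟨x, hx, rfl⟩ := List.mem_map.1 ht
  exact h.2 x hx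

theorem STGCode.Describes.codeCount_eq [Nonempty Q] (h : c.Describes G) (n : ℕ) :
    codeCount c n = (eventSets (G.ticks (codeDenom c)) (codeDenom c * n)).ncard := by
  obtain ⟨f, g, hf, hg, he⟩ := h.exists_relabel
  rw [codeCount, distinctCount_runList (codeTrans_transBound h.codeValid), he,
    ncard_eventSets_relabel hf hg]

theorem STGCode.Describes.ncard_ticks_le (h : c.Describes G) :
    (G.ticks (codeDenom c)).ncard ≤ c.2.2.length := by
  obtain ⟨f, g, hf, hg, he⟩ := h.exists_relabel
  have hinj : (relabel f g).Injective := by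
    rintro ⟨q, k, a, q'⟩ ⟨r, l, b, r'⟩ h
    simp only [relabel, Prod.mk.injEq] at h
    rw [hf h.1, h.2.1, hg h.2.2.1, hf h.2.2.2]
  rw [← Set.ncard_image_of_injective _ hinj, ← he]
  have h1 : {t | t ∈ codeTrans c} = ((codeTrans c).toFinset : Set _) := by
    ext t
    simp
  rw [h1, Set.ncard_coe_finset]
  exact (List.toFinset_card_le _).trans (List.length_map _).le

theorem STGCode.Describes.isRecurrent [Fintype Q] [Fintype A] [Nonempty Q]
    (h : c.Describes G) : IsRecurrent (codeOrder c) fun n => (codeCount c n : ℚ) := by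
  obtain ⟨f, g, hf, hg, he⟩ := h.exists_relabel
  have hcard : Fintype.card Q = c.1 := by
    obtain ⟨eQ, -⟩ := h
    rw [Fintype.card_congr eQ, Fintype.card_fin]
  have h1 : ∀ t ∈ G.trans, tickCount (codeDenom c) t.2.1 ≤ codeMaxTick c := by
    intro t ht
    obtain ⟨k, hk⟩ := h.isDenom.2 t ht
    have hmem : relabel f g (t.1, k, t.2.2.1, t.2.2.2) ∈ {t | t ∈ codeTrans c} := by
      rw [he]
      exact ⟨_, ⟨t.2.1, ht, hk⟩, rfl⟩
    have h2 := le_codeMaxTick hmem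
    rw [tickCount, ← hk, Nat.floor_natCast]
    exact h2
  have h2 := (STG.isRecurrent_ncard_eventSets h.isDenom h1).comp_mul (codeDenom c)
  rw [hcard] at h2
  simpa only [h.codeCount_eq, codeOrder] using h2

theorem STGCode.Describes.exists_isGrowth [Fintype A] [Nonempty Q] (h : c.Describes G) :
    ∃ α : ℝ, IsGrowth (codeCount c) α ∧
      ∀ n, α ^ n ≤ (1 + c.2.2.length : ℕ) * codeCount c n := by
  refine _root_.exists_isGrowth (fun n => ?_) fun n m => ?_
  · rw [h.codeCount_eq]
    exact ncard_eventSets_pos _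
  · simp only [h.codeCount_eq, mul_add]
    refine (ncard_eventSets_add_le (G.finite_ticks _) _ _).trans ?_
    gcongr
    exact h.ncard_ticks_le

end CodeCorrect

/-! ### Computable search for a certificate -/

section Search

/-- A total relation that is primitive recursive has a computable choice function. -/
theorem exists_computable_choice {α β : Type*} [Primcodable α] [Primcodable β] {R : α → β → Prop}
    (hR : PrimrecRel R) (h : ∀ a, ∃ b, R a b) : ∃ F : α → β, Computable F ∧ ∀ a, R a (F a) := by
  classical
  let f : α → ℕ → Option β := fun a n =>
    (Encodable.decode (α := β) n).bind fun b => if R a b then some b else none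
  have hf : Primrec₂ f := by
    refine Primrec.option_bind (Primrec.decode.comp Primrec.snd) ?_
    exact Primrec.ite (hR.comp (Primrec.fst.comp Primrec.fst) Primrec.snd)
      (Primrec.option_some.comp Primrec.snd) (Primrec.const none)
  have hdom : ∀ a, (Nat.rfindOpt (f a)).Dom := by
    intro a
    obtain ⟨b, hb⟩ := h a
    exact Nat.rfindOpt_dom.2 ⟨Encodable.encode b, b, by simp [f, hb]⟩
  refine ⟨fun a => (Nat.rfindOpt (f a)).get (hdom a), ?_, fun a => ?_⟩
  · exact (Partrec.rfindOpt hf.to_comp).of_eq fun a => (Part.some_get (hdom a)).symm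
  · obtain ⟨n, hn⟩ := Nat.rfindOpt_spec (Part.get_mem (hdom a))
    simp only [f, Option.mem_def, Option.bind_eq_some_iff] at hn
    obtain ⟨b, -, hb⟩ := hn
    split_ifs at hb with hab
    have hb' : b = (Nat.rfindOpt (f a)).get (hdom a) := Option.some.inj hb
    exact (congrArg (R a) hb').mp hab

/-- A valid code describes a graph. -/
theorem CodeValid.exists_describes {c : STGCode} (h : CodeValid c) :
    ∃ G : STG (Fin c.1) (Fin c.2.1), c.Describes G := by
  classical
  let φ : {x // x ∈ c.2.2} → Fin c.1 × ℚ≥0 × Fin c.2.1 × Fin c.1 := fun x =>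
    (⟨x.1.1, (h.2 x x.2).1⟩, ratOfCode x.1.2.1, ⟨x.1.2.2.1, (h.2 x x.2).2.1⟩,
      ⟨x.1.2.2.2, (h.2 x x.2).2.2⟩)
  refine ⟨⟨(c.2.2.attach.map φ).toFinset⟩, Equiv.refl _, Equiv.refl _, fun t ht => ?_,
    fun x hx => ?_⟩
  · obtain ⟨x, -, rfl⟩ := List.mem_map.1 (List.mem_toFinset.1 ht)
    exact ⟨x.1, x.2, rfl, rfl, rfl, rfl⟩
  · exact ⟨φ ⟨x, hx⟩, List.mem_toFinset.2 (List.mem_map.2 ⟨⟨x, hx⟩, List.mem_attach _ _, rfl⟩),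
      rfl, rfl, rfl, rfl⟩

/-- The search relation is made total by accepting anything for invalid codes. Validity of a
certificate depends on the code alone, so existence need only be shown for one graph with that code,
taken on `Fin` types. -/
theorem exists_computable_rootCert : ∃ F : STGCode → RootCert, Computable F ∧
    ∀ c, CodeValid c → (F c).Valid (codeCount c) (1 + c.2.2.length) (codeOrder c) := by
  refine exists_computable_choice
    (R := fun (c : STGCode) (x : RootCert) => CodeValid c →
      x.Valid (codeCount c) (1 + c.2.2.length) (codeOrder c))
    ?_ fun c => ?_
  · have h1 : PrimrecPred fun y : STGCode × RootCert => ¬ CodeValid y.1 :=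
      (primrecPred_codeValid.comp Primrec.fst).not
    have hl : Primrec fun y : STGCode × RootCert => y.1.2.2 :=
      Primrec.snd.comp (Primrec.snd.comp Primrec.fst)
    have hu : Primrec₂ fun y : STGCode × RootCert => codeCount y.1 :=
      primrec_codeCount.comp (Primrec.fst.comp Primrec.fst) Primrec.snd
    have h2 := primrecPred_valid (x := fun y : STGCode × RootCert => y.2) Primrec.snd hu
      (Primrec.nat_add.comp (Primrec.const 1) (Primrec.list_length.comp hl))
      (primrec_codeOrder.comp Primrec.fst)
    exact (h1.or h2).of_eq fun y => imp_iff_not_or.symm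
  · by_cases hc : CodeValid c
    · obtain ⟨G, hG⟩ := hc.exists_describes
      have : Nonempty (Fin c.1) := ⟨⟨0, hc.1⟩⟩
      obtain ⟨α, hα, hC⟩ := hG.exists_isGrowth
      obtain ⟨x, hx⟩ := exists_valid_rootCert hα hC hG.isRecurrent
      exact ⟨x, fun _ => hx⟩
    · exact ⟨default, fun h => absurd h hc⟩

end Search

/-! ### Passage to real time and the theorem -/

section Rates

theorem TimedWord.log2_natCast {n : ℕ} (hn : 1 ≤ n) :
    TimedWord.log2 n = ((Real.logb 2 n : ℝ) : EReal) := by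
  have h : ((n : ℕ∞) : ℝ≥0∞) = ENNReal.ofReal n := by simp
  rw [TimedWord.log2, h, ENNReal.log_ofReal_of_pos (by exact_mod_cast hn), Real.logb,
    EReal.coe_div]

/-- Write the quotient as `log (U k) / k` times `k / T` with `k = ⌊T D⌋`; the second factor tends to
`D`. -/
theorem IsGrowth.tendsto_logb_floor {U : ℕ → ℕ} {γ : ℝ} (h : IsGrowth U γ) {D : ℕ} (hD : 0 < D) :
    Filter.Tendsto (fun T : ℝ => Real.logb 2 (U ⌊T * D⌋₊) / T) Filter.atTop
      (𝓝 (Real.logb 2 (γ ^ D))) := by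
  have hD' : (0 : ℝ) < D := by exact_mod_cast hD
  have h1 : Filter.Tendsto (fun T : ℝ => ⌊(D : ℝ) * T⌋₊) Filter.atTop Filter.atTop :=
    tendsto_nat_floor_atTop.comp (Filter.tendsto_id.const_mul_atTop hD')
  have h2 := (h.tendsto.comp h1).mul (tendsto_nat_floor_mul_div_atTop hD'.le)
  have h3 := h2.div_const (Real.log 2)
  have h4 : Real.log γ * D / Real.log 2 = Real.logb 2 (γ ^ D) := by
    rw [Real.logb, Real.log_pow, mul_comm]
  rw [h4] at h3
  refine h3.congr' ?_
  filter_upwards [Filter.eventually_ge_atTop 1] with T hT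
  have h5 : (⌊(D : ℝ) * T⌋₊ : ℝ) ≠ 0 := by
    have : 1 ≤ ⌊(D : ℝ) * T⌋₊ := by
      refine Nat.le_floor ?_
      have : (1 : ℝ) ≤ D := by exact_mod_cast hD
      push_cast
      nlinarith
    exact_mod_cast (by omega)
  rw [Function.comp, mul_comm T, Real.logb]
  field_simp

theorem IsGrowth.unique {U : ℕ → ℕ} {γ γ' : ℝ} (h : IsGrowth U γ) (h' : IsGrowth U γ') :
    γ = γ' :=
  Real.log_injOn_pos (Set.mem_Ioi.2 (one_pos.trans_le h.one_le))
    (Set.mem_Ioi.2 (one_pos.trans_le h'.one_le)) (tendsto_nhds_unique h.tendsto h'.tendsto)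

namespace STG

variable {Q A : Type*} {G : STG Q A} {D : ℕ}

theorem tendsto_log2_encard_events [Finite A] (hG : G.IsDenom D) {γ : ℝ}
    (hγ : IsGrowth (fun n => (eventSets (G.ticks D) n).ncard) γ) :
    Filter.Tendsto (fun T : ℝ => TimedWord.log2
      (TimedWord.events '' TimedWord.restrict G.language T).encard / (T : EReal)) Filter.atTop
      (𝓝 ((Real.logb 2 (γ ^ D) : ℝ) : EReal)) := by
  refine (EReal.tendsto_coe.2 (hγ.tendsto_logb_floor hG.1)).congr' ?_
  filter_upwards [Filter.eventually_ge_atTop 0] with T hT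
  rw [encard_events_restrict hG hT, ← (finite_eventSets _).cast_ncard_eq,
    TimedWord.log2_natCast (hγ.pos _), EReal.coe_div]

/-- Both sides count the event sets of the words of duration at most `n`, whatever the unit of time.
-/
theorem ncard_eventSets_ticks_mul {D' : ℕ} (hG : G.IsDenom D) (hG' : G.IsDenom D') (n : ℕ) :
    (eventSets (G.ticks D) (D * n)).ncard = (eventSets (G.ticks D') (D' * n)).ncard := by
  have h := (encard_events_restrict hG (T := n) n.cast_nonneg).symm.trans
    (encard_events_restrict hG' (T := n) n.cast_nonneg)
  have hfl : ∀ k : ℕ, ⌊(n : ℝ) * k⌋₊ = k * n := fun k => by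
    rw [mul_comm, ← Nat.cast_mul, Nat.floor_natCast]
  rw [hfl, hfl] at h
  exact congrArg ENat.toNat h

end STG

end Rates

/-- One computable function `F` serves all simply-timed graphs. -/
theorem mainTheorem3 :
    ∃ F : STGCode → AlgCode, Computable F ∧
      ∀ (Q : Type*) (A : Type*) [Fintype Q] [Fintype A] (G : STG Q A), G.language.Nonempty →
        ∃ β : ℝ,
          -- the growth rate exists and is finite
          G.HasGrowthRate β ∧
          -- it coincides with both bandwidths for small precisions
          (∃ ε₀ : NNReal, 0 < ε₀ ∧ ∀ ε : NNReal, 0 < ε → ε < ε₀ →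
            TimedWord.capacitiveBandwidth ε G.language = (β : EReal) ∧
            TimedWord.entropicBandwidth ε G.language = (β : EReal)) ∧
          -- it is given by the smallest root of the characteristic equation of the determinized
          -- 0-elimination of `G` (and is `0` if there is no root)
          ((∃ z₀ : ℝ, 0 < z₀ ∧
              G.zeroElim.determinize.charQuasiPoly (z₀ : ℂ) = 0 ∧
              (∀ z : ℂ, G.zeroElim.determinize.charQuasiPoly z = 0 → z₀ ≤ ‖z‖) ∧
              β = -Real.logb 2 z₀) ∨
            ((∀ z : ℂ, G.zeroElim.determinize.charQuasiPoly z ≠ 0) ∧ β = 0)) ∧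
          -- it is the logarithm of an algebraic number, computed exactly by `F`
          (∃ α : ℝ, 0 < α ∧ IsAlgebraic ℚ α ∧ β = Real.logb 2 α ∧
            ∀ c : STGCode, c.Describes G → (F c).Describes α) := by
  obtain ⟨F, hF, hFv⟩ := exists_computable_rootCert
  refine ⟨fun c => (F c).toAlgCode, primrec_toAlgCode.to_comp.comp hF,
    fun Q A _ _ G hne => ?_⟩
  obtain ⟨-, q, -⟩ := hne
  have : Nonempty Q := ⟨q⟩
  obtain ⟨D, hG⟩ := G.exists_isDenom
  have hD : (0 : ℝ) < D := by exact_mod_cast hG.1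
  obtain ⟨γ, hγ, hC⟩ := exists_isGrowth (U := fun n => (eventSets (G.ticks D) n).ncard)
    ncard_eventSets_pos (ncard_eventSets_add_le (G.finite_ticks D))
  have hγ0 : 0 < γ := one_pos.trans_le hγ.one_le
  have hlim := STG.tendsto_log2_encard_events hG hγ
  refine ⟨Real.logb 2 (γ ^ D), ?_, ⟨(1 / (2 * D) : ℝ≥0), ?_, fun ε _ hε => ?_⟩, ?_, γ ^ D,
    by positivity, ?_, rfl, fun c hc => ?_⟩
  · refine hlim.congr fun T => ?_
    rw [TimedWord.size, (STG.onGrid_restrict hG T).maxSeparated_eq hG.1 (by simpa using hD)]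
  · have : (0 : ℝ≥0) < D := by exact_mod_cast hG.1
    positivity
  · have hε' : (ε : ℝ) < 1 / (2 * D) := by exact_mod_cast hε
    constructor
    · refine Filter.Tendsto.limsup_eq (hlim.congr fun T => ?_)
      rw [TimedWord.capacity, (STG.onGrid_restrict hG T).maxSeparated_eq hG.1 hε']
    · refine Filter.Tendsto.limsup_eq (hlim.congr fun T => ?_)
      rw [TimedWord.entropy, (STG.onGrid_restrict hG T).minNet_eq hG.1 hε']
  · rcases STG.smallest_root hG hγ hC with ⟨h1, h2⟩ | ⟨h1, h2⟩
    · exact Or.inl ⟨(γ ^ D)⁻¹, by positivity, h1, h2, by rw [Real.logb_inv, neg_neg]⟩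
    · exact Or.inr ⟨h1, by simp [h2]⟩
  · have hrec := STG.isRecurrent_ncard_eventSets hG (M := ∑ t ∈ G.trans, tickCount D t.2.1)
      fun t ht => Finset.single_le_sum (f := fun t => tickCount D t.2.1)
        (fun _ _ => Nat.zero_le _) ht
    obtain ⟨p, hp0, hp⟩ := hrec.exists_annihilator
    exact IsAlgebraic.pow ⟨p, hp0, hγ.aeval_eq_zero hC hp⟩ D
  · obtain ⟨α, hα, hαC⟩ := hc.exists_isGrowth
    -- The code brings its own denominator. Counting at integer dates removes the dependence on it,
    -- so the certified number is the same `γ ^ D`.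
    have h1 : IsGrowth (codeCount c) (γ ^ D) := by
      have h2 : codeCount c = fun n => (eventSets (G.ticks D) (D * n)).ncard := by
        funext n
        rw [hc.codeCount_eq, STG.ncard_eventSets_ticks_mul hc.isDenom hG]
      rw [h2]
      exact hγ.comp_mul hG.1
    obtain rfl := hα.unique h1
    exact (hFv c hc.codeValid).describes h1 hαC hc.isRecurrent
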